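/- Let $\pi=\langle p_0p_1\cdots p_N\rangle$ be an open simple polygonal arc in the plane that is not a line segment, let $K$ be its convex hull, and let $\varphi\ge 0$. *Guide path, locales, tilts.* Let $w_1,\dots,w_n$ be the vertices of $K$ in the order in which $\pi$ visits them (the nodes of the guide path), and put $H=w_1$ (head), $X=w_2$, $Y=w_{n-1}$, $T=w_n$ (tail); the axis $\xi$ is the segment $HT$, directed from $H$ to $T$. Reflecting the picture if necessary, suppose that $X$ lies to the left of (above) the axis. A link $[w_i,w_{i+1}]$ is a crossing link if it does not lie on $\partial K$. Let $J-1$ be the number of crossing links, let $b_1<\dots<b_{J-1}$ be the indices $i$ of the crossing links $[w_i,w_{i+1}]$, and put $b_0=1$, $b_J=n-1$. The guide path divides $K$ into the $J$ locales $\mathcal L_j=\operatorname{conv}\{w_i: b_{j-1}\le i\le b_j+1\}$, $1\le j\le J$; the base of $\mathcal L_j$ is the directed segment $B_j$ from $w_{b_{j-1}}$ to $w_{b_j+1}$. The tilts are the directed angles $\tau_0=\angle(\xi,HX)$, $\tau_j=\angle(\xi,B_j)$ for $1\le j\le J$, and $\tau_{J+1}=\angle(\xi,YT)$, taken in $(-180^\circ,180^\circ]$.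 Let $\varphi_L=\tau_0-\tau_1$, and let $\varphi_R=\tau_J-\tau_{J+1}$ if $J$ is even and $\varphi_R=\tau_{J+1}-\tau_J$ if $J$ is odd (the left and right aspect angles). *Pairs of support lines.* For two support lines $m,n$ of $K$, $|\angle(m,n)|$ is the angle between $m$ and $n$ when they are directed so that $K$ lies to the left of one and to the right of the other; so it is $0$ for two parallel lines, and for intersecting lines it is the size of the sector containing $K$. An unordered pair of support lines has the $\Lambda$-property if its lines can be named $m$ and $n$ so that there are points $u,w$ of $\pi$ on $m$ and a point $v$ of $\pi$ on $n$ but not on $m$ with $v$ strictly between $u$ and $w$ in the parametric ordering of $\pi$. If $m\cap n$ is a point $P$, we say that $P$ lies on the side of a vertex $Q$ of $K$ if $Q$ belongs to the (possibly degenerate) triangle $Pxy$ for all $x\in m\cap K$ and $y\in n\cap K$, i.e. if $Q$ lies on the part of $K$ that faces $P$. Then $\varphi_L>0$ and $\varphi_R<0$, and: A. If $\varphi=0$, there is exactly one pair of (parallel) support lines of $K$ with $|\angle(m,n)|=0$ that has the $\Lambda$-property. B. If $0<\varphi\le\min\{\varphi_L,|\varphi_R|\}$, there are exactly two pairs of support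 lines of $K$ with $|\angle(m,n)|=\varphi$ that have the $\Lambda$-property. For one of them the point $m\cap n$ lies on the left, on the side of $H$ (and it equals $H$ exactly when $\varphi=\varphi_L$); for the other one it lies on the right, on the side of $T$ (and it equals $T$ exactly when $\varphi=|\varphi_R|$). C. If $\min\{\varphi_L,|\varphi_R|\}<\varphi\le\max\{\varphi_L,|\varphi_R|\}$, there is exactly one pair of support lines of $K$ with $|\angle(m,n)|=\varphi$ that has the $\Lambda$-property. D. If $\varphi>\max\{\varphi_L,|\varphi_R|\}$, there is no such pair. -/

import Mathlib

open scoped ComplexConjugate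

noncomputable section

namespace LambdaArc

/-! The plane is `ℂ`. -/

/-- The signed area `a × b`; it is positive when `b` points to the left of `a`. -/
def cross (a b : ℂ) : ℝ := (conj a * b).im

/-- The directed angle from the direction `a` to the direction `b`, in `(-π, π]`,
positive in the counterclockwise sense. -/
def dirAngle (a b : ℂ) : ℝ := Complex.arg (b / a)

/-- The parametrization on `[0, N]` of the polygonal arc `⟨p 0, p 1, …, p N⟩`. -/
def polyline (p : ℕ → ℂ) (t : ℝ) : ℂ :=
  AffineMap.lineMap (p ⌊t⌋₊) (p (⌊t⌋₊ + 1)) (t - (⌊t⌋₊ : ℝ))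

/-- The point set of the polygonal arc `⟨p 0, p 1, …, p N⟩`. -/
def arcSet (N : ℕ) (p : ℕ → ℂ) : Set ℂ := polyline p '' Set.Icc (0 : ℝ) N

/-- The arc `⟨p 0, p 1, …, p N⟩` is open and simple, and it is not a line segment. -/
def IsOpenSimpleNonSegment (N : ℕ) (p : ℕ → ℂ) : Prop :=
  Set.InjOn (polyline p) (Set.Icc (0 : ℝ) N) ∧ ¬ ∃ a b : ℂ, arcSet N p = segment ℝ a b

/-- The convex hull `K` of the arc. -/
def hull (N : ℕ) (p : ℕ → ℂ) : Set ℂ := convexHull ℝ (arcSet N p)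

/-! ### The guide path -/

open Classical in
/-- The nodes of the guide path: the vertices of the convex hull, in the order in which the arc
visits them. (Every vertex of the hull is a node of the arc.) -/
def guide (N : ℕ) (p : ℕ → ℂ) : List ℂ :=
  ((List.range (N + 1)).map p).filter (fun z => decide (z ∈ (hull N p).extremePoints ℝ))

/-- The number of nodes of the guide path. -/
def guideLen (N : ℕ) (p : ℕ → ℂ) : ℕ := (guide N p).length

/-- The nodes `w 0, w 1, …, w (n - 1)` of the guide path, `n = guideLen N p`. -/
def gnode (N : ℕ) (p : ℕ → ℂ) (i : ℕ) : ℂ := (guide N p).getD i 0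

/-- The head `H`, the first node of the guide path. -/
def head (N : ℕ) (p : ℕ → ℂ) : ℂ := gnode N p 0

/-- The tail `T`, the last node of the guide path. -/
def tail (N : ℕ) (p : ℕ → ℂ) : ℂ := gnode N p (guideLen N p - 1)

/-- The axis `ξ`, as the vector from `H` to `T`. -/
def axis (N : ℕ) (p : ℕ → ℂ) : ℂ := tail N p - head N p

/-! ### Locales and tilts -/

/-- The link `[w i, w (i + 1)]` of the guide path is a crossing link:
it does not lie on the boundary of the convex hull. -/
def IsCrossing (N : ℕ) (p : ℕ → ℂ) (i : ℕ) : Prop :=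
  ¬ segment ℝ (gnode N p i) (gnode N p (i + 1)) ⊆ frontier (hull N p)

open Classical in
/-- The indices `b 0 < b 1 < ⋯ < b J` of the links of the guide path that delimit the locales:
the first link `HX`, then all crossing links in order, then the last link `YT`.
The guide path cuts the hull, from `H` to `T`, into the `J` locales
`L j = conv {w i | b (j - 1) ≤ i ≤ b j + 1}`, `1 ≤ j ≤ J`. The cap of `L j` is the chain
`w (b (j - 1) + 1), …, w (b j)`, and its base is the edge `[w (b (j - 1)), w (b j + 1)]`
of the hull. -/
def breaks (N : ℕ) (p : ℕ → ℂ) : List ℕ :=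
  0 :: ((List.range (guideLen N p - 1)).filter (fun i => decide (IsCrossing N p i))
    ++ [guideLen N p - 2])

/-- The number `J` of locales. -/
def numLocales (N : ℕ) (p : ℕ → ℂ) : ℕ := (breaks N p).length - 1

/-- The oriented segment `B j`, as the pair of its initial and its final point: `B 0 = HX`,
`B j` is the base of the locale `L j` directed from `H` to `T` for `1 ≤ j ≤ J`,
and `B (J + 1) = YT`. -/
def base (N : ℕ) (p : ℕ → ℂ) (j : ℕ) : ℂ × ℂ :=
  if j = 0 then (gnode N p 0, gnode N p 1)
  else if j ≤ numLocales N p then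
    (gnode N p ((breaks N p).getD (j - 1) 0), gnode N p ((breaks N p).getD j 0 + 1))
  else (gnode N p (guideLen N p - 2), gnode N p (guideLen N p - 1))

/-- The tilt `τ j`: the directed angle from the axis to `B j`, in the picture that is
reflected in the axis, if necessary, so that `X` lies to the left of the axis from `H` to `T`
(that is, above it). -/
def tilt (N : ℕ) (p : ℕ → ℂ) (j : ℕ) : ℝ :=
  if 0 < cross (axis N p) (gnode N p 1 - head N p) then
    dirAngle (axis N p) ((base N p j).2 - (base N p j).1)
  else
    dirAngle (conj (axis N p)) (conj ((base N p j).2 - (base N p j).1))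

/-- The left aspect angle `φ_L`. -/
def aspectL (N : ℕ) (p : ℕ → ℂ) : ℝ := tilt N p 0 - tilt N p 1

/-- The right aspect angle `φ_R`. -/
def aspectR (N : ℕ) (p : ℕ → ℂ) : ℝ :=
  if Even (numLocales N p) then
    tilt N p (numLocales N p) - tilt N p (numLocales N p + 1)
  else
    tilt N p (numLocales N p + 1) - tilt N p (numLocales N p)

/-! ### Support lines and the Λ-property -/

/-- The line through `a` in the direction `d` (a line when `d ≠ 0`). -/
def lineThrough (a d : ℂ) : AffineSubspace ℝ ℂ := AffineSubspace.mk' a (Submodule.span ℝ {d})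

/-- `K` lies in the closed half-plane to the left of the line through `a` directed by `d`. -/
def OnLeft (K : Set ℂ) (a d : ℂ) : Prop := ∀ z ∈ K, 0 ≤ cross d (z - a)

/-- `K` lies in the closed half-plane to the right of the line through `a` directed by `d`. -/
def OnRight (K : Set ℂ) (a d : ℂ) : Prop := ∀ z ∈ K, cross d (z - a) ≤ 0

/-- `m` is a support line of `K`: a line that meets `K` and has `K` on one side. (Reversing `d`
exchanges the two sides.) -/
def IsSupportLine (K : Set ℂ) (m : AffineSubspace ℝ ℂ) : Prop :=
  ∃ a d : ℂ, a ∈ K ∧ d ≠ 0 ∧ m = lineThrough a d ∧ OnLeft K a d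

/-- `|∠(m, n)| = φ` for two support lines of `K`: `m` and `n` are directed so that `K` lies to the
left of one and to the right of the other, and the angle between these directions is `φ`.
The relation is symmetric in `m` and `n`. For lines that meet, `φ` is the size of that one of the
four sectors that contains `K`; for two parallel lines it is `0`. -/
def HasAngle (K : Set ℂ) (m n : AffineSubspace ℝ ℂ) (φ : ℝ) : Prop :=
  ∃ a d b e : ℂ, d ≠ 0 ∧ e ≠ 0 ∧ m = lineThrough a d ∧ n = lineThrough b e ∧
    OnLeft K a d ∧ OnRight K b e ∧ |dirAngle d e| = φ

/-- The Λ-property with `m` as the line touched twice: the arc meets `m` at two points `u` and `w`,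
and between them, in the parametric order, it meets `n` at a point `v` off `m`. -/
def HasLambda (N : ℕ) (p : ℕ → ℂ) (m n : AffineSubspace ℝ ℂ) : Prop :=
  ∃ r s t : ℝ, 0 ≤ r ∧ r < s ∧ s < t ∧ t ≤ N ∧
    polyline p r ∈ m ∧ polyline p t ∈ m ∧ polyline p s ∈ n ∧ polyline p s ∉ m

/-- The unordered pairs of support lines of the hull that form the angle `φ` and that, with one of
the lines taken as `m` and the other one as `n`, have the Λ-property. -/
def lambdaPairs (N : ℕ) (p : ℕ → ℂ) (φ : ℝ) : Set (Sym2 (AffineSubspace ℝ ℂ)) :=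
  {q | ∃ m n : AffineSubspace ℝ ℂ, q = s(m, n) ∧
    IsSupportLine (hull N p) m ∧ IsSupportLine (hull N p) n ∧
    HasAngle (hull N p) m n φ ∧ HasLambda N p m n}

/-- The lines `m` and `n` meet in exactly one point `P`, and `P` lies on the side of the point `Q`
of `K`: the part of `K` that faces `P`, cut off by the points of contact, contains `Q`, which means
that `Q` belongs to every triangle formed by `P`, a point of contact on `m` and one on `n`. -/
def MeetsBeyond (K : Set ℂ) (m n : AffineSubspace ℝ ℂ) (P Q : ℂ) : Prop :=
  (m : Set ℂ) ∩ (n : Set ℂ) = {P} ∧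
    ∀ x y : ℂ, x ∈ K → x ∈ m → y ∈ K → y ∈ n → Q ∈ convexHull ℝ ({P, x, y} : Set ℂ)

end LambdaArc

end

noncomputable section

namespace LambdaArc

/-! ### The signed area -/

/-! The arc matters only through its guide path. Number the hull vertices w 0, …, w m in the order
of the visits. The axis from w 0 to w m divides the other vertices into two chains, and simplicity
of the arc forces each chain to be visited from head to tail (`IsArcThrough.isGuide`). Hence, for
every i < m, each side has exactly one hull edge that spans the time i: it starts at or before w i
and ends after it. Direct both edges from the earlier to the later end, and let `opening` at i be
the directed angle from the right one to the left one. The passage of w (i + 1) replaces the edge on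
the side of this node and keeps the other edge. The angle strictly drops, and the support lines at w
(i + 1), measured against the kept edge, fill exactly the interval between the old and the new value
(`opening_step`).

In a pair with the Λ-property for nodes, one line contains two nodes, so it carries a hull edge; the
other line touches the hull at a node visited between the ends of this edge, and that node lies on
the opposite chain. So the pair consists of a spanning edge and a touching line opposite to it.
Angle intervals of consecutive nodes share one value, at which both nodes give the same pair of
edges (`touch_unique`). Thus there is one pair for each directed angle s between the last and the
first opening (`exists_nodePairs_param`). The first opening is positive and equals φ_L, the last one
is negative and equals φ_R (`aspectL_eq`, `aspectR_eq`); counting the s with |s| = φ gives all four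
cases (`nodePairs_count`). The sign of s tells whether the lines meet on the side of the head or of
the tail.

The topological input is `sum_normalArg_eq_zero`. For disjoint paths γ and δ, a continuous logarithm
of γ x - δ y has total increment zero around the parameter square. If the end points have supporting
half-planes, the four increments are differences of principal arguments. Disjoint subarcs with
interlaced end points would make all four of one sign. This yields the order on the chains and, in
`IsArcThrough.nodeLambda`, the passage from arbitrary contact points to nodes. -/

lemma cross_eq (a b : ℂ) : cross a b = a.re * b.im - a.im * b.re := by
  simp only [cross, Complex.mul_im, Complex.conj_re, Complex.conj_im]; ring

lemma re_neg_I_mul_conj_mul (d z : ℂ) : (-Complex.I * conj d * z).re = cross d z := by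
  simp only [cross_eq, Complex.mul_re, Complex.mul_im, Complex.neg_re, Complex.neg_im,
    Complex.conj_re, Complex.conj_im, Complex.I_re, Complex.I_im]; ring

/-- Two points of the closed right half-plane with positive signed area have increasing
arguments. -/
lemma arg_lt_arg_of_cross_pos {z w : ℂ} (hz : 0 ≤ z.re) (hw : 0 ≤ w.re)
    (h : 0 < cross z w) : z.arg < w.arg := by
  have hz0 : z ≠ 0 := by rintro rfl; simp [cross_eq] at h
  have hw0 : w ≠ 0 := by rintro rfl; simp [cross_eq] at h
  have h1 := abs_le.1 (Complex.abs_arg_le_pi_div_two_iff.2 hz)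
  have h2 := abs_le.1 (Complex.abs_arg_le_pi_div_two_iff.2 hw)
  by_contra hle
  push Not at hle
  -- Otherwise the difference of the arguments lies in [-π, 0], where the sine is nonpositive; but
  -- this sine is the signed area divided by the two norms.
  have h3 : Real.sin (w.arg - z.arg) ≤ 0 :=
    Real.sin_nonpos_of_nonpos_of_neg_pi_le (by linarith) (by linarith)
  rw [Real.sin_sub, Complex.sin_arg, Complex.cos_arg hz0, Complex.sin_arg,
    Complex.cos_arg hw0] at h3
  have hzp : 0 < ‖z‖ := norm_pos_iff.2 hz0
  have hwp : 0 < ‖w‖ := norm_pos_iff.2 hw0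
  have : w.im / ‖w‖ * (z.re / ‖z‖) - w.re / ‖w‖ * (z.im / ‖z‖) = cross z w / (‖z‖ * ‖w‖) := by
    rw [cross_eq]; field_simp
  rw [this] at h3
  exact absurd h3 (not_le.2 (by positivity))

lemma cross_mul_mul (c a b : ℂ) : cross (c * a) (c * b) = Complex.normSq c * cross a b := by
  simp only [cross_eq, Complex.mul_re, Complex.mul_im, Complex.normSq_apply]; ring

/-! ### Two disjoint paths in a convex set -/

/-- Two continuous logarithms of functions with a constant ratio have equal increments. -/
lemma log_increment_eq {g₁ g₂ : ℝ → ℂ} (h₁ : Continuous g₁) (h₂ : Continuous g₂) {c : ℂ}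
    (h : ∀ x, Complex.exp (g₁ x) = c * Complex.exp (g₂ x)) :
    g₁ 1 - g₁ 0 = g₂ 1 - g₂ 0 := by
  have key : ∀ x, ∃ n : ℤ, (g₁ x - g₂ x) = (g₁ 0 - g₂ 0) + n * (2 * Real.pi * Complex.I) := by
    intro x
    apply Complex.exp_eq_exp_iff_exists_int.1
    rw [Complex.exp_sub, Complex.exp_sub, h x, h 0, mul_div_cancel_right₀ _ (Complex.exp_ne_zero _),
      mul_div_cancel_right₀ _ (Complex.exp_ne_zero _)]
  choose n hn using key
  have hπ : (2 * Real.pi * Complex.I : ℂ) ≠ 0 := Complex.two_pi_I_ne_zero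
  -- The integer that counts the extra turns between the two branches depends continuously on x, so
  -- it is constant.
  have hcont : Continuous (fun x => ((n x : ℤ) : ℂ)) := by
    have : (fun x => ((n x : ℤ) : ℂ)) =
        fun x => ((g₁ x - g₂ x) - (g₁ 0 - g₂ 0)) / (2 * Real.pi * Complex.I) := by
      funext x; rw [hn x]; field_simp; ring
    rw [this]
    fun_prop
  have hcont' : Continuous n := by
    have : Topology.IsEmbedding (fun m : ℤ => ((m : ℝ) : ℂ)) :=
      (Complex.isometry_ofReal.isEmbedding).comp Int.isClosedEmbedding_coe_real.isEmbedding
    rw [this.continuous_iff]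
    simpa [Function.comp_def] using hcont
  have hc : n 1 = n 0 := PreconnectedSpace.constant inferInstance hcont'
  have e1 := hn 1
  have e0 := hn 0
  rw [hc] at e1
  linear_combination e1 - e0

/-- The parameter plane is convex, hence simply connected, so a nowhere vanishing function lifts
through the exponential. -/
lemma exists_continuous_log {f : ℝ × ℝ → ℂ} (hf : Continuous f) (h0 : ∀ z, f z ≠ 0) :
    ∃ L : ℝ × ℝ → ℂ, Continuous L ∧ ∀ z, Complex.exp (L z) = f z := by
  have hU : IsSimplyConnected (Set.univ : Set (ℝ × ℝ)) :=
    have := convex_univ.contractibleSpace (Set.univ_nonempty (α := ℝ × ℝ))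
    show SimplyConnectedSpace _ from inferInstance
  obtain ⟨L, hL, hE⟩ := Complex.exists_continuousOn_eqOn_exp_comp hU isOpen_univ
    (g := f) hf.continuousOn (by rintro ⟨z, -, hz⟩; exact h0 z hz)
  exact ⟨L, continuousOn_univ.1 hL, fun z => hE (Set.mem_univ z)⟩

/-- The argument of `z`, measured from the left normal of `d`. -/
def normalArg (d z : ℂ) : ℝ := (-Complex.I * conj d * z).arg

/-- Multiplication by k turns the half-plane at B into the right half-plane. Without the origin this
lies in the slit plane, so the principal logarithm is a continuous branch there and the increment is
a difference of principal arguments. -/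
lemma log_increment_of_halfPlane {γ : ℝ → ℂ} (hγ : Continuous γ) {B d : ℂ} (hd : d ≠ 0)
    (hB : ∀ x, γ x ≠ B) (hl : ∀ x, 0 ≤ cross d (γ x - B)) {g : ℝ → ℂ} (hg : Continuous g)
    {c : ℂ} (hc : c ≠ 0) (h : ∀ x, Complex.exp (g x) = c * (γ x - B)) :
    (g 1).im - (g 0).im = normalArg d (γ 1 - B) - normalArg d (γ 0 - B) := by
  set k : ℂ := -Complex.I * conj d with hk
  have hk0 : k ≠ 0 := by simp [hk, hd]
  have hne : ∀ x, k * (γ x - B) ≠ 0 := fun x => mul_ne_zero hk0 (sub_ne_zero.2 (hB x))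
  have hsl : ∀ x, k * (γ x - B) ∈ Complex.slitPlane := by
    intro x
    have h1 : 0 ≤ (k * (γ x - B)).re := by rw [hk, re_neg_I_mul_conj_mul]; exact hl x
    rcases h1.lt_or_eq with h1 | h1
    · exact Or.inl h1
    · refine Or.inr fun h2 => hne x (Complex.ext h1.symm h2)
  have hcont : Continuous fun x => Complex.log (k * (γ x - B)) :=
    Continuous.clog (by fun_prop) hsl
  have := log_increment_eq hg hcont (c := c / k) (fun x => by
    rw [h x, Complex.exp_log (hne x)]; field_simp)
  have h2 := congrArg Complex.im this
  rwa [Complex.sub_im, Complex.sub_im, Complex.log_im, Complex.log_im] at h2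

/-- The angles at the four end points of two disjoint paths that stay in the supporting
half-planes at these points add up to zero. -/
theorem sum_normalArg_eq_zero {γ δ : ℝ → ℂ} (hγ : Continuous γ) (hδ : Continuous δ)
    (hne : ∀ x y, γ x ≠ δ y) {dA dB dC dD : ℂ} (hdA : dA ≠ 0) (hdB : dB ≠ 0) (hdC : dC ≠ 0)
    (hdD : dD ≠ 0)
    (hA : ∀ x, 0 ≤ cross dA (δ x - γ 0)) (hB : ∀ x, 0 ≤ cross dB (γ x - δ 0))
    (hC : ∀ x, 0 ≤ cross dC (δ x - γ 1)) (hD : ∀ x, 0 ≤ cross dD (γ x - δ 1)) :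
    (normalArg dB (γ 1 - δ 0) - normalArg dB (γ 0 - δ 0)) +
    (normalArg dC (δ 1 - γ 1) - normalArg dC (δ 0 - γ 1)) +
    (normalArg dD (γ 0 - δ 1) - normalArg dD (γ 1 - δ 1)) +
    (normalArg dA (δ 0 - γ 0) - normalArg dA (δ 1 - γ 0)) = 0 := by
  -- The increments of one logarithm along the four sides of the unit square cancel. Seen from γ 0
  -- and γ 1 the relevant vector is δ y - γ x, the negative of the function, whence the constant -1
  -- below.
  obtain ⟨L, hL, hE⟩ := exists_continuous_log (f := fun z : ℝ × ℝ => γ z.1 - δ z.2)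
    (by fun_prop) (fun z => sub_ne_zero.2 (hne _ _))
  have eB := log_increment_of_halfPlane hγ hdB (fun x => hne x 0) hB
    (g := fun x => L (x, 0)) (by fun_prop) one_ne_zero (fun x => by rw [hE, one_mul])
  have eD := log_increment_of_halfPlane hγ hdD (fun x => hne x 1) hD
    (g := fun x => L (x, 1)) (by fun_prop) one_ne_zero (fun x => by rw [hE, one_mul])
  have eA := log_increment_of_halfPlane hδ hdA (fun x => (hne 0 x).symm) hA
    (g := fun x => L (0, x)) (by fun_prop) (neg_ne_zero.2 one_ne_zero)
    (fun x => by rw [hE]; ring)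
  have eC := log_increment_of_halfPlane hδ hdC (fun x => (hne 1 x).symm) hC
    (g := fun x => L (1, x)) (by fun_prop) (neg_ne_zero.2 one_ne_zero)
    (fun x => by rw [hE]; ring)
  linarith

lemma normalArg_lt {d z w : ℂ} (hd : d ≠ 0) (hz : 0 ≤ cross d z) (hw : 0 ≤ cross d w)
    (h : 0 < cross z w) : normalArg d z < normalArg d w := by
  refine arg_lt_arg_of_cross_pos ?_ ?_ ?_
  · rw [re_neg_I_mul_conj_mul]; exact hz
  · rw [re_neg_I_mul_conj_mul]; exact hw
  · rw [cross_mul_mul]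
    exact mul_pos (Complex.normSq_pos.2 (by simp [hd])) h

/-! ### Orientation of triples and convex position -/

/-- Twice the signed area of the triangle `a b c`. -/
def orient (a b c : ℂ) : ℝ := cross (b - a) (c - a)

lemma orient_eq (a b c : ℂ) : orient a b c =
    (b.re - a.re) * (c.im - a.im) - (b.im - a.im) * (c.re - a.re) := by
  simp [orient, cross_eq]

lemma orient_rotate (a b c : ℂ) : orient b c a = orient a b c := by
  simp only [orient_eq]; ring

lemma orient_swap (a b c : ℂ) : orient a c b = -orient a b c := by
  simp only [orient_eq]; ring

lemma exists_real_mul_of_cross_eq_zero {d z : ℂ} (hd : d ≠ 0) (h : cross d z = 0) :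
    ∃ r : ℝ, z = r * d := by
  have hn : Complex.normSq d ≠ 0 := by simpa using hd
  rw [cross_eq] at h
  refine ⟨(d.re * z.re + d.im * z.im) / Complex.normSq d, ?_⟩
  apply Complex.ext
  · simp only [Complex.mul_re, Complex.ofReal_re, Complex.ofReal_im]
    rw [Complex.normSq_apply] at *
    rw [zero_mul, sub_zero, div_mul_eq_mul_div, eq_div_iff hn]
    linear_combination -d.im * h
  · simp only [Complex.mul_im, Complex.ofReal_re, Complex.ofReal_im]
    rw [Complex.normSq_apply] at *
    rw [zero_mul, add_zero, div_mul_eq_mul_div, eq_div_iff hn]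
    linear_combination d.re * h

lemma mem_convexHull_triple {a b c d : ℂ} {u v t : ℝ} (hu : 0 ≤ u) (hv : 0 ≤ v) (ht : 0 ≤ t)
    (h : u + v + t = 1) (hd : d = u * a + v * b + t * c) :
    d ∈ convexHull ℝ ({a, b, c} : Set ℂ) := by
  have hc := convex_convexHull ℝ ({a, b, c} : Set ℂ)
  have ha : a ∈ convexHull ℝ ({a, b, c} : Set ℂ) := subset_convexHull ℝ _ (by simp)
  have hb : b ∈ convexHull ℝ ({a, b, c} : Set ℂ) := subset_convexHull ℝ _ (by simp)
  have hcc : c ∈ convexHull ℝ ({a, b, c} : Set ℂ) := subset_convexHull ℝ _ (by simp)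
  have := hc.sum_mem (t := Finset.univ) (w := ![u, v, t]) (z := ![a, b, c])
    (by intro i _; fin_cases i <;> simpa) (by simpa [Fin.sum_univ_three] using h)
    (by intro i _; fin_cases i <;> simpa)
  simpa [Fin.sum_univ_three, hd] using this

/-- The barycentric coordinates of d are the signed areas of the three subtriangles divided by that
of the whole triangle. -/
lemma mem_convexHull_of_orient {a b c d : ℂ} (h : 0 < orient a b c) (h1 : 0 ≤ orient a b d)
    (h2 : 0 ≤ orient b c d) (h3 : 0 ≤ orient c a d) :
    d ∈ convexHull ℝ ({a, b, c} : Set ℂ) := by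
  refine mem_convexHull_triple (div_nonneg h2 h.le) (div_nonneg h3 h.le) (div_nonneg h1 h.le)
    ?_ ?_
  · field_simp
    simp only [orient_eq]; ring
  · have h0 : orient a b c ≠ 0 := h.ne'
    apply Complex.ext
    · simp only [Complex.add_re, Complex.mul_re, Complex.ofReal_re, Complex.ofReal_im]
      field_simp
      simp only [orient_eq]; ring
    · simp only [Complex.add_im, Complex.mul_im, Complex.ofReal_re, Complex.ofReal_im]
      field_simp
      simp only [orient_eq]; ring

/-- The node `w j` lies strictly on the side `σ` of the axis from `w 0` to `w m`. -/
def Side (m : ℕ) (w : ℕ → ℂ) (σ : ℝ) (j : ℕ) : Prop := 0 < σ * orient (w 0) (w m) (w j)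

/-- The node `w j` belongs to the closed chain of the hull on the side `σ` of the axis. -/
def Chain (m : ℕ) (w : ℕ → ℂ) (σ : ℝ) (j : ℕ) : Prop := j = 0 ∨ j = m ∨ Side m w σ j

/-- `w a` and `w b` are consecutive nodes of the chain on the side `σ`. -/
structure IsEdge (m : ℕ) (w : ℕ → ℂ) (σ : ℝ) (a b : ℕ) : Prop where
  lt : a < b
  le : b ≤ m
  left : Chain m w σ a
  right : Chain m w σ b
  not_side : ∀ k, a < k → k < b → ¬ Side m w σ k

/-- A guide path: its nodes are in convex position, and on each side of its axis they are visited
in the order from the head to the tail. -/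
structure IsGuide (m : ℕ) (w : ℕ → ℂ) : Prop where
  two_le : 2 ≤ m
  notMem : ∀ i ≤ m, w i ∉ convexHull ℝ (w '' {j | j ≤ m ∧ j ≠ i})
  order : ∀ σ : ℝ, σ = 1 ∨ σ = -1 → ∀ i j, i < j → j ≤ m → Side m w σ i → Side m w σ j →
    0 < σ * orient (w 0) (w j) (w i)

section ConvexPosition

variable {m : ℕ} {w : ℕ → ℂ}

lemma ne_of_notMem (hw : ∀ i ≤ m, w i ∉ convexHull ℝ (w '' {j | j ≤ m ∧ j ≠ i}))
    {i j : ℕ} (hi : i ≤ m) (hj : j ≤ m) (h : i ≠ j) : w i ≠ w j := fun e =>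
  hw i hi (subset_convexHull ℝ _ ⟨j, ⟨hj, h.symm⟩, e.symm⟩)

lemma notMem_triangle (hw : ∀ i ≤ m, w i ∉ convexHull ℝ (w '' {j | j ≤ m ∧ j ≠ i}))
    {i j k l : ℕ} (hi : i ≤ m) (hj : j ≤ m) (hk : k ≤ m) (hl : l ≤ m)
    (h1 : i ≠ l) (h2 : j ≠ l) (h3 : k ≠ l) :
    w l ∉ convexHull ℝ ({w i, w j, w k} : Set ℂ) := by
  intro h
  refine hw l hl (convexHull_mono ?_ h)
  rintro z (rfl | rfl | rfl)
  exacts [⟨i, ⟨hi, h1⟩, rfl⟩, ⟨j, ⟨hj, h2⟩, rfl⟩, ⟨k, ⟨hk, h3⟩, rfl⟩]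

/-- Of three collinear nodes one lies between the other two, against convex position. The coordinate
r of w k on the line, with w i at 0 and w j at 1, tells which one. -/
lemma orient_ne_zero (hw : ∀ i ≤ m, w i ∉ convexHull ℝ (w '' {j | j ≤ m ∧ j ≠ i}))
    {i j k : ℕ} (hi : i ≤ m) (hj : j ≤ m) (hk : k ≤ m)
    (h1 : i ≠ j) (h2 : i ≠ k) (h3 : j ≠ k) : orient (w i) (w j) (w k) ≠ 0 := by
  intro h
  obtain ⟨r, hr⟩ := exists_real_mul_of_cross_eq_zero
    (sub_ne_zero.2 (ne_of_notMem hw hi hj h1).symm) h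
  have hr' : w k = w i + r * (w j - w i) := by linear_combination hr
  rcases le_or_gt r 0 with h0 | h0
  · refine notMem_triangle hw hj hk hk hi h1.symm h2.symm h2.symm
      (mem_convexHull_triple (u := -r / (1 - r)) (v := 1 / (1 - r)) (t := 0)
        (div_nonneg (by linarith) (by linarith)) (div_nonneg (by linarith) (by linarith)) le_rfl
        ?_ ?_)
    · have : 1 - r ≠ 0 := by linarith
      field_simp; ring
    · have : (1 - r : ℂ) ≠ 0 := by
        have : (1 - r : ℝ) ≠ 0 := by linarith
        exact_mod_cast this
      rw [hr']; push_cast; field_simp; ring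
  · rcases le_or_gt r 1 with h4 | h4
    · refine notMem_triangle hw hi hj hj hk h2 h3 h3
        (mem_convexHull_triple (u := 1 - r) (v := r) (t := 0)
          (by linarith) h0.le le_rfl (by ring) ?_)
      rw [hr']; push_cast; ring
    · refine notMem_triangle hw hi hk hk hj h1 h3.symm h3.symm
        (mem_convexHull_triple (u := (r - 1) / r) (v := 1 / r) (t := 0)
          (div_nonneg (by linarith) h0.le) (div_nonneg zero_le_one h0.le) le_rfl ?_ ?_)
      · field_simp; ring
      · have : (r : ℂ) ≠ 0 := by exact_mod_cast h0.ne'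
        rw [hr']; push_cast; field_simp; ring

lemma ne_of_orient_ne_zero {i j k : ℕ} (h : orient (w i) (w j) (w k) ≠ 0) :
    i ≠ j ∧ i ≠ k ∧ j ≠ k := by
  refine ⟨?_, ?_, ?_⟩ <;> rintro rfl <;> apply h <;> simp only [orient_eq] <;> ring

/-- The angular order around a node is transitive because of convex position: if the first claim
failed, w h would lie in the triangle of w a, w b, w c; if the second failed, w b would lie in the
triangle of w h, w a, w c. -/
lemma orient_trans_pos (hw : ∀ i ≤ m, w i ∉ convexHull ℝ (w '' {j | j ≤ m ∧ j ≠ i}))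
    {h a b c : ℕ} (hh : h ≤ m) (ha : a ≤ m) (hb : b ≤ m) (hc : c ≤ m)
    (h1 : 0 < orient (w h) (w a) (w b)) (h2 : 0 < orient (w h) (w b) (w c)) :
    0 < orient (w h) (w a) (w c) ∧ 0 < orient (w a) (w b) (w c) := by
  obtain ⟨n1, n2, n3⟩ := ne_of_orient_ne_zero h1.ne'
  obtain ⟨-, n4, n5⟩ := ne_of_orient_ne_zero h2.ne'
  have n6 : a ≠ c := by
    rintro rfl
    rw [orient_swap] at h2; linarith
  have e3 : 0 < orient (w h) (w a) (w c) := by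
    by_contra h3
    have h3' : 0 < orient (w h) (w c) (w a) := by
      have := orient_ne_zero hw hh ha hc n1 n4 n6
      rw [orient_swap]; rcases lt_or_gt_of_ne this with h | h <;> linarith
    refine notMem_triangle hw ha hb hc hh n1.symm n2.symm n4.symm
      (mem_convexHull_of_orient ?_ ?_ ?_ ?_)
    · have : orient (w a) (w b) (w c) = orient (w h) (w a) (w b) + orient (w h) (w b) (w c)
        + orient (w h) (w c) (w a) := by simp only [orient_eq]; ring
      linarith
    · rw [orient_rotate]; exact h1.le
    · rw [orient_rotate]; exact h2.le
    · rw [orient_rotate]; exact h3'.le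
  refine ⟨e3, ?_⟩
  by_contra h4
  refine notMem_triangle hw hh ha hc hb n2 n3 n5.symm (mem_convexHull_of_orient e3 h1.le ?_ ?_)
  · rw [orient_swap]; linarith
  · rw [orient_rotate, orient_rotate, orient_rotate] at *
    rw [← orient_rotate]; exact h2.le

/-- The case σ = -1 is the case σ = 1 read backwards, with a and c exchanged. -/
lemma orient_trans (hw : ∀ i ≤ m, w i ∉ convexHull ℝ (w '' {j | j ≤ m ∧ j ≠ i}))
    {σ : ℝ} (hσ : σ = 1 ∨ σ = -1)
    {h a b c : ℕ} (hh : h ≤ m) (ha : a ≤ m) (hb : b ≤ m) (hc : c ≤ m)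
    (h1 : 0 < σ * orient (w h) (w a) (w b)) (h2 : 0 < σ * orient (w h) (w b) (w c)) :
    0 < σ * orient (w h) (w a) (w c) ∧ 0 < σ * orient (w a) (w b) (w c) := by
  rcases hσ with rfl | rfl
  · simp only [one_mul] at *
    exact orient_trans_pos hw hh ha hb hc h1 h2
  · have := orient_trans_pos hw hh hc hb ha (by rw [orient_swap]; linarith)
      (by rw [orient_swap]; linarith)
    constructor
    · rw [orient_swap]; linarith [this.1]
    · have e : orient (w a) (w b) (w c) = -orient (w c) (w b) (w a) := by
        simp only [orient_eq]; ring
      rw [e]; linarith [this.2]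

end ConvexPosition

/-! ### The edges of the hull of a guide path -/

section Guide

variable {m : ℕ} {w : ℕ → ℂ} {σ : ℝ}

lemma neg_sign (hσ : σ = 1 ∨ σ = -1) : -σ = 1 ∨ -σ = -1 := by
  rcases hσ with rfl | rfl <;> simp

lemma Side.pos {j : ℕ} (h : Side m w σ j) : 0 < j := by
  rcases Nat.eq_zero_or_pos j with rfl | h'
  · simp [Side, orient_eq] at h
  · exact h'

lemma Side.ne_last {j : ℕ} (h : Side m w σ j) : j ≠ m := by
  rintro rfl
  have : orient (w 0) (w j) (w j) = 0 := by simp only [orient_eq]; ring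
  simp [Side, this] at h

lemma Side.not_neg {j : ℕ} (h : Side m w σ j) : ¬ Side m w (-σ) j := by
  intro h'
  unfold Side at *
  linarith

lemma Side.not_chain_neg {j : ℕ} (h : Side m w σ j) : ¬ Chain m w (-σ) j := by
  rintro (h' | h' | h')
  exacts [h.pos.ne' h', h.ne_last h', h.not_neg h']

lemma IsGuide.ne (g : IsGuide m w) {i j : ℕ} (hi : i ≤ m) (hj : j ≤ m) (h : i ≠ j) :
    w i ≠ w j := ne_of_notMem g.notMem hi hj h

lemma IsGuide.orient_ne (g : IsGuide m w) {i j k : ℕ} (hi : i ≤ m) (hj : j ≤ m) (hk : k ≤ m)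
    (h1 : i ≠ j) (h2 : i ≠ k) (h3 : j ≠ k) : orient (w i) (w j) (w k) ≠ 0 :=
  orient_ne_zero g.notMem hi hj hk h1 h2 h3

lemma IsGuide.trans (g : IsGuide m w) (hσ : σ = 1 ∨ σ = -1)
    {h a b c : ℕ} (hh : h ≤ m) (ha : a ≤ m) (hb : b ≤ m) (hc : c ≤ m)
    (h1 : 0 < σ * orient (w h) (w a) (w b)) (h2 : 0 < σ * orient (w h) (w b) (w c)) :
    0 < σ * orient (w h) (w a) (w c) ∧ 0 < σ * orient (w a) (w b) (w c) :=
  orient_trans g.notMem hσ hh ha hb hc h1 h2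

lemma IsGuide.side_or (g : IsGuide m w) (hσ : σ = 1 ∨ σ = -1) {j : ℕ} (h0 : 0 < j) (hj : j < m) :
    Side m w σ j ∨ Side m w (-σ) j := by
  have := g.orient_ne (Nat.zero_le _) le_rfl hj.le (h0.trans hj).ne h0.ne hj.ne'
  unfold Side
  rcases hσ with rfl | rfl <;> rcases lt_or_gt_of_ne this with h | h
  · right; linarith
  · left; linarith
  · left; linarith
  · right; linarith

lemma IsGuide.chain_or (g : IsGuide m w) (hσ : σ = 1 ∨ σ = -1) {j : ℕ} (hj : j ≤ m) :
    Chain m w σ j ∨ Chain m w (-σ) j := by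
  rcases Nat.eq_zero_or_pos j with h | h
  · exact Or.inl (Or.inl h)
  rcases hj.eq_or_lt with h' | h'
  · exact Or.inl (Or.inr (Or.inl h'))
  exact (g.side_or hσ h h').imp (fun h => Or.inr (Or.inr h)) (fun h => Or.inr (Or.inr h))

/-- In the order around the head that starts on the side `-σ`, the nodes of the chain on the
side `-σ` come before the nodes of the chain on the side `σ`. -/
lemma IsGuide.orient_head_pos (g : IsGuide m w) (hσ : σ = 1 ∨ σ = -1) {i j : ℕ} (hi : i ≤ m)
    (hj : j ≤ m) (hl : Side m w (-σ) i) (hu : Side m w σ j) :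
    0 < σ * orient (w 0) (w i) (w j) := by
  refine (g.trans hσ (Nat.zero_le _) hi le_rfl hj ?_ hu).1
  unfold Side at hl
  rw [orient_swap]; linarith

lemma IsGuide.orient_head_nonneg (g : IsGuide m w) (hσ : σ = 1 ∨ σ = -1) {i j : ℕ} (hi : i ≤ m)
    (hj : j ≤ m) (hl : Chain m w (-σ) i) (hu : Chain m w σ j) :
    0 ≤ σ * orient (w 0) (w i) (w j) := by
  rcases hl with rfl | rfl | hl
  · simp [orient_eq]
  · rcases hu with rfl | rfl | hu
    · simp [orient_eq]
    · simp [orient_eq, mul_comm]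
    · exact hu.le
  · rcases hu with rfl | rfl | hu
    · simp [orient_eq]
    · unfold Side at hl; rw [orient_swap]; linarith
    · exact (g.orient_head_pos hσ hi hj hl hu).le

lemma IsGuide.orient_tail_nonneg (g : IsGuide m w) (hσ : σ = 1 ∨ σ = -1) {i j : ℕ} (hi : i ≤ m)
    (hj : j ≤ m) (hl : Chain m w (-σ) i) (hu : Chain m w σ j) :
    0 ≤ σ * orient (w m) (w j) (w i) := by
  have e0 : orient (w m) (w j) (w 0) = orient (w 0) (w m) (w j) := by
    simp only [orient_eq]; ring
  have e1 : orient (w m) (w 0) (w i) = -orient (w 0) (w m) (w i) := by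
    simp only [orient_eq]; ring
  rcases hl with rfl | rfl | hl
  · rw [e0]
    rcases hu with rfl | rfl | hu
    · simp [orient_eq]
    · simp [orient_eq, mul_comm]
    · exact hu.le
  · simp [orient_eq]
  · rcases hu with rfl | rfl | hu
    · rw [e1]; unfold Side at hl; linarith
    · simp [orient_eq]
    · have := (g.trans hσ (Nat.zero_le _) hi le_rfl hj
        (by unfold Side at hl; rw [orient_swap]; linarith) hu).2
      rw [orient_rotate]; exact this.le

variable (m w σ) in
-- The edge runs from the last chain node at or before the time i to the first one after it. Both
-- exist because head and tail belong to both chains.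
lemma exists_isEdge {i : ℕ} (hi : i < m) : ∃ a b, IsEdge m w σ a b ∧ a ≤ i ∧ i < b := by
  classical
  obtain ⟨a, ha, hamax⟩ : ∃ a, (a ≤ i ∧ Chain m w σ a) ∧ ∀ k, a < k → k ≤ i →
      ¬ Chain m w σ k := by
    have hex : ∃ a ≤ i, Chain m w σ a := ⟨0, Nat.zero_le _, Or.inl rfl⟩
    refine ⟨Nat.findGreatest (Chain m w σ) i,
      ⟨Nat.findGreatest_le _, Nat.findGreatest_spec (Nat.zero_le i) (Or.inl rfl)⟩,
      fun k h1 h2 => Nat.findGreatest_is_greatest h1 h2⟩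
  have hb : ∃ b, i < b ∧ Chain m w σ b := ⟨m, hi, Or.inr (Or.inl rfl)⟩
  refine ⟨a, Nat.find hb, ⟨ha.1.trans_lt (Nat.find_spec hb).1, ?_, ha.2, (Nat.find_spec hb).2,
    fun k h1 h2 hk => ?_⟩, ha.1, (Nat.find_spec hb).1⟩
  · exact Nat.find_min' hb ⟨hi, Or.inr (Or.inl rfl)⟩
  · rcases le_or_gt k i with h | h
    · exact hamax k h1 h (Or.inr (Or.inr hk))
    · exact Nat.find_min hb h2 ⟨h, Or.inr (Or.inr hk)⟩

lemma IsEdge.not_chain {a b k : ℕ} (h : IsEdge m w σ a b) (h1 : a < k) (h2 : k < b) :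
    ¬ Chain m w σ k := by
  rintro (h' | h' | h')
  · omega
  · have := h.le; omega
  · exact h.not_side k h1 h2 h'

/-- The links of a chain that span a given time agree. -/
lemma IsEdge.unique {a b a' b' i : ℕ} (h : IsEdge m w σ a b) (h' : IsEdge m w σ a' b')
    (h1 : a ≤ i) (h2 : i < b) (h3 : a' ≤ i) (h4 : i < b') : a = a' ∧ b = b' := by
  constructor
  · rcases lt_trichotomy a a' with hl | hl | hl
    · exact absurd h'.left (h.not_chain hl (by omega))
    · exact hl
    · exact absurd h.left (h'.not_chain hl (by omega))
  · rcases lt_trichotomy b b' with hl | hl | hl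
    · exact absurd h.right (h'.not_chain (by omega) hl)
    · exact hl
    · exact absurd h'.right (h.not_chain (by omega) hl)

/-- The consecutive nodes of a chain form an edge of the hull. -/
lemma IsEdge.strict (g : IsGuide m w) (hσ : σ = 1 ∨ σ = -1) {a b : ℕ} (h : IsEdge m w σ a b)
    {k : ℕ} (hk : k ≤ m) (hka : k ≠ a) (hkb : k ≠ b) :
    0 < σ * orient (w b) (w a) (w k) := by
  have hab := h.lt
  have hbm := h.le
  have h0m : 0 ≤ m := Nat.zero_le _
  have eA : orient (w m) (w 0) (w k) = -orient (w 0) (w m) (w k) := by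
    simp only [orient_eq]; ring
  have hcases : k = 0 ∨ k = m ∨ Side m w σ k ∨ Side m w (-σ) k := by
    rcases Nat.eq_zero_or_pos k with h' | h'
    · exact Or.inl h'
    rcases hk.eq_or_lt with h'' | h''
    · exact Or.inr (Or.inl h'')
    · exact Or.inr (Or.inr (g.side_or hσ h' h''))
  rcases h.left with rfl | rfl | ha
  · rcases h.right with rfl | rfl | hb
    · omega
    · rcases hcases with rfl | rfl | h' | h'
      · omega
      · omega
      · exact absurd h' (h.not_side k (by omega) (by omega))
      · rw [eA]; unfold Side at h'; linarith
    · have e : orient (w b) (w 0) (w k) = orient (w 0) (w k) (w b) := by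
        simp only [orient_eq]; ring
      rw [e]
      rcases hcases with rfl | rfl | h' | h'
      · omega
      · exact hb
      · exact g.order σ hσ b k (by
          by_contra hlt; exact h.not_side k (by omega) (by omega) h') hk hb h'
      · exact g.orient_head_pos hσ hk hbm h' hb
  · omega
  · rcases h.right with rfl | rfl | hb
    · omega
    · rcases hcases with rfl | rfl | h' | h'
      · rw [orient_rotate]; exact ha
      · omega
      · have hlt : k < a := by
          by_contra hlt
          have := h'.ne_last
          exact h.not_side k (by omega) (by omega) h'
        exact (g.trans hσ h0m le_rfl (by omega) hk ha (g.order σ hσ k a hlt (by omega) h' ha)).2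
      · have := (g.trans hσ h0m hk le_rfl (by omega)
          (by unfold Side at h'; rw [orient_swap]; linarith) ha).2
        rwa [← orient_rotate] at this
    · have hba := g.order σ hσ a b hab hbm ha hb
      rcases hcases with rfl | rfl | h' | h'
      · rwa [← orient_rotate] at hba
      · have := (g.trans hσ h0m le_rfl hbm (by omega) hb hba).2
        rwa [← orient_rotate] at this
      · rcases lt_or_gt_of_ne hka with hlt | hlt
        · exact (g.trans hσ h0m hbm (by omega) hk hba
            (g.order σ hσ k a hlt (by omega) h' ha)).2
        · have hbk : b < k := by
            by_contra hlt
            exact h.not_side k (by omega) (by omega) h'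
          have := (g.trans hσ h0m hk hbm (by omega) (g.order σ hσ b k hbk hk hb h') hba).2
          rwa [← orient_rotate] at this
      · have := (g.trans hσ h0m hk hbm (by omega) (g.orient_head_pos hσ hk hbm h' hb) hba).2
        rwa [← orient_rotate] at this

/-- The nodes `w i` and `w j` span a line with all nodes on one side. -/
def SameSide (m : ℕ) (w : ℕ → ℂ) (i j : ℕ) : Prop :=
  ∀ k ≤ m, ∀ l ≤ m, 0 ≤ orient (w i) (w j) (w k) * orient (w i) (w j) (w l)

lemma SameSide.false_of_pos (hs : SameSide m w i j) (hσ : σ = 1 ∨ σ = -1) {k l : ℕ}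
    (hk : k ≤ m) (hl : l ≤ m)
    (h1 : 0 < σ * orient (w i) (w j) (w k)) (h2 : 0 < σ * orient (w i) (w l) (w j)) : False := by
  have := hs k hk l hl
  rw [orient_swap] at h2
  rcases hσ with rfl | rfl <;> nlinarith

/-- Nodes on different sides of the axis do not span an edge of the hull. -/
lemma SameSide.not_side (g : IsGuide m w) (hσ : σ = 1 ∨ σ = -1) {i j : ℕ} (hi : i ≤ m) (hj : j ≤ m)
    (hs : SameSide m w i j) (h1 : Side m w σ i) (h2 : Side m w (-σ) j) : False := by
  have e1 := g.orient_head_pos hσ hj hi h2 h1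
  have e2 := (g.trans hσ (Nat.zero_le _) hj le_rfl hi
    (by unfold Side at h2; rw [orient_swap]; linarith) h1).2
  refine hs.false_of_pos hσ (k := m) (l := 0) le_rfl (Nat.zero_le _) ?_ ?_
  · rwa [orient_rotate] at e2
  · rwa [orient_rotate] at e1

/-- A node of the same chain visited in between would lie on one side of the line through w i and w
j, with the head or the tail on the other. The pair 0, m is excluded because the axis may itself be
a hull edge with a whole chain on one side of it. -/
lemma SameSide.not_side_between (g : IsGuide m w) (hσ : σ = 1 ∨ σ = -1) {i j k : ℕ}
    (hj : j ≤ m) (hs : SameSide m w i j) (h1 : Chain m w σ i) (h2 : Chain m w σ j)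
    (hne : i ≠ 0 ∨ j ≠ m) (hik : i < k) (hkj : k < j) : ¬ Side m w σ k := by
  intro hk
  have hkm : k ≤ m := by omega
  have him : i ≤ m := by omega
  rcases h1 with rfl | rfl | h1
  · rcases h2 with rfl | rfl | h2
    · omega
    · omega
    · exact hs.false_of_pos hσ hkm le_rfl (g.order σ hσ k j hkj hj hk h2) h2
  · omega
  · have hki := g.order σ hσ i k hik hkm h1 hk
    rcases h2 with rfl | rfl | h2
    · omega
    · have e := (g.trans hσ (Nat.zero_le _) le_rfl hkm him hk hki).2
      rw [orient_rotate] at e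
      refine hs.false_of_pos hσ hkm (Nat.zero_le _) e ?_
      unfold Side at h1
      rwa [orient_rotate] at h1
    · have e := (g.trans hσ (Nat.zero_le _) hj hkm him (g.order σ hσ k j hkj hj hk h2) hki).2
      have e' := g.order σ hσ i j (by omega) hj h1 h2
      rw [orient_rotate] at e e'
      exact hs.false_of_pos hσ hkm (Nat.zero_le _) e e'

/-- An edge of the hull joins consecutive nodes of one of the two chains. -/
lemma SameSide.isEdge (g : IsGuide m w) {i j : ℕ} (hij : i < j) (hj : j ≤ m)
    (hs : SameSide m w i j) : IsEdge m w 1 i j ∨ IsEdge m w (-1) i j := by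
  -- If the edge is the axis, all inner nodes lie on one side of it, and the chain on the other side
  -- consists of head and tail only.
  by_cases h0 : i = 0 ∧ j = m
  · obtain ⟨rfl, rfl⟩ := h0
    by_cases hk : ∃ k, 0 < k ∧ k < j ∧ Side j w 1 k
    · obtain ⟨k, hk0, hkj, hk⟩ := hk
      refine Or.inr ⟨hij, le_rfl, Or.inl rfl, Or.inr (Or.inl rfl), fun l hl0 hlj hl => ?_⟩
      have := hs k hkj.le l hlj.le
      unfold Side at hk hl
      nlinarith
    · push Not at hk
      exact Or.inl ⟨hij, le_rfl, Or.inl rfl, Or.inr (Or.inl rfl), hk⟩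
  · have hne : i ≠ 0 ∨ j ≠ m := by
      by_contra h; push Not at h; exact h0 h
    have key : ∀ σ : ℝ, (σ = 1 ∨ σ = -1) → Chain m w σ i → Chain m w σ j → IsEdge m w σ i j :=
      fun σ hσ h1 h2 => ⟨hij, hj, h1, h2, fun k hk1 hk2 =>
        hs.not_side_between g hσ hj h1 h2 hne hk1 hk2⟩
    have o1 : (1 : ℝ) = 1 ∨ (1 : ℝ) = -1 := Or.inl rfl
    have o2 : (-1 : ℝ) = 1 ∨ (-1 : ℝ) = -1 := Or.inr rfl
    rcases g.chain_or o1 (by omega : i ≤ m) with h1 | h1 <;> rcases g.chain_or o1 hj with h2 | h2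
    · exact Or.inl (key _ o1 h1 h2)
    · rcases h1 with h1 | h1 | h1
      · exact Or.inr (key _ o2 (Or.inl h1) h2)
      · omega
      · rcases h2 with h2 | h2 | h2
        · omega
        · exact Or.inl (key _ o1 (Or.inr (Or.inr h1)) (Or.inr (Or.inl h2)))
        · exact (hs.not_side g o1 (by omega) hj h1 h2).elim
    · rcases h2 with h2 | h2 | h2
      · omega
      · exact Or.inr (key _ o2 h1 (Or.inr (Or.inl h2)))
      · rcases h1 with h1 | h1 | h1
        · exact Or.inl (key _ o1 (Or.inl h1) (Or.inr (Or.inr h2)))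
        · omega
        · exact (hs.not_side g o2 (by omega) hj h1 (by rwa [neg_neg])).elim
    · exact Or.inr (key _ o2 h1 h2)

end Guide

/-! ### Lines and half-planes -/

lemma cross_add_right (a b c : ℂ) : cross a (b + c) = cross a b + cross a c := by
  simp only [cross_eq, Complex.add_re, Complex.add_im]; ring

lemma cross_sub_right (a b c : ℂ) : cross a (b - c) = cross a b - cross a c := by
  simp only [cross_eq, Complex.sub_re, Complex.sub_im]; ring

lemma cross_real_mul_right (r : ℝ) (a b : ℂ) : cross a (r * b) = r * cross a b := by
  simp [cross_eq]; ring

lemma cross_real_mul_left (r : ℝ) (a b : ℂ) : cross (r * a) b = r * cross a b := by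
  simp [cross_eq]; ring

lemma cross_neg_left (a b : ℂ) : cross (-a) b = -cross a b := by
  simp [cross_eq]; ring

lemma cross_neg_right (a b : ℂ) : cross a (-b) = -cross a b := by
  simp [cross_eq]; ring

lemma cross_swap (a b : ℂ) : cross b a = -cross a b := by
  simp only [cross_eq]; ring

lemma cross_self (a : ℂ) : cross a a = 0 := by
  simp only [cross_eq]; ring

lemma mem_lineThrough {a d z : ℂ} : z ∈ lineThrough a d ↔ ∃ r : ℝ, z = a + r * d := by
  rw [lineThrough, AffineSubspace.mem_mk', Submodule.mem_span_singleton]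
  constructor
  · rintro ⟨r, hr⟩
    refine ⟨r, ?_⟩
    rw [vsub_eq_sub, Complex.real_smul] at hr
    linear_combination -hr
  · rintro ⟨r, rfl⟩
    exact ⟨r, by simp⟩

lemma mem_lineThrough_iff_cross {a d z : ℂ} (hd : d ≠ 0) :
    z ∈ lineThrough a d ↔ cross d (z - a) = 0 := by
  rw [mem_lineThrough]
  constructor
  · rintro ⟨r, rfl⟩
    rw [add_sub_cancel_left, cross_real_mul_right, cross_self, mul_zero]
  · intro h
    obtain ⟨r, hr⟩ := exists_real_mul_of_cross_eq_zero hd h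
    exact ⟨r, by linear_combination hr⟩

lemma self_mem_lineThrough (a d : ℂ) : a ∈ lineThrough a d := mem_lineThrough.2 ⟨0, by simp⟩

lemma lineThrough_eq {a b d : ℂ} {r : ℝ} (hr : r ≠ 0) (hb : b ∈ lineThrough a d) :
    lineThrough b (r * d) = lineThrough a d := by
  have hr' : (r : ℂ) ≠ 0 := by exact_mod_cast hr
  obtain ⟨t, rfl⟩ := mem_lineThrough.1 hb
  ext z
  simp only [mem_lineThrough]
  constructor
  · rintro ⟨u, rfl⟩
    exact ⟨t + u * r, by push_cast; ring⟩
  · rintro ⟨u, rfl⟩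
    exact ⟨(u - t) / r, by push_cast; field_simp; ring⟩

lemma lineThrough_neg (a d : ℂ) : lineThrough a (-d) = lineThrough a d := by
  have := lineThrough_eq (r := -1) (by norm_num) (self_mem_lineThrough a d)
  simpa using this

lemma lineThrough_eq_of_mem {a b d : ℂ} (hb : b ∈ lineThrough a d) :
    lineThrough b d = lineThrough a d := by
  simpa using lineThrough_eq (r := 1) one_ne_zero hb

lemma onRight_iff_onLeft_neg {K : Set ℂ} {a d : ℂ} : OnRight K a d ↔ OnLeft K a (-d) := by
  simp only [OnRight, OnLeft, cross_neg_left, Left.nonneg_neg_iff]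

lemma OnLeft.of_mem {K : Set ℂ} {a b d : ℂ} (hd : d ≠ 0) (h : OnLeft K a d)
    (hb : b ∈ lineThrough a d) : OnLeft K b d := by
  intro z hz
  have h1 := h z hz
  have h2 := (mem_lineThrough_iff_cross hd).1 hb
  have : z - b = (z - a) - (b - a) := by ring
  rw [this, cross_sub_right, h2, sub_zero]; exact h1

lemma OnRight.of_mem {K : Set ℂ} {a b d : ℂ} (hd : d ≠ 0) (h : OnRight K a d)
    (hb : b ∈ lineThrough a d) : OnRight K b d := by
  rw [onRight_iff_onLeft_neg] at *
  exact h.of_mem (neg_ne_zero.2 hd) (by rwa [lineThrough_neg])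

/-! ### The hull of the nodes -/

/-- The convex hull of the nodes `w 0, …, w m`. -/
def nodeHull (m : ℕ) (w : ℕ → ℂ) : Set ℂ := convexHull ℝ (w '' Set.Iic m)

section Guide

variable {m : ℕ} {w : ℕ → ℂ} {σ : ℝ}

lemma node_mem {k : ℕ} (hk : k ≤ m) : w k ∈ nodeHull m w :=
  subset_convexHull ℝ _ ⟨k, hk, rfl⟩

lemma convex_cross_nonneg (d a : ℂ) : Convex ℝ {z | 0 ≤ cross d (z - a)} := by
  intro x hx y hy s t hs ht hst
  simp only [Set.mem_ofPred_eq] at *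
  have : s • x + t • y - a = (s : ℂ) * (x - a) + (t : ℂ) * (y - a) := by
    have : (s : ℂ) + t = 1 := by exact_mod_cast hst
    simp only [Complex.real_smul]
    linear_combination a * this
  rw [this, cross_add_right, cross_real_mul_right, cross_real_mul_right]
  positivity

lemma onLeft_nodeHull {a d : ℂ} :
    OnLeft (nodeHull m w) a d ↔ ∀ k ≤ m, 0 ≤ cross d (w k - a) := by
  constructor
  · exact fun h k hk => h _ (node_mem hk)
  · intro h z hz
    refine convexHull_min ?_ (convex_cross_nonneg d a) hz
    rintro _ ⟨k, hk, rfl⟩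
    exact h k hk

lemma onRight_nodeHull {a d : ℂ} :
    OnRight (nodeHull m w) a d ↔ ∀ k ≤ m, cross d (w k - a) ≤ 0 := by
  rw [onRight_iff_onLeft_neg, onLeft_nodeHull]
  simp only [cross_neg_left, Left.nonneg_neg_iff]

/-- A point of contact of a support line is a convex combination of nodes on this line. -/
lemma mem_face {a d x : ℂ} (h : OnLeft (nodeHull m w) a d) (hx : x ∈ nodeHull m w)
    (h0 : cross d (x - a) = 0) :
    x ∈ convexHull ℝ (w '' {k | k ≤ m ∧ cross d (w k - a) = 0}) := by
  set F := convexHull ℝ (w '' {k | k ≤ m ∧ cross d (w k - a) = 0}) with hF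
  have hFle : ∀ z ∈ F, 0 ≤ cross d (z - a) := by
    intro z hz
    refine convexHull_min ?_ (convex_cross_nonneg d a) hz
    rintro _ ⟨k, hk, rfl⟩
    exact hk.2.ge
  -- The points strictly to the left of the line, together with F, form a convex set that contains
  -- all nodes and so the whole hull; a point of the hull on the line must then be in F.
  have hconv : Convex ℝ {z | 0 < cross d (z - a) ∨ z ∈ F} := by
    intro x hx y hy s t hs ht hst
    have hst' : (s : ℂ) + t = 1 := by exact_mod_cast hst
    have e : cross d (s • x + t • y - a) = s * cross d (x - a) + t * cross d (y - a) := by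
      rw [← cross_real_mul_right, ← cross_real_mul_right, ← cross_add_right]
      congr 1
      simp only [Complex.real_smul]
      linear_combination a * hst'
    have hx0 : 0 ≤ cross d (x - a) := hx.elim le_of_lt (hFle x)
    have hy0 : 0 ≤ cross d (y - a) := hy.elim le_of_lt (hFle y)
    rcases hs.eq_or_lt with rfl | hs
    · have : t = 1 := by linarith
      subst this; simpa using hy
    rcases ht.eq_or_lt with rfl | ht
    · have : s = 1 := by linarith
      subst this; simpa using hx
    rcases hx with hx | hx
    · left; rw [e]; positivity
    rcases hy with hy | hy
    · left; rw [e]; positivity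
    · right; exact convex_convexHull ℝ _ hx hy hs.le ht.le hst
  have hmem : x ∈ {z | 0 < cross d (z - a) ∨ z ∈ F} := by
    refine convexHull_min ?_ hconv hx
    rintro _ ⟨k, hk, rfl⟩
    rcases (h _ (node_mem hk)).lt_or_eq with h1 | h1
    · exact Or.inl h1
    · exact Or.inr (subset_convexHull ℝ _ ⟨k, ⟨hk, h1.symm⟩, rfl⟩)
  exact hmem.resolve_left (by rw [h0]; exact lt_irrefl _)

/-- With one of the two points fixed, the condition puts the other one in a half-plane, so it passes
to the convex hulls one variable at a time. -/
lemma orient_nonneg_of_mem_convexHull {Q x y : ℂ} {A B : Set ℂ}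
    (h : ∀ a ∈ A, ∀ b ∈ B, 0 ≤ orient Q a b) (hx : x ∈ convexHull ℝ A)
    (hy : y ∈ convexHull ℝ B) : 0 ≤ orient Q x y := by
  have h1 : ∀ a ∈ A, 0 ≤ orient Q a y := fun a ha =>
    convexHull_min (fun b hb => h a ha b hb) (convex_cross_nonneg (a - Q) Q) hy
  have h2 : 0 ≤ cross (-(y - Q)) (x - Q) :=
    convexHull_min (s := A) (t := {z | 0 ≤ cross (-(y - Q)) (z - Q)})
      (fun a ha => by
        have := h1 a ha
        rw [orient] at this
        rw [Set.mem_ofPred_eq, cross_neg_left, ← cross_swap]; exact this)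
      (convex_cross_nonneg _ Q) hx
  rwa [cross_neg_left, ← cross_swap] at h2

/-- Two nodes on a support line have all nodes on one side. -/
lemma sameSide_of_onLeft {a d : ℂ} (hd : d ≠ 0) (h : OnLeft (nodeHull m w) a d) {i j : ℕ}
    (hi : w i ∈ lineThrough a d) (hj : w j ∈ lineThrough a d) : SameSide m w i j := by
  have hi' := h.of_mem hd hi
  rw [← lineThrough_eq_of_mem hi, mem_lineThrough_iff_cross hd] at hj
  obtain ⟨r, hr⟩ := exists_real_mul_of_cross_eq_zero hd hj
  intro k hk l hl
  rw [orient, orient, hr, cross_real_mul_left, cross_real_mul_left]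
  have h1 := hi' _ (node_mem hk)
  have h2 := hi' _ (node_mem hl)
  have : r * cross d (w k - w i) * (r * cross d (w l - w i)) =
    (r * r) * (cross d (w k - w i) * cross d (w l - w i)) := by ring
  rw [this]
  exact mul_nonneg (mul_self_nonneg r) (mul_nonneg h1 h2)

/-- A support line that touches the hull at a node strictly on the side `σ` of the axis touches it
at nodes of the chain on this side only. -/
lemma chain_of_onLeft (g : IsGuide m w) (hσ : σ = 1 ∨ σ = -1) {a d : ℂ} (hd : d ≠ 0)
    (h : OnLeft (nodeHull m w) a d) {i k : ℕ} (hi : i ≤ m) (hk : k ≤ m) (hs : Side m w σ i)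
    (hia : w i ∈ lineThrough a d) (hka : w k ∈ lineThrough a d) : Chain m w σ k := by
  have key : Chain m w 1 i ∧ Chain m w 1 k ∨ Chain m w (-1) i ∧ Chain m w (-1) k := by
    rcases lt_trichotomy i k with hik | rfl | hik
    · exact ((sameSide_of_onLeft hd h hia hka).isEdge g hik hk).imp
        (fun e => ⟨e.left, e.right⟩) (fun e => ⟨e.left, e.right⟩)
    · exact (g.chain_or (Or.inl rfl) hi).imp (fun h => ⟨h, h⟩) (fun h => ⟨h, h⟩)
    · exact ((sameSide_of_onLeft hd h hka hia).isEdge g hik hi).imp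
        (fun e => ⟨e.right, e.left⟩) (fun e => ⟨e.right, e.left⟩)
  have hn := hs.not_chain_neg
  rcases hσ with rfl | rfl
  · exact (key.resolve_right fun h => hn h.1).2
  · rw [neg_neg] at hn
    exact (key.resolve_left fun h => hn h.1).2

/-- The nodes on the line of an edge of the hull are its end points. -/
lemma IsEdge.mem_line_iff (g : IsGuide m w) {a b k : ℕ} (h : IsEdge m w σ a b) (hk : k ≤ m) :
    w k ∈ lineThrough (w a) (w b - w a) ↔ k = a ∨ k = b := by
  have hab := h.lt
  have hb := h.le
  have ha : a ≤ m := by omega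
  have hd : w b - w a ≠ 0 := sub_ne_zero.2 (g.ne hb ha hab.ne')
  rw [mem_lineThrough_iff_cross hd]
  constructor
  · intro h0
    by_contra hc
    push Not at hc
    exact g.orient_ne ha hb hk hab.ne (Ne.symm hc.1) (Ne.symm hc.2) h0
  · rintro (rfl | rfl)
    · simp [cross_eq]
    · exact cross_self _

lemma IsEdge.cross_nonpos (g : IsGuide m w) (hσ : σ = 1 ∨ σ = -1) {a b k : ℕ}
    (h : IsEdge m w σ a b) (hk : k ≤ m) : σ * cross (w b - w a) (w k - w a) ≤ 0 := by
  by_cases hka : k = a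
  · subst hka; simp [cross_eq]
  by_cases hkb : k = b
  · subst hkb; simp [cross_self]
  have := h.strict g hσ hk hka hkb
  have e : orient (w b) (w a) (w k) = -cross (w b - w a) (w k - w a) := by
    rw [← orient_rotate, orient_swap, orient]
  rw [e] at this; linarith

lemma IsEdge.cross_neg (g : IsGuide m w) (hσ : σ = 1 ∨ σ = -1) {a b k : ℕ}
    (h : IsEdge m w σ a b) (hk : k ≤ m) (hka : k ≠ a) (hkb : k ≠ b) :
    σ * cross (w b - w a) (w k - w a) < 0 := by
  have := h.strict g hσ hk hka hkb
  have e : orient (w b) (w a) (w k) = -cross (w b - w a) (w k - w a) := by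
    rw [← orient_rotate, orient_swap, orient]
  rw [e] at this; linarith

lemma IsEdge.ne_zero (g : IsGuide m w) {a b : ℕ} (h : IsEdge m w σ a b) : w b - w a ≠ 0 :=
  sub_ne_zero.2 (g.ne h.le (h.lt.le.trans h.le) h.lt.ne')

lemma IsGuide.exists_third (g : IsGuide m w) (a b : ℕ) : ∃ k ≤ m, k ≠ a ∧ k ≠ b := by
  have := g.two_le
  by_contra hc
  push Not at hc
  have h0 := hc 0 (by omega)
  have h1 := hc 1 (by omega)
  have h2 := hc 2 (by omega)
  omega

/-- The left direction of a support line along an edge of the hull. -/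
lemma IsEdge.exists_direction (g : IsGuide m w) (hσ : σ = 1 ∨ σ = -1) {i j : ℕ}
    (h : IsEdge m w σ i j) {a d : ℂ} (hd : d ≠ 0) (hl : OnLeft (nodeHull m w) a d)
    (hi : w i ∈ lineThrough a d) (hj : w j ∈ lineThrough a d) :
    ∃ r : ℝ, 0 < r ∧ d = (-σ * r : ℝ) * (w j - w i) := by
  have hi' := hl.of_mem hd hi
  rw [← lineThrough_eq_of_mem hi, mem_lineThrough_iff_cross hd] at hj
  obtain ⟨r, hr⟩ := exists_real_mul_of_cross_eq_zero (h.ne_zero g) (z := d)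
    (by rw [cross_swap, hj, neg_zero])
  -- A third node lies strictly off the edge and decides the sign of the factor.
  obtain ⟨k, hk, hki, hkj⟩ := g.exists_third i j
  have h1 := h.cross_neg g hσ hk hki hkj
  have h2 := hi' _ (node_mem hk)
  rw [hr, cross_real_mul_left] at h2
  have hr0 : r ≠ 0 := by rintro rfl; simp at hr; exact hd hr
  refine ⟨-σ * r, ?_, ?_⟩
  · rcases hσ with rfl | rfl
    · rcases lt_or_gt_of_ne hr0 with h' | h'
      · linarith
      · nlinarith
    · rcases lt_or_gt_of_ne hr0 with h' | h'
      · nlinarith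
      · linarith
  · rw [hr]; rcases hσ with rfl | rfl <;> simp

end Guide

/-! ### Directed angles on the two sides -/

lemma cross_eq_sin (z w : ℂ) : cross z w = ‖z‖ * ‖w‖ * Real.sin (w.arg - z.arg) := by
  rcases eq_or_ne z 0 with rfl | hz
  · simp [cross_eq]
  rcases eq_or_ne w 0 with rfl | hw
  · simp [cross_eq]
  have hzp : ‖z‖ ≠ 0 := norm_ne_zero_iff.2 hz
  have hwp : ‖w‖ ≠ 0 := norm_ne_zero_iff.2 hw
  rw [Real.sin_sub, Complex.sin_arg, Complex.cos_arg hz, Complex.sin_arg, Complex.cos_arg hw,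
    cross_eq]
  field_simp

lemma sin_nonpos_cases {x : ℝ} (h1 : -(2 * Real.pi) < x) (h : Real.sin x ≤ 0) :
    (-Real.pi ≤ x ∧ x ≤ 0) ∨ Real.pi ≤ x := by
  rcases lt_or_ge x (-Real.pi) with h3 | h3
  · have := Real.sin_pos_of_pos_of_lt_pi (x := x + 2 * Real.pi) (by linarith) (by linarith)
    rw [Real.sin_add_two_pi] at this; linarith
  rcases le_or_gt x 0 with h4 | h4
  · exact Or.inl ⟨h3, h4⟩
  rcases lt_or_ge x Real.pi with h5 | h5
  · have := Real.sin_pos_of_pos_of_lt_pi h4 h5; linarith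
  · exact Or.inr h5

/-- Turning clockwise by less than `π` without passing the negative real axis. -/
lemma arg_between {z₁ z₂ : ℂ} (h : cross z₁ z₂ < 0) (hn : ¬ (z₁.im ≤ 0 ∧ 0 ≤ z₂.im)) :
    z₂.arg < z₁.arg ∧ z₁.arg < Real.pi ∧ ∀ z : ℂ, z ≠ 0 →
      ((cross z₁ z ≤ 0 ∧ cross z z₂ ≤ 0) ↔ (z₂.arg ≤ z.arg ∧ z.arg ≤ z₁.arg)) := by
  have hπ := Real.pi_pos
  have hz1 : z₁ ≠ 0 := by rintro rfl; simp [cross_eq] at h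
  have hz2 : z₂ ≠ 0 := by rintro rfl; simp [cross_eq] at h
  have p1 : 0 < ‖z₁‖ := norm_pos_iff.2 hz1
  have p2 : 0 < ‖z₂‖ := norm_pos_iff.2 hz2
  have a1 := Complex.neg_pi_lt_arg z₁
  have a2 := Complex.neg_pi_lt_arg z₂
  have b1 := Complex.arg_le_pi z₁
  have b2 := Complex.arg_le_pi z₂
  have hs : Real.sin (z₂.arg - z₁.arg) < 0 := by
    rw [cross_eq_sin] at h
    by_contra hc
    push Not at hc
    exact absurd h (not_lt.2 (by positivity))
  -- This rules out a difference of arguments of at least π, the case in which the clockwise turn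
  -- would pass the negative real axis.
  have hnot : ¬ (z₁.arg < 0 ∧ 0 ≤ z₂.arg) := by
    rintro ⟨h1, h2⟩
    exact hn ⟨(Complex.arg_neg_iff.1 h1).le, Complex.arg_nonneg_iff.1 h2⟩
  have key : -Real.pi < z₂.arg - z₁.arg ∧ z₂.arg - z₁.arg < 0 := by
    rcases sin_nonpos_cases (by linarith) hs.le with h' | h'
    · refine ⟨h'.1.lt_of_ne ?_, h'.2.lt_of_ne ?_⟩
      · intro e; rw [← e] at hs; simp at hs
      · intro e; rw [e] at hs; simp at hs
    · exact (hnot ⟨by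
        rcases h'.eq_or_lt with e | e
        · rw [← e] at hs; simp at hs
        · linarith, by linarith⟩).elim
  refine ⟨by linarith, ?_, fun z hz => ?_⟩
  · refine b1.lt_of_ne fun e => hn ?_
    have h1 := Complex.arg_eq_pi_iff.1 e
    refine ⟨h1.2.le, ?_⟩
    rw [cross_eq, h1.2, zero_mul, sub_zero] at h
    by_contra hc
    push Not at hc
    nlinarith [h1.1]
  · have pz : 0 < ‖z‖ := norm_pos_iff.2 hz
    have a := Complex.neg_pi_lt_arg z
    have b := Complex.arg_le_pi z
    rw [cross_eq_sin, cross_eq_sin]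
    have e1 : ‖z₁‖ * ‖z‖ * Real.sin (z.arg - z₁.arg) ≤ 0 ↔ Real.sin (z.arg - z₁.arg) ≤ 0 :=
      ⟨fun h => by by_contra hc; push Not at hc; exact absurd h (not_le.2 (by positivity)),
        fun h => mul_nonpos_of_nonneg_of_nonpos (by positivity) h⟩
    have e2 : ‖z‖ * ‖z₂‖ * Real.sin (z₂.arg - z.arg) ≤ 0 ↔ Real.sin (z₂.arg - z.arg) ≤ 0 :=
      ⟨fun h => by by_contra hc; push Not at hc; exact absurd h (not_le.2 (by positivity)),
        fun h => mul_nonpos_of_nonneg_of_nonpos (by positivity) h⟩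
    rw [e1, e2]
    constructor
    · rintro ⟨h1, h2⟩
      rcases sin_nonpos_cases (by linarith) h1 with h' | h' <;>
      rcases sin_nonpos_cases (by linarith) h2 with h'' | h'' <;>
      constructor <;> linarith
    · rintro ⟨h1, h2⟩
      exact ⟨Real.sin_nonpos_of_nonpos_of_neg_pi_le (by linarith) (by linarith),
        Real.sin_nonpos_of_nonpos_of_neg_pi_le (by linarith) (by linarith)⟩

/-- The reflection in the real axis if `σ = -1`, the identity if `σ = 1`. -/
def reflect (σ : ℝ) (z : ℂ) : ℂ := ⟨z.re, σ * z.im⟩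

/-- The directed angle between the direction `f` of a line with the hull on the side `-σ` and the
direction `d` of a line with the hull on the side `σ`: from the latter to the former if `σ = 1`,
conversely if `σ = -1`. -/
def angleOn (σ : ℝ) (d f : ℂ) : ℝ := (reflect σ (f / d)).arg

lemma angleOn_one (d f : ℂ) : angleOn 1 d f = dirAngle d f := by
  simp [angleOn, reflect, dirAngle]

lemma angleOn_neg_one (d f : ℂ) : angleOn (-1) d f = dirAngle f d := by
  have : reflect (-1) (f / d) = conj (f / d) := by
    apply Complex.ext <;> simp [reflect, -map_div₀]
  rw [angleOn, this, dirAngle, Complex.arg_conj, ← inv_div f d, Complex.arg_inv]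

lemma reflect_ne_zero {σ : ℝ} (hσ : σ = 1 ∨ σ = -1) {z : ℂ} (hz : z ≠ 0) : reflect σ z ≠ 0 := by
  intro h
  apply hz
  have h1 := congrArg Complex.re h
  have h2 := congrArg Complex.im h
  apply Complex.ext
  · simpa [reflect] using h1
  · rcases hσ with rfl | rfl <;> simpa [reflect] using h2

lemma reflect_reflect {σ : ℝ} (hσ : σ = 1 ∨ σ = -1) (z : ℂ) : reflect σ (reflect σ z) = z := by
  rcases hσ with rfl | rfl <;> simp [reflect]

lemma cross_reflect_div (σ : ℝ) (d x y : ℂ) :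
    cross (reflect σ (x / d)) (reflect σ (y / d)) = σ * cross x y / Complex.normSq d := by
  have h : cross (reflect σ (x / d)) (reflect σ (y / d)) = σ * cross (x / d) (y / d) := by
    simp only [cross_eq, reflect]; ring
  rw [h, div_eq_inv_mul, div_eq_inv_mul, cross_mul_mul, map_inv₀]
  field_simp

lemma im_reflect_div (σ : ℝ) (d x : ℂ) :
    (reflect σ (x / d)).im = σ * cross d x / Complex.normSq d := by
  simp only [reflect, Complex.div_im, cross_eq]
  ring

lemma reflect_mul_exp {σ : ℝ} (hσ : σ = 1 ∨ σ = -1) (s : ℝ) :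
    reflect σ (Complex.exp ((σ * s : ℝ) * Complex.I)) = Complex.exp (s * Complex.I) := by
  apply Complex.ext
  · rw [Complex.exp_ofReal_mul_I_re]
    simp only [reflect, Complex.exp_ofReal_mul_I_re]
    rcases hσ with rfl | rfl <;> simp
  · rw [Complex.exp_ofReal_mul_I_im]
    simp only [reflect, Complex.exp_ofReal_mul_I_im]
    rcases hσ with rfl | rfl <;> simp

lemma angleOn_mul_exp {σ : ℝ} (hσ : σ = 1 ∨ σ = -1) {d : ℂ} (hd : d ≠ 0) {s : ℝ}
    (h1 : -Real.pi < s) (h2 : s ≤ Real.pi) :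
    angleOn σ d (d * Complex.exp ((σ * s : ℝ) * Complex.I)) = s := by
  rw [angleOn, mul_div_cancel_left₀ _ hd, reflect_mul_exp hσ, Complex.arg_exp_mul_I,
    toIocMod_eq_self]
  constructor <;> linarith

/-- The polar form of f / d, with the sense of the angle adapted to σ: the angle determines a
direction up to a positive factor. -/
lemma exists_pos_mul_exp {σ : ℝ} (hσ : σ = 1 ∨ σ = -1) {d f : ℂ} (hd : d ≠ 0) (hf : f ≠ 0) :
    ∃ r : ℝ, 0 < r ∧ f = r * (d * Complex.exp ((σ * angleOn σ d f : ℝ) * Complex.I)) := by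
  have hz : f / d ≠ 0 := div_ne_zero hf hd
  refine ⟨‖reflect σ (f / d)‖, norm_pos_iff.2 (reflect_ne_zero hσ hz), ?_⟩
  have h1 := Complex.norm_mul_exp_arg_mul_I (reflect σ (f / d))
  have h2 := congrArg (reflect σ) h1
  rw [reflect_reflect hσ] at h2
  have h3 : ∀ (r : ℝ) (z : ℂ), reflect σ (r * z) = r * reflect σ z := by
    intro r z; apply Complex.ext <;> simp [reflect]; ring
  rw [h3, ← reflect_mul_exp hσ, reflect_reflect hσ] at h2
  rw [angleOn]
  field_simp at h2
  linear_combination -h2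

lemma dirAngle_real_mul {d e : ℂ} {r t : ℝ} (hr : 0 < r) (ht : 0 < t) :
    dirAngle (r * d) (t * e) = dirAngle d e := by
  have : t * e / (r * d) = ((t / r : ℝ) : ℂ) * (e / d) := by
    have : (r : ℂ) ≠ 0 := by exact_mod_cast hr.ne'
    push_cast; field_simp
  rw [dirAngle, this, Complex.arg_real_mul _ (by positivity), dirAngle]

lemma dirAngle_neg_neg (d e : ℂ) : dirAngle (-d) (-e) = dirAngle d e := by
  rw [dirAngle, neg_div_neg_eq, dirAngle]

lemma abs_dirAngle_swap (d e : ℂ) : |dirAngle e d| = |dirAngle d e| := by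
  rw [dirAngle, ← inv_div e d, Complex.abs_arg_inv, dirAngle]

section Guide

variable {m : ℕ} {w : ℕ → ℂ} {σ : ℝ}

/-- Cramer's rule for f in the basis e₁, e₂, cleared of denominators. It transfers half-plane
conditions from two edges to every direction in the cone between them. -/
lemma cross_combination (f e₁ e₂ v : ℂ) :
    cross f v * cross e₁ e₂ = cross f e₂ * cross e₁ v + cross e₁ f * cross e₂ v := by
  simp only [cross_eq]; ring

/-- The support lines at the node `w i`, by their directed angles to the edge on the other side
of the axis that is spanned by the time `i`. -/
lemma support_at_node (g : IsGuide m w) (hσ : σ = 1 ∨ σ = -1) {a i b c e : ℕ}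
    (h1 : IsEdge m w σ a i) (h2 : IsEdge m w σ i b) (h3 : IsEdge m w (-σ) c e)
    (hc : c < i) (he : i < e) :
    angleOn σ (w e - w c) (w b - w i) < angleOn σ (w e - w c) (w i - w a) ∧
    angleOn σ (w e - w c) (w i - w a) < Real.pi ∧
    ∀ f : ℂ, f ≠ 0 → ((∀ k ≤ m, σ * cross f (w k - w i) ≤ 0) ↔
      angleOn σ (w e - w c) (w b - w i) ≤ angleOn σ (w e - w c) f ∧
      angleOn σ (w e - w c) f ≤ angleOn σ (w e - w c) (w i - w a)) := by
  have hd := h3.ne_zero g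
  have hai := h1.lt
  have hib := h2.lt
  have hbm := h2.le
  have hem := h3.le
  set d := w e - w c
  set e₁ := w i - w a with he₁
  set e₂ := w b - w i with he₂
  have hN : 0 < Complex.normSq d := Complex.normSq_pos.2 hd
  have hedge1 : ∀ k ≤ m, σ * cross e₁ (w k - w i) ≤ 0 := fun k hk => by
    have := h1.cross_nonpos g hσ hk
    have e : w k - w a = (w k - w i) + (w i - w a) := by ring
    rwa [e, cross_add_right, cross_self, add_zero] at this
  have hedge2 : ∀ k ≤ m, σ * cross e₂ (w k - w i) ≤ 0 := fun k hk => h2.cross_nonpos g hσ hk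
  have hD : σ * cross e₁ e₂ < 0 := by
    have := h1.cross_neg g hσ hbm (by omega : b ≠ a) (by omega)
    have e : w b - w a = (w b - w i) + (w i - w a) := by ring
    rwa [e, cross_add_right, cross_self, add_zero] at this
  have hcone : ∀ f : ℂ, (∀ k ≤ m, σ * cross f (w k - w i) ≤ 0) ↔
      σ * cross e₁ f ≤ 0 ∧ σ * cross f e₂ ≤ 0 := by
    intro f
    constructor
    · intro hf
      refine ⟨?_, hf b hbm⟩
      have := hf a (by omega)
      have e : w a - w i = -e₁ := by rw [he₁]; ring
      rwa [e, cross_neg_right, ← cross_swap] at this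
    · rintro ⟨hf1, hf2⟩ k hk
      have e := cross_combination f e₁ e₂ (w k - w i)
      have e' : (σ * cross f (w k - w i)) * (σ * cross e₁ e₂) =
          (σ * cross f e₂) * (σ * cross e₁ (w k - w i)) +
          (σ * cross e₁ f) * (σ * cross e₂ (w k - w i)) := by linear_combination σ * σ * e
      have p1 := mul_nonneg_of_nonpos_of_nonpos hf2 (hedge1 k hk)
      have p2 := mul_nonneg_of_nonpos_of_nonpos hf1 (hedge2 k hk)
      by_contra hcon
      push Not at hcon
      have := mul_neg_of_pos_of_neg hcon hD
      linarith
  -- If the turn from e₁ to e₂ passed the direction -d, then the line through w i in that direction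
  -- would support the hull, with w c on its wrong side. So the arguments relative to d do not wrap
  -- around.
  have hneg : ¬ ((reflect σ (e₁ / d)).im ≤ 0 ∧ 0 ≤ (reflect σ (e₂ / d)).im) := by
    rw [im_reflect_div, im_reflect_div]
    rintro ⟨q1, q2⟩
    have q1' : σ * cross d e₁ ≤ 0 := by
      by_contra hh; push Not at hh; exact absurd q1 (not_le.2 (by positivity))
    have q2' : 0 ≤ σ * cross d e₂ := by
      by_contra hh; push Not at hh
      exact absurd q2 (not_le.2 (div_neg_of_neg_of_pos hh hN))
    have hcc := (hcone (-d)).2 ⟨by rw [cross_neg_right, ← cross_swap]; exact q1',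
      by rw [cross_neg_left]; linarith⟩ c (by omega)
    have hs := h3.cross_neg g (neg_sign hσ) (k := i) (by omega) hc.ne' he.ne
    have e : w c - w i = -(w i - w c) := by ring
    rw [e, cross_neg_left, cross_neg_right, neg_neg] at hcc
    linarith
  have hcr : cross (reflect σ (e₁ / d)) (reflect σ (e₂ / d)) < 0 := by
    rw [cross_reflect_div]; exact div_neg_of_neg_of_pos hD hN
  obtain ⟨r1, r2, r3⟩ := arg_between hcr hneg
  refine ⟨r1, r2, fun f hf => ?_⟩
  have h4 := r3 (reflect σ (f / d)) (reflect_ne_zero hσ (div_ne_zero hf hd))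
  rw [cross_reflect_div, cross_reflect_div] at h4
  rw [hcone f]
  unfold angleOn
  rw [← h4]
  have hdiv : ∀ x : ℝ, x / Complex.normSq d ≤ 0 ↔ x ≤ 0 := fun x => by
    rw [div_le_iff₀ hN, zero_mul]
  rw [hdiv, hdiv]

end Guide

/-! ### The two edges that span a given time -/

section Guide

variable {m : ℕ} {w : ℕ → ℂ} {σ : ℝ}

variable (m w σ) in
open Classical in
/-- The first node of the edge on the side `σ` that is spanned by the time `i`. -/
def edgeStart (i : ℕ) : ℕ := if h : i < m then (exists_isEdge m w σ h).choose else 0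

variable (m w σ) in
open Classical in
/-- The last node of the edge on the side `σ` that is spanned by the time `i`. -/
def edgeEnd (i : ℕ) : ℕ :=
  if h : i < m then (exists_isEdge m w σ h).choose_spec.choose else 0

variable (m w σ) in
/-- The direction of the edge on the side `σ` that is spanned by the time `i`. -/
def edgeDir (i : ℕ) : ℂ := w (edgeEnd m w σ i) - w (edgeStart m w σ i)

variable (m w σ) in
/-- The line of the edge on the side `σ` that is spanned by the time `i`. -/
def edgeLine (i : ℕ) : AffineSubspace ℝ ℂ :=
  lineThrough (w (edgeStart m w σ i)) (edgeDir m w σ i)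

variable (m w) in
/-- The directed angle from the right to the left one of the two edges that are spanned by the
time `i`. -/
def opening (i : ℕ) : ℝ := dirAngle (edgeDir m w (-1) i) (edgeDir m w 1 i)

lemma edge_spec {i : ℕ} (hi : i < m) : IsEdge m w σ (edgeStart m w σ i) (edgeEnd m w σ i) ∧
    edgeStart m w σ i ≤ i ∧ i < edgeEnd m w σ i := by
  rw [edgeStart, edgeEnd, dif_pos hi, dif_pos hi]
  exact (exists_isEdge m w σ hi).choose_spec.choose_spec

lemma IsEdge.eq_edge {a b i : ℕ} (h : IsEdge m w σ a b) (h1 : a ≤ i) (h2 : i < b) :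
    edgeStart m w σ i = a ∧ edgeEnd m w σ i = b := by
  have hs := edge_spec (w := w) (σ := σ) (h2.trans_le h.le)
  exact hs.1.unique h hs.2.1 hs.2.2 h1 h2

lemma edgeDir_ne_zero (g : IsGuide m w) {i : ℕ} (hi : i < m) : edgeDir m w σ i ≠ 0 :=
  (edge_spec hi).1.ne_zero g

lemma opening_eq (hσ : σ = 1 ∨ σ = -1) (i : ℕ) :
    opening m w i = angleOn σ (edgeDir m w (-σ) i) (edgeDir m w σ i) := by
  rcases hσ with rfl | rfl
  · rw [angleOn_one, opening]
  · rw [angleOn_neg_one, opening, neg_neg]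

lemma Side.lt {j : ℕ} (h : Side m w σ j) (hj : j ≤ m) : j < m := lt_of_le_of_ne hj h.ne_last

/-- A node of the side σ ends one edge of its chain and starts the next, while the edge of the other
chain cannot end there and continues. -/
lemma Side.edge_succ {i : ℕ} (h : Side m w σ (i + 1)) (hi : i + 1 ≤ m) :
    edgeStart m w σ (i + 1) = i + 1 ∧ edgeEnd m w σ i = i + 1 ∧
    edgeStart m w (-σ) (i + 1) = edgeStart m w (-σ) i ∧
    edgeEnd m w (-σ) (i + 1) = edgeEnd m w (-σ) i := by
  have hlt := h.lt hi
  have h1 := edge_spec (w := w) (σ := σ) hlt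
  have h2 := edge_spec (w := w) (σ := σ) (by omega : i < m)
  have h3 := edge_spec (w := w) (σ := -σ) (by omega : i < m)
  refine ⟨?_, ?_, ?_⟩
  · by_contra hne
    exact h1.1.not_side (i + 1) (by omega) h1.2.2 h
  · by_contra hne
    exact h2.1.not_side (i + 1) (by omega) (by omega) h
  · refine h3.1.eq_edge (by omega) ?_
    have : edgeEnd m w (-σ) i ≠ i + 1 := fun e => h.not_chain_neg (e ▸ h3.1.right)
    omega

lemma Side.edgeLine_neg_succ {i : ℕ} (h : Side m w σ (i + 1)) (hi : i + 1 ≤ m) :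
    edgeDir m w (-σ) (i + 1) = edgeDir m w (-σ) i ∧
    edgeLine m w (-σ) (i + 1) = edgeLine m w (-σ) i := by
  obtain ⟨-, -, h3, h4⟩ := h.edge_succ hi
  constructor
  · rw [edgeDir, edgeDir, h3, h4]
  · rw [edgeLine, edgeLine, edgeDir, edgeDir, h3, h4]

/-- The passage of a node strictly decreases the angle between the two spanned edges, and the
support lines at this node are those with angles in between. -/
lemma opening_step (g : IsGuide m w) (hσ : σ = 1 ∨ σ = -1) {i : ℕ} (h : Side m w σ (i + 1))
    (hi : i + 1 ≤ m) :
    opening m w (i + 1) < opening m w i ∧ opening m w i < Real.pi ∧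
    ∀ f : ℂ, f ≠ 0 → ((∀ k ≤ m, σ * cross f (w k - w (i + 1)) ≤ 0) ↔
      opening m w (i + 1) ≤ angleOn σ (edgeDir m w (-σ) (i + 1)) f ∧
      angleOn σ (edgeDir m w (-σ) (i + 1)) f ≤ opening m w i) := by
  have hlt := h.lt hi
  obtain ⟨e1, e2, e3, e4⟩ := h.edge_succ hi
  have h1 := edge_spec (w := w) (σ := σ) hlt
  have h2 := edge_spec (w := w) (σ := σ) (by omega : i < m)
  have h3 := edge_spec (w := w) (σ := -σ) hlt
  rw [e1] at h1
  rw [e2] at h2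
  have hc : edgeStart m w (-σ) (i + 1) ≠ i + 1 := fun e => h.not_chain_neg (e ▸ h3.1.left)
  have key := support_at_node g hσ h2.1 h1.1 h3.1 (by omega) h3.2.2
  rw [opening_eq hσ, opening_eq hσ i, ← (h.edgeLine_neg_succ hi).1]
  have d1 : edgeDir m w σ (i + 1) = w (edgeEnd m w σ (i + 1)) - w (i + 1) := by
    rw [edgeDir, e1]
  have d2 : edgeDir m w σ i = w (i + 1) - w (edgeStart m w σ i) := by
    rw [edgeDir, e2]
  rw [d1, d2]
  exact key

lemma IsGuide.exists_side (g : IsGuide m w) {i : ℕ} (h0 : 0 < i) (hi : i < m) :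
    ∃ σ : ℝ, (σ = 1 ∨ σ = -1) ∧ Side m w σ i :=
  (g.side_or (Or.inl rfl) h0 hi).elim (fun h => ⟨1, Or.inl rfl, h⟩)
    (fun h => ⟨-1, Or.inr rfl, h⟩)

lemma opening_succ_lt (g : IsGuide m w) {i : ℕ} (hi : i + 1 < m) :
    opening m w (i + 1) < opening m w i := by
  obtain ⟨σ, hσ, hs⟩ := g.exists_side (Nat.succ_pos i) hi
  exact (opening_step g hσ hs hi.le).1

lemma opening_lt (g : IsGuide m w) {i j : ℕ} (hij : i < j) (hj : j < m) :
    opening m w j < opening m w i := by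
  induction j, hij using Nat.le_induction with
  | base => exact opening_succ_lt g hj
  | succ k hk ih => exact (opening_succ_lt g hj).trans (ih (by omega))

lemma opening_zero_lt_pi (g : IsGuide m w) : opening m w 0 < Real.pi := by
  have := g.two_le
  obtain ⟨σ, hσ, hs⟩ := g.exists_side (i := 0 + 1) (Nat.succ_pos 0) (by omega)
  exact (opening_step g hσ hs (by omega)).2.1

/-! ### Touching lines at a node -/

variable (m w σ) in
/-- The line through the node `w i` whose directed angle to the edge on the other side of the axis
is `s`. -/
def touchLine (i : ℕ) (s : ℝ) : AffineSubspace ℝ ℂ :=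
  lineThrough (w i) (edgeDir m w (-σ) i * Complex.exp ((σ * s : ℝ) * Complex.I))

lemma touchDir_ne_zero (g : IsGuide m w) {i : ℕ} (hi : i < m) (s : ℝ) :
    edgeDir m w (-σ) i * Complex.exp ((σ * s : ℝ) * Complex.I) ≠ 0 :=
  mul_ne_zero (edgeDir_ne_zero g hi) (Complex.exp_ne_zero _)

/-- A line through a node in a direction with angle `s` is the corresponding touching line. -/
lemma lineThrough_eq_touchLine (g : IsGuide m w) (hσ : σ = 1 ∨ σ = -1) {i : ℕ} (hi : i < m)
    {f : ℂ} (hf : f ≠ 0) :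
    lineThrough (w i) f = touchLine m w σ i (angleOn σ (edgeDir m w (-σ) i) f) := by
  obtain ⟨r, hr, h⟩ := exists_pos_mul_exp hσ (edgeDir_ne_zero g (σ := -σ) hi) hf
  have := lineThrough_eq hr.ne' (self_mem_lineThrough (w i)
    (edgeDir m w (-σ) i *
      Complex.exp ((σ * angleOn σ (edgeDir m w (-σ) i) f : ℝ) * Complex.I)))
  rwa [← h] at this

/-- At the two extreme angles the touching line has rotated into the edge after or before the node.
This glues the families of touching lines at consecutive nodes. -/
lemma touchLine_opening (g : IsGuide m w) (hσ : σ = 1 ∨ σ = -1) {i : ℕ}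
    (h : Side m w σ (i + 1)) (hi : i + 1 ≤ m) :
    touchLine m w σ (i + 1) (opening m w (i + 1)) = edgeLine m w σ (i + 1) ∧
    touchLine m w σ (i + 1) (opening m w i) = edgeLine m w σ i := by
  have hlt := h.lt hi
  obtain ⟨e1, e2, -, -⟩ := h.edge_succ hi
  constructor
  · rw [opening_eq hσ, ← lineThrough_eq_touchLine g hσ hlt (edgeDir_ne_zero g hlt), edgeLine, e1]
  · rw [opening_eq hσ, ← (h.edgeLine_neg_succ hi).1,
      ← lineThrough_eq_touchLine g hσ hlt (edgeDir_ne_zero g (by omega)), edgeLine]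
    refine lineThrough_eq_of_mem (mem_lineThrough.2 ⟨1, ?_⟩)
    rw [edgeDir, e2]; push_cast; ring

/-! ### Pairs of support lines with nodes in alternating order -/

/-- The Λ-property for nodes: the guide path meets `M` at two nodes, and between them it meets
`M'` at a node off `M`. -/
def NodeLambda (m : ℕ) (w : ℕ → ℂ) (M M' : AffineSubspace ℝ ℂ) : Prop :=
  ∃ i j k : ℕ, i < j ∧ j < k ∧ k ≤ m ∧ w i ∈ M ∧ w k ∈ M ∧ w j ∈ M' ∧ w j ∉ M

/-- The pairs of support lines with angle `φ` and the Λ-property for nodes. -/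
def nodePairs (m : ℕ) (w : ℕ → ℂ) (φ : ℝ) : Set (Sym2 (AffineSubspace ℝ ℂ)) :=
  {q | ∃ M M' : AffineSubspace ℝ ℂ, q = s(M, M') ∧
    IsSupportLine (nodeHull m w) M ∧ IsSupportLine (nodeHull m w) M' ∧
    HasAngle (nodeHull m w) M M' φ ∧ NodeLambda m w M M'}

/-- Reversing both directions exchanges the sides on which K lies, and with them the roles of the
two lines. -/
lemma HasAngle.symm {K : Set ℂ} {M M' : AffineSubspace ℝ ℂ} {φ : ℝ} (h : HasAngle K M M' φ) :
    HasAngle K M' M φ := by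
  obtain ⟨a, d, b, e, hd, he, rfl, rfl, hl, hr, hφ⟩ := h
  refine ⟨b, -e, a, -d, neg_ne_zero.2 he, neg_ne_zero.2 hd, (lineThrough_neg _ _).symm,
    (lineThrough_neg _ _).symm, onRight_iff_onLeft_neg.1 hr,
    onRight_iff_onLeft_neg.2 (by rwa [neg_neg]), ?_⟩
  rw [dirAngle_neg_neg, abs_dirAngle_swap, hφ]

variable (m w) in
/-- `l` and `r` are support lines with the hull on the left of `l` and on the right of `r`, they
include the directed angle `s`, and they touch the hull on the two sides of the axis. -/
structure IsTouchPair (s : ℝ) (a d b e : ℂ) : Prop where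
  left_ne : d ≠ 0
  right_ne : e ≠ 0
  onLeft : OnLeft (nodeHull m w) a d
  onRight : OnRight (nodeHull m w) b e
  angle : dirAngle d e = s
  chain_left : ∀ k ≤ m, w k ∈ lineThrough a d → Chain m w (-1) k
  chain_right : ∀ k ≤ m, w k ∈ lineThrough b e → Chain m w 1 k
  left_node : ∀ q, q = 0 ∨ q = m → ∃ k ≤ m, k ≠ q ∧ w k ∈ lineThrough a d
  right_node : ∀ q, q = 0 ∨ q = m → ∃ k ≤ m, k ≠ q ∧ w k ∈ lineThrough b e
  inner_node : ∃ k, 0 < k ∧ k < m ∧ (w k ∈ lineThrough a d ∨ w k ∈ lineThrough b e)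
  at_head : s = opening m w 0 → w 0 ∈ lineThrough a d ∧ w 0 ∈ lineThrough b e
  at_tail : s = opening m w (m - 1) → w m ∈ lineThrough a d ∧ w m ∈ lineThrough b e

lemma edgeLine_chain (g : IsGuide m w) {i k : ℕ} (hi : i < m) (hk : k ≤ m)
    (h : w k ∈ edgeLine m w σ i) : Chain m w σ k := by
  have hs := edge_spec (w := w) (σ := σ) hi
  rcases (hs.1.mem_line_iff g hk).1 h with rfl | rfl
  exacts [hs.1.left, hs.1.right]

lemma start_mem_edgeLine {i : ℕ} : w (edgeStart m w σ i) ∈ edgeLine m w σ i :=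
  self_mem_lineThrough _ _

lemma end_mem_edgeLine {i : ℕ} : w (edgeEnd m w σ i) ∈ edgeLine m w σ i :=
  mem_lineThrough.2 ⟨1, by rw [edgeDir]; push_cast; ring⟩

lemma edgeLine_node {i q : ℕ} (hi : i < m) : ∃ k ≤ m, k ≠ q ∧ w k ∈ edgeLine m w σ i := by
  have hs := edge_spec (w := w) (σ := σ) hi
  have := hs.1.le
  by_cases h : edgeStart m w σ i = q
  · exact ⟨_, hs.1.le, by omega, end_mem_edgeLine⟩
  · exact ⟨_, by omega, h, start_mem_edgeLine⟩

lemma edgeLine_onSide (g : IsGuide m w) (hσ : σ = 1 ∨ σ = -1) {i : ℕ} (hi : i < m) :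
    ∀ k ≤ m, σ * cross (edgeDir m w σ i) (w k - w (edgeStart m w σ i)) ≤ 0 :=
  fun _ hk => (edge_spec hi).1.cross_nonpos g hσ hk

/-- The touching lines at a node on the side `σ`. -/
lemma touchLine_spec (g : IsGuide m w) (hσ : σ = 1 ∨ σ = -1) {i : ℕ} (h : Side m w σ (i + 1))
    (hi : i + 1 ≤ m) {s : ℝ} (h1 : opening m w (i + 1) ≤ s) (h2 : s ≤ opening m w i) :
    angleOn σ (edgeDir m w (-σ) (i + 1))
      (edgeDir m w (-σ) (i + 1) * Complex.exp ((σ * s : ℝ) * Complex.I)) = s ∧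
    (∀ k ≤ m, σ * cross (edgeDir m w (-σ) (i + 1) * Complex.exp ((σ * s : ℝ) * Complex.I))
      (w k - w (i + 1)) ≤ 0) := by
  have hlt := h.lt hi
  have key := opening_step g hσ h hi
  have hs : angleOn σ (edgeDir m w (-σ) (i + 1))
      (edgeDir m w (-σ) (i + 1) * Complex.exp ((σ * s : ℝ) * Complex.I)) = s :=
    angleOn_mul_exp hσ (edgeDir_ne_zero g hlt)
      (lt_of_lt_of_le (Complex.neg_pi_lt_arg _) h1) (h2.trans key.2.1.le)
  refine ⟨hs, (key.2.2 _ (touchDir_ne_zero g hlt s)).2 ?_⟩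
  rw [hs]; exact ⟨h1, h2⟩

/-- Openings strictly decrease, so an extreme angle occurs only at the first or the last inner node.
There the touching line has become an edge that shares the head or the tail with the opposite edge.
-/
lemma touch_at_ends (g : IsGuide m w) (hσ : σ = 1 ∨ σ = -1) {i : ℕ} (h : Side m w σ (i + 1))
    (hi : i + 1 ≤ m) {s : ℝ} (h1 : opening m w (i + 1) ≤ s) (h2 : s ≤ opening m w i) :
    (s = opening m w 0 → w 0 ∈ edgeLine m w (-σ) (i + 1) ∧ w 0 ∈ touchLine m w σ (i + 1) s) ∧
    (s = opening m w (m - 1) →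
      w m ∈ edgeLine m w (-σ) (i + 1) ∧ w m ∈ touchLine m w σ (i + 1) s) := by
  have hlt := h.lt hi
  have ht := touchLine_opening g hσ h hi
  constructor
  · rintro rfl
    have : i = 0 := by
      by_contra hne
      have := opening_lt g (Nat.pos_of_ne_zero hne) (by omega : i < m)
      linarith
    subst this
    have hm : ∀ τ, w 0 ∈ edgeLine m w τ 0 := by
      intro τ
      have := (edge_spec (w := w) (σ := τ) (by omega : 0 < m)).2.1
      have h0 : edgeStart m w τ 0 = 0 := by omega
      have := start_mem_edgeLine (m := m) (w := w) (σ := τ) (i := 0)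
      rwa [h0] at this
    rw [ht.2, (h.edgeLine_neg_succ hi).2]
    exact ⟨hm _, hm _⟩
  · rintro rfl
    have : i + 1 = m - 1 := by
      by_contra hne
      have := opening_lt g (by omega : i + 1 < m - 1) (by omega : m - 1 < m)
      linarith
    rw [← this, ht.1]
    have hm : ∀ τ, w m ∈ edgeLine m w τ (i + 1) := by
      intro τ
      have hs := edge_spec (w := w) (σ := τ) hlt
      have h0 : edgeEnd m w τ (i + 1) = m := by
        have := hs.1.le; omega
      have := end_mem_edgeLine (m := m) (w := w) (σ := τ) (i := i + 1)
      rwa [h0] at this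
    exact ⟨hm _, hm _⟩

/-- For σ = 1 the edge has the hull on its left and the touching line has it on its right; for σ =
-1 the roles are exchanged, which an unordered pair does not notice. -/
lemma exists_isTouchPair (g : IsGuide m w) (hσ : σ = 1 ∨ σ = -1) {i : ℕ}
    (h : Side m w σ (i + 1)) (hi : i + 1 ≤ m) {s : ℝ} (h1 : opening m w (i + 1) ≤ s)
    (h2 : s ≤ opening m w i) :
    ∃ a d b e, IsTouchPair m w s a d b e ∧
      s(edgeLine m w (-σ) (i + 1), touchLine m w σ (i + 1) s) =
        s(lineThrough a d, lineThrough b e) := by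
  have hlt := h.lt hi
  obtain ⟨hang, hside⟩ := touchLine_spec g hσ h hi h1 h2
  obtain ⟨hh, ht⟩ := touch_at_ends g hσ h hi h1 h2
  have hne := touchDir_ne_zero (σ := σ) g hlt s
  have hed := edgeLine_onSide g (neg_sign hσ) hlt
  have hmem : w (i + 1) ∈ touchLine m w σ (i + 1) s := self_mem_lineThrough _ _
  have hq : ∀ q, q = 0 ∨ q = m → ∃ k ≤ m, k ≠ q ∧ w k ∈ touchLine m w σ (i + 1) s :=
    fun q hq => ⟨i + 1, hi, by omega, hmem⟩
  rcases hσ with rfl | rfl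
  · have hr : OnRight (nodeHull m w) (w (i + 1)) (edgeDir m w (-1) (i + 1) *
        Complex.exp ((1 * s : ℝ) * Complex.I)) :=
      onRight_nodeHull.2 fun k hk => by simpa using hside k hk
    refine ⟨_, _, _, _, ⟨edgeDir_ne_zero g hlt, hne,
      onLeft_nodeHull.2 fun k hk => by simpa using hed k hk, hr, ?_,
      fun k hk hm => edgeLine_chain g hlt hk hm, fun k hk hm => ?_,
      fun q _ => edgeLine_node hlt, hq, ⟨i + 1, by omega, hlt, Or.inr hmem⟩, hh, ht⟩, rfl⟩
    · rw [← angleOn_one]; exact hang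
    · exact chain_of_onLeft g (Or.inl rfl) (neg_ne_zero.2 hne) (onRight_iff_onLeft_neg.1 hr) hi hk
        h (self_mem_lineThrough _ _) (by rwa [lineThrough_neg])
  · have hl : OnLeft (nodeHull m w) (w (i + 1)) (edgeDir m w (- -1) (i + 1) *
        Complex.exp ((-1 * s : ℝ) * Complex.I)) :=
      onLeft_nodeHull.2 fun k hk => by
        have := hside k hk
        linarith
    refine ⟨_, _, _, _, ⟨hne, edgeDir_ne_zero (σ := - -1) g hlt, hl,
      onRight_nodeHull.2 fun k hk => by simpa using hed k hk, ?_,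
      fun k hk hm => ?_, fun k hk hm => ?_,
      hq, fun q _ => edgeLine_node hlt, ⟨i + 1, by omega, hlt, Or.inl hmem⟩,
      fun e => (hh e).symm, fun e => (ht e).symm⟩, Sym2.eq_swap⟩
    · rw [← angleOn_neg_one]; exact hang
    · exact chain_of_onLeft g (Or.inr rfl) hne hl hi hk h (self_mem_lineThrough _ _) hm
    · have := edgeLine_chain (σ := - -1) g hlt hk hm
      rwa [neg_neg] at this

lemma IsTouchPair.hasAngle {s : ℝ} {a d b e : ℂ} (h : IsTouchPair m w s a d b e) :
    HasAngle (nodeHull m w) (lineThrough a d) (lineThrough b e) |s| :=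
  ⟨a, d, b, e, h.left_ne, h.right_ne, rfl, rfl, h.onLeft, h.onRight, by rw [h.angle]⟩

lemma isSupportLine_of_node {a d : ℂ} (hd : d ≠ 0) (h : OnLeft (nodeHull m w) a d) {k : ℕ}
    (hk : k ≤ m) (hm : w k ∈ lineThrough a d) : IsSupportLine (nodeHull m w) (lineThrough a d) :=
  ⟨w k, d, node_mem hk, hd, (lineThrough_eq_of_mem hm).symm, h.of_mem hd hm⟩

lemma IsTouchPair.isSupportLine {s : ℝ} {a d b e : ℂ} (h : IsTouchPair m w s a d b e) :
    IsSupportLine (nodeHull m w) (lineThrough a d) ∧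
    IsSupportLine (nodeHull m w) (lineThrough b e) := by
  constructor
  · obtain ⟨k, hk, -, hm⟩ := h.left_node 0 (Or.inl rfl)
    exact isSupportLine_of_node h.left_ne h.onLeft hk hm
  · obtain ⟨k, hk, -, hm⟩ := h.right_node 0 (Or.inl rfl)
    rw [← lineThrough_neg] at hm ⊢
    exact isSupportLine_of_node (neg_ne_zero.2 h.right_ne) (onRight_iff_onLeft_neg.1 h.onRight)
      hk hm

/-- The edge on the side -σ spans the time i + 1 and does not have w (i + 1) as an end, since this
node is strictly on the side σ. So its ends are the outer contacts, and w (i + 1) is the inner one.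
-/
lemma touch_mem_nodePairs (g : IsGuide m w) (hσ : σ = 1 ∨ σ = -1) {i : ℕ}
    (h : Side m w σ (i + 1)) (hi : i + 1 ≤ m) {s : ℝ} (h1 : opening m w (i + 1) ≤ s)
    (h2 : s ≤ opening m w i) :
    s(edgeLine m w (-σ) (i + 1), touchLine m w σ (i + 1) s) ∈ nodePairs m w |s| := by
  have hlt := h.lt hi
  obtain ⟨a, d, b, e, ht, heq⟩ := exists_isTouchPair g hσ h hi h1 h2
  have hs := edge_spec (w := w) (σ := -σ) hlt
  have hc : edgeStart m w (-σ) (i + 1) ≠ i + 1 := fun e => h.not_chain_neg (e ▸ hs.1.left)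
  refine ⟨_, _, rfl, ?_⟩
  have hL : NodeLambda m w (edgeLine m w (-σ) (i + 1)) (touchLine m w σ (i + 1) s) :=
    ⟨_, i + 1, _, lt_of_le_of_ne hs.2.1 hc, hs.2.2, hs.1.le, start_mem_edgeLine,
      end_mem_edgeLine, self_mem_lineThrough _ _, fun hm =>
        h.not_chain_neg (edgeLine_chain g hlt hi hm)⟩
  rcases Sym2.eq_iff.1 heq with ⟨e1, e2⟩ | ⟨e1, e2⟩
  · rw [e1, e2] at hL ⊢
    exact ⟨ht.isSupportLine.1, ht.isSupportLine.2, ht.hasAngle, hL⟩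
  · rw [e1, e2] at hL ⊢
    exact ⟨ht.isSupportLine.2, ht.isSupportLine.1, ht.hasAngle.symm, hL⟩

/-- Two contacts make the doubly touched line an edge of the hull, on some side -σ. Its ends are
consecutive in their chain, so the node visited between them is on the side σ. Hence the edge is the
spanning edge opposite to this node, and the second line is a touching line there. -/
lemma exists_touch_of_mem_nodePairs (g : IsGuide m w) {φ : ℝ}
    {q : Sym2 (AffineSubspace ℝ ℂ)} (hq : q ∈ nodePairs m w φ) :
    ∃ σ : ℝ, (σ = 1 ∨ σ = -1) ∧ ∃ i, i + 1 ≤ m ∧ Side m w σ (i + 1) ∧ ∃ s : ℝ, |s| = φ ∧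
      opening m w (i + 1) ≤ s ∧ s ≤ opening m w i ∧
      q = s(edgeLine m w (-σ) (i + 1), touchLine m w σ (i + 1) s) := by
  obtain ⟨M, M', rfl, -, -, ⟨a, d, b, e, hd, he, rfl, rfl, hl, hr, hφ⟩,
    i, j, k, hij, hjk, hk, hi, hk', hj, -⟩ := hq
  have hss := sameSide_of_onLeft hd hl hi hk'
  obtain ⟨σ, hσ, hE⟩ : ∃ σ : ℝ, (σ = 1 ∨ σ = -1) ∧ IsEdge m w (-σ) i k := by
    rcases hss.isEdge g (hij.trans hjk) hk with h | h
    · exact ⟨-1, Or.inr rfl, by rwa [neg_neg]⟩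
    · exact ⟨1, Or.inl rfl, h⟩
  obtain ⟨j, rfl⟩ : ∃ j', j = j' + 1 := ⟨j - 1, by omega⟩
  have hjm : j + 1 < m := by omega
  have hs : Side m w σ (j + 1) := by
    have := (g.side_or (neg_sign hσ) (Nat.succ_pos j) hjm).resolve_left (hE.not_side _ hij hjk)
    rwa [neg_neg] at this
  obtain ⟨es, ee⟩ := hE.eq_edge hij.le hjk
  obtain ⟨r, hr0, hdir⟩ := hE.exists_direction g (neg_sign hσ) hd hl hi hk'
  rw [neg_neg] at hdir
  have hD : edgeDir m w (-σ) (j + 1) = w k - w i := by rw [edgeDir, es, ee]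
  rw [← hD] at hdir
  have hσ0 : σ ≠ 0 := by rcases hσ with rfl | rfl <;> norm_num
  -- Since d is σ times a positive multiple of the edge direction, e is multiplied by σ too; this
  -- puts the hull on the side that `opening_step` requires.
  have hf : (σ : ℂ) * e ≠ 0 := mul_ne_zero (by exact_mod_cast hσ0) he
  have hr' := hr.of_mem he hj
  have hstep := ((opening_step g hσ hs hjm.le).2.2 _ hf).1 (fun k hk => by
    rw [cross_real_mul_left]
    have h1 := hr' _ (node_mem hk)
    have h2 : σ * σ = 1 := by rcases hσ with rfl | rfl <;> norm_num
    rw [← mul_assoc, h2, one_mul]; exact h1)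
  refine ⟨σ, hσ, j, hjm.le, hs, _, ?_, hstep.1, hstep.2, ?_⟩
  · rw [← hφ, hdir]
    rcases hσ with rfl | rfl
    · rw [angleOn_one]
      have := dirAngle_real_mul (d := edgeDir m w (-1) (j + 1)) (e := e) hr0 one_pos
      push_cast at this ⊢
      rw [one_mul, one_mul, ← this, one_mul]
    · rw [angleOn_neg_one, abs_dirAngle_swap]
      have := dirAngle_real_mul (d := edgeDir m w (- -1) (j + 1)) (e := -e) hr0 one_pos
      push_cast at this ⊢
      rw [neg_one_mul, ← this, one_mul, ← dirAngle_neg_neg]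
      congr 2 <;> ring
  · have e1 : edgeLine m w (-σ) (j + 1) = lineThrough a d := by
      rw [edgeLine, es, ← lineThrough_eq_of_mem hi, hdir]
      exact (lineThrough_eq (mul_ne_zero hσ0 hr0.ne') (self_mem_lineThrough _ _)).symm
    rw [e1, ← lineThrough_eq_touchLine g hσ hjm hf, lineThrough_eq hσ0 (self_mem_lineThrough _ _),
      lineThrough_eq_of_mem hj]

lemma side_sign_unique {τ : ℝ} {j : ℕ} (hσ : σ = 1 ∨ σ = -1) (hτ : τ = 1 ∨ τ = -1)
    (h1 : Side m w σ j) (h2 : Side m w τ j) : σ = τ := by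
  rcases hσ with rfl | rfl <;> rcases hτ with rfl | rfl
  · rfl
  · exact (h1.not_neg h2).elim
  · exact (h2.not_neg h1).elim
  · rfl

/-- The touching pair is determined by the directed angle. -/
lemma touch_unique (g : IsGuide m w) {τ : ℝ} (hσ : σ = 1 ∨ σ = -1) (hτ : τ = 1 ∨ τ = -1)
    {i j : ℕ} (hi : i + 1 ≤ m) (hj : j + 1 ≤ m) (h : Side m w σ (i + 1))
    (h' : Side m w τ (j + 1)) {s : ℝ} (h1 : opening m w (i + 1) ≤ s) (h2 : s ≤ opening m w i)
    (h3 : opening m w (j + 1) ≤ s) (h4 : s ≤ opening m w j) :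
    s(edgeLine m w (-σ) (i + 1), touchLine m w σ (i + 1) s) =
      s(edgeLine m w (-τ) (j + 1), touchLine m w τ (j + 1) s) := by
  have hlt := h.lt hi
  have hlt' := h'.lt hj
  have hpair : ∀ (τ : ℝ), (τ = 1 ∨ τ = -1) → ∀ k,
      s(edgeLine m w (-τ) k, edgeLine m w τ k) = s(edgeLine m w (-1) k, edgeLine m w 1 k) := by
    rintro τ (rfl | rfl) k
    · rfl
    · rw [neg_neg]; exact Sym2.eq_swap
  have key : ∀ {σ τ : ℝ} {i j : ℕ}, (σ = 1 ∨ σ = -1) → (τ = 1 ∨ τ = -1) → i < j → j + 1 < m →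
      Side m w σ (i + 1) → Side m w τ (j + 1) → opening m w (i + 1) ≤ s → s ≤ opening m w j →
      s(edgeLine m w (-σ) (i + 1), touchLine m w σ (i + 1) s) =
      s(edgeLine m w (-τ) (j + 1), touchLine m w τ (j + 1) s) := by
    intro σ τ i j hσ hτ hij hj h h' h1 h4
    -- Angle intervals of non-consecutive nodes are disjoint. Those of consecutive nodes share only
    -- the opening between them, where both pairs consist of the two edges that span this time.
    have e : j = i + 1 := by
      by_contra hne
      have := opening_lt g (by omega : i + 1 < j) (by omega)
      linarith
    subst e
    have es : s = opening m w (i + 1) := le_antisymm h4 h1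
    rw [es, (touchLine_opening g hσ h (by omega)).1, (touchLine_opening g hτ h' (by omega)).2,
      (h'.edgeLine_neg_succ (by omega)).2, hpair σ hσ, hpair τ hτ]
  rcases lt_trichotomy i j with hij | rfl | hij
  · exact key hσ hτ hij hlt' h h' h1 h4
  · rw [side_sign_unique hσ hτ h h']
  · exact (key hτ hσ hij hlt h' h h3 h2).symm

/-- The pairs of support lines with the Λ-property for nodes are parametrized by their directed
angle, which ranges over an interval. -/
theorem exists_nodePairs_param (g : IsGuide m w) :
    ∃ q : ℝ → Sym2 (AffineSubspace ℝ ℂ),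
      (∀ s, opening m w (m - 1) ≤ s → s ≤ opening m w 0 →
        ∃ a d b e, IsTouchPair m w s a d b e ∧ q s = s(lineThrough a d, lineThrough b e)) ∧
      ∀ φ, nodePairs m w φ =
        {x | ∃ s, opening m w (m - 1) ≤ s ∧ s ≤ opening m w 0 ∧ |s| = φ ∧ x = q s} := by
  classical
  have hm := g.two_le
  have hex : ∀ s, opening m w (m - 1) ≤ s → s ≤ opening m w 0 →
      ∃ σ : ℝ, (σ = 1 ∨ σ = -1) ∧ ∃ i, i + 1 ≤ m ∧ Side m w σ (i + 1) ∧
      opening m w (i + 1) ≤ s ∧ s ≤ opening m w i := by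
    intro s h1 h2
    -- The node to touch is the first one at which the opening has dropped to s or below.
    have hfind : ∃ i, opening m w (i + 1) ≤ s := ⟨m - 2, by
      rwa [show m - 2 + 1 = m - 1 by omega]⟩
    have hspec := Nat.find_spec hfind
    have hle : Nat.find hfind ≤ m - 2 := Nat.find_min' hfind (by
      rwa [show m - 2 + 1 = m - 1 by omega])
    obtain ⟨σ, hσ, hs⟩ := g.exists_side (Nat.succ_pos (Nat.find hfind))
      (show Nat.find hfind + 1 < m by omega)
    refine ⟨σ, hσ, Nat.find hfind, by omega, hs, hspec, ?_⟩
    rcases Nat.eq_zero_or_pos (Nat.find hfind) with h0 | h0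
    · rw [h0]; exact h2
    · have := Nat.find_min hfind (m := Nat.find hfind - 1) (by omega)
      rw [show Nat.find hfind - 1 + 1 = Nat.find hfind by omega] at this
      exact (not_le.1 this).le
  choose! τ hτ ix hix hside hlo hhi using hex
  refine ⟨fun s => s(edgeLine m w (-τ s) (ix s + 1), touchLine m w (τ s) (ix s + 1) s),
    fun s h1 h2 => exists_isTouchPair g (hτ s h1 h2) (hside s h1 h2) (hix s h1 h2) (hlo s h1 h2)
      (hhi s h1 h2), fun φ => ?_⟩
  ext x
  constructor
  · intro hx
    obtain ⟨σ, hσ, i, hi, hs, s, hφ, h1, h2, rfl⟩ := exists_touch_of_mem_nodePairs g hx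
    have hlt := hs.lt hi
    have h1' : opening m w (m - 1) ≤ s := by
      refine le_trans ?_ h1
      rcases (by omega : i + 1 = m - 1 ∨ i + 1 < m - 1) with e | e
      · rw [e]
      · exact (opening_lt g e (by omega)).le
    have h2' : s ≤ opening m w 0 := by
      refine h2.trans ?_
      rcases Nat.eq_zero_or_pos i with rfl | e
      · exact le_rfl
      · exact (opening_lt g e (by omega)).le
    exact ⟨s, h1', h2', hφ, touch_unique g hσ (hτ s h1' h2') hi (hix s h1' h2') hs
      (hside s h1' h2') h1 h2 (hlo s h1' h2') (hhi s h1' h2')⟩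
  · rintro ⟨s, h1, h2, rfl, rfl⟩
    exact touch_mem_nodePairs g (hτ s h1 h2) (hside s h1 h2) (hix s h1 h2) (hlo s h1 h2)
      (hhi s h1 h2)

end Guide

/-! ### The position of the common point of two support lines -/

lemma dirAngle_im (d e : ℂ) : (e / d).im = cross d e / Complex.normSq d := by
  have := im_reflect_div 1 d e
  simpa [reflect] using this

lemma dirAngle_pos_of_cross {d e : ℂ} (h : 0 < cross d e) : 0 < dirAngle d e := by
  have hd : d ≠ 0 := by rintro rfl; simp [cross_eq] at h
  have hN : 0 < Complex.normSq d := Complex.normSq_pos.2 hd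
  have him : 0 < (e / d).im := by rw [dirAngle_im]; positivity
  refine lt_of_le_of_ne (Complex.arg_nonneg_iff.2 him.le) fun h0 => ?_
  have := (Complex.arg_eq_zero_iff.1 h0.symm).2
  exact him.ne' this

lemma dirAngle_neg_of_cross {d e : ℂ} (h : cross d e < 0) : dirAngle d e < 0 := by
  have hd : d ≠ 0 := by rintro rfl; simp [cross_eq] at h
  have hN : 0 < Complex.normSq d := Complex.normSq_pos.2 hd
  refine Complex.arg_neg_iff.2 ?_
  rw [dirAngle_im]; exact div_neg_of_neg_of_pos h hN

lemma cross_pos_of_dirAngle {d e : ℂ} (h : 0 < dirAngle d e) (h' : dirAngle d e < Real.pi) :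
    0 < cross d e := by
  by_contra hc
  push Not at hc
  rcases hc.lt_or_eq with hc | hc
  · exact absurd (dirAngle_neg_of_cross hc) (not_lt.2 h.le)
  · have him : (e / d).im = 0 := by rw [dirAngle_im, hc, zero_div]
    rcases le_or_gt 0 (e / d).re with h1 | h1
    · exact h.ne' (Complex.arg_eq_zero_iff.2 ⟨h1, him⟩)
    · exact h'.ne (Complex.arg_eq_pi_iff.2 ⟨h1, him⟩)

lemma cross_neg_of_dirAngle {d e : ℂ} (h : dirAngle d e < 0) : cross d e < 0 := by
  have him := Complex.arg_neg_iff.1 h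
  rw [dirAngle_im] at him
  by_contra hc
  push Not at hc
  exact absurd him (not_lt.2 (div_nonneg hc (Complex.normSq_nonneg d)))

/-- The expansion of a vector in the basis formed by two directions. -/
lemma eq_combination_of_cross {d e z : ℂ} (h : cross d e ≠ 0) :
    z = ((cross z e / cross d e : ℝ) : ℂ) * d + ((cross d z / cross d e : ℝ) : ℂ) * e := by
  apply Complex.ext
  · simp only [Complex.add_re, Complex.mul_re, Complex.ofReal_re, Complex.ofReal_im]
    field_simp
    simp only [cross_eq]; ring
  · simp only [Complex.add_im, Complex.mul_im, Complex.ofReal_re, Complex.ofReal_im]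
    field_simp
    simp only [cross_eq]; ring

lemma eq_of_cross_eq_zero {d e z P : ℂ} (h : cross d e ≠ 0) (h1 : cross d (z - P) = 0)
    (h2 : cross e (z - P) = 0) : z = P := by
  have := eq_combination_of_cross (z := z - P) h
  rw [h1, cross_swap e, h2] at this
  simp only [neg_zero, zero_div, Complex.ofReal_zero, zero_mul, add_zero] at this
  exact sub_eq_zero.1 this

/-- A criterion for the common point of two support lines to lie on the side of `Q`. -/
lemma exists_meetsBeyond {K : Set ℂ} {a d b e Q : ℂ} (hl : OnLeft K a d) (hr : OnRight K b e)
    (hc : 0 < cross d e) (hQ : Q ∈ K)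
    (h : ∀ x ∈ K, x ∈ lineThrough a d → ∀ y ∈ K, y ∈ lineThrough b e → 0 ≤ orient Q x y)
    (hP : ∀ P ∈ K, P ∈ lineThrough a d → P ∈ lineThrough b e → P = Q) :
    ∃ P, MeetsBeyond K (lineThrough a d) (lineThrough b e) P Q := by
  have hd : d ≠ 0 := by rintro rfl; simp [cross_eq] at hc
  have he : e ≠ 0 := by rintro rfl; simp [cross_eq] at hc
  have hD := hc.ne'
  -- The common point of the two lines, by Cramer's rule.
  set P : ℂ := a + ((cross (b - a) e / cross d e : ℝ) : ℂ) * d with hPdef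
  have hPl : P ∈ lineThrough a d := mem_lineThrough.2 ⟨_, rfl⟩
  have hPr : P ∈ lineThrough b e := by
    refine mem_lineThrough.2 ⟨-(cross d (b - a) / cross d e), ?_⟩
    have := eq_combination_of_cross (z := b - a) hD
    rw [hPdef]
    push_cast at this ⊢
    linear_combination -this
  have hl' := hl.of_mem hd hPl
  have hr' := hr.of_mem he hPr
  refine ⟨P, ?_, ?_⟩
  · ext z
    simp only [Set.mem_inter_iff, SetLike.mem_coe, Set.mem_singleton_iff]
    constructor
    · rintro ⟨h1, h2⟩
      rw [← lineThrough_eq_of_mem hPl, mem_lineThrough_iff_cross hd] at h1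
      rw [← lineThrough_eq_of_mem hPr, mem_lineThrough_iff_cross he] at h2
      exact eq_of_cross_eq_zero hD h1 h2
    · rintro rfl; exact ⟨hPl, hPr⟩
  · intro x y hx hxl hy hyr
    by_cases hPK : P ∈ K
    · rw [← hP P hPK hPl hPr]
      exact subset_convexHull ℝ _ (by simp)
    have hxy := h x hx hxl y hy hyr
    rw [← lineThrough_eq_of_mem hPl] at hxl
    rw [← lineThrough_eq_of_mem hPr] at hyr
    obtain ⟨l, rfl⟩ := mem_lineThrough.1 hxl
    obtain ⟨u, rfl⟩ := mem_lineThrough.1 hyr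
    have hl0 : 0 < l := by
      have h1 := hr' _ hx
      rw [add_sub_cancel_left, cross_real_mul_right, cross_swap d e] at h1
      have hl0 : l ≠ 0 := by rintro rfl; apply hPK; simpa using hx
      refine lt_of_le_of_ne ?_ hl0.symm
      by_contra hneg; push Not at hneg; nlinarith
    have hu0 : 0 < u := by
      have h1 := hl' _ hy
      rw [add_sub_cancel_left, cross_real_mul_right] at h1
      have hu0 : u ≠ 0 := by rintro rfl; apply hPK; simpa using hy
      refine lt_of_le_of_ne ?_ hu0.symm
      by_contra hneg; push Not at hneg; nlinarith
    have hq := eq_combination_of_cross (z := Q - P) hD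
    set h1 := cross (Q - P) e / cross d e
    set h2 := cross d (Q - P) / cross d e
    have hQe : Q = P + h1 * d + h2 * e := by linear_combination hq
    have n1 : 0 ≤ h1 := by
      refine div_nonneg ?_ hc.le
      rw [cross_swap]; have := hr' _ hQ; linarith
    have n2 : 0 ≤ h2 := div_nonneg (hl' _ hQ) hc.le
    -- In coordinates along d and e with origin P, the contacts are (l, 0) and (0, u), and Q is (h1,
    -- h2). The orientation condition becomes h1 / l + h2 / u ≤ 1, so Q is not beyond the line of
    -- the contacts.
    have e1 : orient Q (P + l * d) (P + u * e) = (l * u - l * h2 - u * h1) * cross d e := by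
      rw [orient, hQe]
      simp only [cross_eq, Complex.add_re, Complex.add_im, Complex.sub_re, Complex.sub_im,
        Complex.mul_re, Complex.mul_im, Complex.ofReal_re, Complex.ofReal_im]
      ring
    rw [e1] at hxy
    have n3 : 0 ≤ l * u - l * h2 - u * h1 := by
      by_contra hneg; push Not at hneg
      exact absurd hxy (not_le.2 (mul_neg_of_neg_of_pos hneg hc))
    have hlC : (l : ℂ) ≠ 0 := by exact_mod_cast hl0.ne'
    have huC : (u : ℂ) ≠ 0 := by exact_mod_cast hu0.ne'
    refine mem_convexHull_triple (u := (l * u - l * h2 - u * h1) / (l * u)) (v := h1 / l)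
      (t := h2 / u) (by positivity) (by positivity) (by positivity) (by field_simp; ring) ?_
    rw [hQe]
    push_cast
    field_simp
    ring

lemma MeetsBeyond.eq_iff {K : Set ℂ} {l r : AffineSubspace ℝ ℂ} {P Q : ℂ}
    (h : MeetsBeyond K l r P Q) : P = Q ↔ Q ∈ l ∧ Q ∈ r := by
  constructor
  · rintro rfl
    have : P ∈ (l : Set ℂ) ∩ r := by rw [h.1]; rfl
    exact this
  · intro hQ
    have : Q ∈ (l : Set ℂ) ∩ r := hQ
    rw [h.1] at this
    exact this.symm

section Guide

variable {m : ℕ} {w : ℕ → ℂ} {σ : ℝ}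

/-- If two support lines meet in a point of the hull, then this point is a node. -/
lemma exists_node_eq {a d b e P : ℂ} (hl : OnLeft (nodeHull m w) a d)
    (hr : OnRight (nodeHull m w) b e) (hc : 0 < cross d e) (hP : P ∈ nodeHull m w)
    (h1 : P ∈ lineThrough a d) (h2 : P ∈ lineThrough b e) : ∃ k ≤ m, w k = P := by
  have hd : d ≠ 0 := by rintro rfl; simp [cross_eq] at hc
  have he : e ≠ 0 := by rintro rfl; simp [cross_eq] at hc
  have hl' := hl.of_mem hd h1
  have hr' := hr.of_mem he h2
  have hsub : ∀ z, cross (d - e) z = cross d z - cross e z := fun z => by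
    simp only [cross_eq, Complex.sub_re, Complex.sub_im]; ring
  -- The line through P in the direction d - e supports the hull and meets it in P only, so the node
  -- that its face must contain is P.
  have hle : OnLeft (nodeHull m w) P (d - e) := fun z hz => by
    rw [hsub]; linarith [hl' z hz, hr' z hz]
  have hmem := mem_face hle hP (by simp [cross_eq])
  obtain ⟨_, k, ⟨hk, hk0⟩, rfl⟩ := convexHull_nonempty_iff.1 ⟨P, hmem⟩
  rw [hsub] at hk0
  have p1 := hl' _ (node_mem hk)
  have p2 := hr' _ (node_mem hk)
  exact ⟨k, hk, eq_of_cross_eq_zero hc.ne' (by linarith) (by linarith)⟩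

/-- A and B stand for the two chains: orientations at w q known for nodes extend to all contact
points. The lines cannot meet at w q', because from there the further contacts lie ahead in the
directions d and e, in the order that `hneg` forbids. -/
lemma exists_meetsBeyond_node {a d b e : ℂ} {q q' : ℕ} {A B : ℕ → Prop}
    (hl : OnLeft (nodeHull m w) a d) (hr : OnRight (nodeHull m w) b e) (hc : 0 < cross d e)
    (hq : q ≤ m)
    (hA : ∀ k ≤ m, w k ∈ lineThrough a d → A k) (hB : ∀ k ≤ m, w k ∈ lineThrough b e → B k)
    (hpos : ∀ k ≤ m, ∀ l ≤ m, A k → B l → 0 ≤ orient (w q) (w k) (w l))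
    (hneg : ∀ k ≤ m, ∀ l ≤ m, A k → B l → 0 ≤ orient (w q') (w l) (w k))
    (hAB : ∀ k, A k → B k → k = q ∨ k = q')
    (hA' : ∃ k ≤ m, w k ≠ w q' ∧ w k ∈ lineThrough a d)
    (hB' : ∃ k ≤ m, w k ≠ w q' ∧ w k ∈ lineThrough b e) :
    ∃ P, MeetsBeyond (nodeHull m w) (lineThrough a d) (lineThrough b e) P (w q) := by
  have hd : d ≠ 0 := by rintro rfl; simp [cross_eq] at hc
  have he : e ≠ 0 := by rintro rfl; simp [cross_eq] at hc
  refine exists_meetsBeyond hl hr hc (node_mem hq) ?_ ?_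
  · intro x hx hxl y hy hyr
    have fx := mem_face hl hx ((mem_lineThrough_iff_cross hd).1 hxl)
    have fy := mem_face (onRight_iff_onLeft_neg.1 hr) hy
      ((mem_lineThrough_iff_cross (neg_ne_zero.2 he)).1 (by rwa [lineThrough_neg]))
    refine orient_nonneg_of_mem_convexHull ?_ fx fy
    rintro _ ⟨k, ⟨hk, hk0⟩, rfl⟩ _ ⟨l, ⟨hl1, hl0⟩, rfl⟩
    refine hpos k hk l hl1 (hA k hk ((mem_lineThrough_iff_cross hd).2 hk0)) (hB l hl1 ?_)
    rw [← lineThrough_neg]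
    exact (mem_lineThrough_iff_cross (neg_ne_zero.2 he)).2 hl0
  · intro P hP h1 h2
    obtain ⟨k, hk, rfl⟩ := exists_node_eq hl hr hc hP h1 h2
    rcases hAB k (hA k hk h1) (hB k hk h2) with rfl | rfl
    · rfl
    exfalso
    obtain ⟨i, hi, hik, hil⟩ := hA'
    obtain ⟨j, hj, hjk, hjr⟩ := hB'
    have hn := hneg i hi j hj (hA i hi hil) (hB j hj hjr)
    have p1 := hr.of_mem he h2 _ (node_mem hi)
    have p2 := hl.of_mem hd h1 _ (node_mem hj)
    rw [← lineThrough_eq_of_mem h1] at hil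
    rw [← lineThrough_eq_of_mem h2] at hjr
    obtain ⟨l, hli⟩ := mem_lineThrough.1 hil
    obtain ⟨u, huj⟩ := mem_lineThrough.1 hjr
    rw [hli, add_sub_cancel_left, cross_real_mul_right, cross_swap d e] at p1
    rw [huj, add_sub_cancel_left, cross_real_mul_right] at p2
    rw [orient, hli, huj, add_sub_cancel_left, add_sub_cancel_left, cross_real_mul_right,
      cross_real_mul_left, cross_swap d e] at hn
    have hl0 : l ≠ 0 := by rintro rfl; apply hik; rw [hli]; simp
    have hu0 : u ≠ 0 := by rintro rfl; apply hjk; rw [huj]; simp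
    have hlp : 0 < l := lt_of_le_of_ne (by by_contra h; push Not at h; nlinarith) hl0.symm
    have hup : 0 < u := lt_of_le_of_ne (by by_contra h; push Not at h; nlinarith) hu0.symm
    have := mul_pos (mul_pos hlp hup) hc
    nlinarith

/-- The edges of the hull at a node determine the directions of two support lines that touch the
hull at this node and at further nodes. -/
lemma dirAngle_eq_of_apex (g : IsGuide m w) {a d b e : ℂ} {q i j k l : ℕ}
    (hl : OnLeft (nodeHull m w) a d) (hr : OnRight (nodeHull m w) b e) (hc : 0 < cross d e)
    (hq : q ≤ m) (hk : k ≤ m) (hlm : l ≤ m) (hqk : k ≠ q) (hql : l ≠ q)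
    (hk' : ∀ z ≤ m, 0 ≤ cross (w k - w q) (w z - w q))
    (hl' : ∀ z ≤ m, cross (w l - w q) (w z - w q) ≤ 0)
    (h1 : w q ∈ lineThrough a d) (h2 : w q ∈ lineThrough b e)
    (hi : i ≤ m) (hiq : i ≠ q) (hia : w i ∈ lineThrough a d)
    (hj : j ≤ m) (hjq : j ≠ q) (hjb : w j ∈ lineThrough b e) :
    dirAngle d e = dirAngle (w k - w q) (w l - w q) := by
  have hd : d ≠ 0 := by rintro rfl; simp [cross_eq] at hc
  have he : e ≠ 0 := by rintro rfl; simp [cross_eq] at hc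
  have hlq := hl.of_mem hd h1
  have hrq := hr.of_mem he h2
  rw [← lineThrough_eq_of_mem h1] at hia
  rw [← lineThrough_eq_of_mem h2] at hjb
  obtain ⟨r, hri⟩ := mem_lineThrough.1 hia
  obtain ⟨t, htj⟩ := mem_lineThrough.1 hjb
  have hr0 : r ≠ 0 := by
    rintro rfl; exact g.ne hi hq hiq (by rw [hri]; simp)
  have ht0 : t ≠ 0 := by
    rintro rfl; exact g.ne hj hq hjq (by rw [htj]; simp)
  have hrp : 0 < r := by
    have h := hrq _ (node_mem hi)
    rw [hri, add_sub_cancel_left, cross_real_mul_right, cross_swap d e] at h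
    exact lt_of_le_of_ne (by by_contra h; push Not at h; nlinarith) hr0.symm
  have htp : 0 < t := by
    have h := hlq _ (node_mem hj)
    rw [htj, add_sub_cancel_left, cross_real_mul_right] at h
    exact lt_of_le_of_ne (by by_contra h; push Not at h; nlinarith) ht0.symm
  have hri' : w i - w q = r * d := by rw [hri]; ring
  have htj' : w j - w q = t * e := by rw [htj]; ring
  -- Seen from w q, both w i and w k bound the hull on the same side. So they are collinear with w q
  -- and agree by convex position.
  have hik : i = k := by
    by_contra hne
    have e1 := hk' i hi
    have e2 := hlq _ (node_mem hk)
    have e3 : cross (w i - w q) (w k - w q) = r * cross d (w k - w q) := by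
      rw [hri', cross_real_mul_left]
    have e4 : 0 ≤ r * cross d (w k - w q) := mul_nonneg hrp.le e2
    rw [cross_swap] at e1
    exact g.orient_ne hq hi hk hiq.symm hqk.symm hne (by rw [orient]; linarith)
  have hjl : j = l := by
    by_contra hne
    have e1 := hl' j hj
    have e2 := hrq _ (node_mem hlm)
    have e3 : cross (w j - w q) (w l - w q) = t * cross e (w l - w q) := by
      rw [htj', cross_real_mul_left]
    have e4 : t * cross e (w l - w q) ≤ 0 := mul_nonpos_of_nonneg_of_nonpos htp.le e2
    rw [cross_swap] at e1
    exact g.orient_ne hq hj hlm hjq.symm hql.symm hne (by rw [orient]; linarith)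
  rw [← hik, ← hjl, hri', htj', dirAngle_real_mul hrp htp]

/-! ### The edges of the hull at the head and at the tail -/

lemma first_edges (g : IsGuide m w) : edgeStart m w σ 0 = 0 ∧ 0 < edgeEnd m w σ 0 ∧
    edgeEnd m w σ 0 ≤ m ∧ edgeDir m w σ 0 = w (edgeEnd m w σ 0) - w 0 := by
  have := g.two_le
  have hs := edge_spec (w := w) (σ := σ) (by omega : 0 < m)
  have h0 : edgeStart m w σ 0 = 0 := by omega
  exact ⟨h0, hs.2.2, hs.1.le, by rw [edgeDir, h0]⟩

lemma last_edges (g : IsGuide m w) : edgeEnd m w σ (m - 1) = m ∧ edgeStart m w σ (m - 1) < m ∧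
    edgeDir m w σ (m - 1) = w m - w (edgeStart m w σ (m - 1)) := by
  have := g.two_le
  have hs := edge_spec (w := w) (σ := σ) (by omega : m - 1 < m)
  have := hs.1.le
  have h0 : edgeEnd m w σ (m - 1) = m := by omega
  exact ⟨h0, by omega, by rw [edgeDir, h0]⟩

lemma first_edge_side (g : IsGuide m w) (hσ : σ = 1 ∨ σ = -1) {k : ℕ} (hk : k ≤ m) :
    σ * cross (w (edgeEnd m w σ 0) - w 0) (w k - w 0) ≤ 0 := by
  have := g.two_le
  obtain ⟨e1, -, -, e2⟩ := first_edges (σ := σ) g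
  have := edgeLine_onSide g hσ (by omega : 0 < m) k hk
  rwa [e1, e2] at this

lemma last_edge_side (g : IsGuide m w) (hσ : σ = 1 ∨ σ = -1) {k : ℕ} (hk : k ≤ m) :
    0 ≤ σ * cross (w (edgeStart m w σ (m - 1)) - w m) (w k - w m) := by
  have := g.two_le
  obtain ⟨-, -, e2⟩ := last_edges (σ := σ) g
  have := edgeLine_onSide g hσ (by omega : m - 1 < m) k hk
  rw [e2] at this
  have e : w k - w (edgeStart m w σ (m - 1)) = (w k - w m) +
    (w m - w (edgeStart m w σ (m - 1))) := by ring
  rw [e, cross_add_right, cross_self, add_zero] at this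
  rw [← neg_sub (w m), cross_neg_left]; linarith

/-- If the two first edges had the same end, the hull would lie on both sides of their line and so
in it, against a third node. -/
lemma first_ends_ne (g : IsGuide m w) : edgeEnd m w (-1) 0 ≠ edgeEnd m w 1 0 := by
  intro h
  obtain ⟨k, hk, hk0, hk1⟩ := g.exists_third 0 (edgeEnd m w 1 0)
  have hm := g.two_le
  have h1 := first_edge_side g (Or.inl rfl) hk
  have h2 := first_edge_side g (Or.inr rfl) hk
  rw [h] at h2
  obtain ⟨-, e1, e2, -⟩ := first_edges (σ := 1) g
  exact g.orient_ne (Nat.zero_le _) e2 hk e1.ne hk0.symm hk1.symm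
    (by rw [orient]; linarith)

lemma last_starts_ne (g : IsGuide m w) :
    edgeStart m w (-1) (m - 1) ≠ edgeStart m w 1 (m - 1) := by
  intro h
  obtain ⟨k, hk, hk0, hk1⟩ := g.exists_third m (edgeStart m w 1 (m - 1))
  have hm := g.two_le
  have h1 := last_edge_side g (Or.inl rfl) hk
  have h2 := last_edge_side g (Or.inr rfl) hk
  rw [h] at h2
  obtain ⟨-, e1, -⟩ := last_edges (σ := 1) g
  exact g.orient_ne le_rfl e1.le hk e1.ne' hk0.symm hk1.symm
    (by rw [orient]; linarith)

/-- The right first edge has the hull on its left, in particular the end of the left first edge, and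
the two ends differ. -/
lemma opening_first_pos (g : IsGuide m w) : 0 < opening m w 0 := by
  apply dirAngle_pos_of_cross
  obtain ⟨-, e1, e2, e3⟩ := first_edges (σ := 1) g
  obtain ⟨-, f1, f2, f3⟩ := first_edges (σ := -1) g
  have h := first_edge_side g (Or.inr rfl) e2
  rw [e3, f3]
  have hne := g.orient_ne (Nat.zero_le _) f2 e2 f1.ne e1.ne (first_ends_ne g)
  rw [orient] at hne
  exact lt_of_le_of_ne (by linarith) hne.symm

lemma opening_last_neg (g : IsGuide m w) : opening m w (m - 1) < 0 := by
  apply dirAngle_neg_of_cross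
  obtain ⟨-, e1, e3⟩ := last_edges (σ := 1) g
  obtain ⟨-, f1, f3⟩ := last_edges (σ := -1) g
  have h := last_edge_side g (Or.inr rfl) e1.le
  rw [e3, f3]
  have hne := g.orient_ne le_rfl f1.le e1.le f1.ne' e1.ne' (last_starts_ne g)
  rw [orient] at hne
  rw [← neg_sub _ (w m), ← neg_sub _ (w m), cross_neg_left, cross_neg_right, neg_neg]
  exact lt_of_le_of_ne (by linarith) hne

lemma chain_inter (h : Chain m w (-1) k) (h' : Chain m w 1 k) : k = 0 ∨ k = m := by
  rcases h with h | h | h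
  · exact Or.inl h
  · exact Or.inr h
  · have := h.not_chain_neg
    rw [neg_neg] at this
    exact absurd h' this

variable {s : ℝ} {a d b e : ℂ}

/-- The contacts lie on the right and the left chain, which are seen in counterclockwise order from
the head and in the opposite order from the tail; for s > 0 this puts the common point on the side
of the head. If it is the head, each line contains a further node, so the lines are the two first
edges and s is the first opening. -/
lemma IsTouchPair.meetsBeyond_head (h : IsTouchPair m w s a d b e) (g : IsGuide m w) (hs : 0 < s)
    (hs' : s < Real.pi) :
    ∃ P, MeetsBeyond (nodeHull m w) (lineThrough a d) (lineThrough b e) P (w 0) ∧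
      (P = w 0 ↔ s = opening m w 0) := by
  have hc : 0 < cross d e := cross_pos_of_dirAngle (by rwa [h.angle]) (by rwa [h.angle])
  have h0 : 0 ≤ m := Nat.zero_le m
  have o1 : (1 : ℝ) = 1 ∨ (1 : ℝ) = -1 := Or.inl rfl
  obtain ⟨i, hi, him, hil⟩ := h.left_node m (Or.inr rfl)
  obtain ⟨j, hj, hjm, hjr⟩ := h.right_node m (Or.inr rfl)
  obtain ⟨P, hP⟩ := exists_meetsBeyond_node (q := 0) (q' := m) h.onLeft h.onRight hc h0
    h.chain_left h.chain_right
    (fun k hk l hl h1 h2 => by simpa using g.orient_head_nonneg o1 hk hl h1 h2)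
    (fun k hk l hl h1 h2 => by simpa using g.orient_tail_nonneg o1 hk hl h1 h2)
    (fun k h1 h2 => chain_inter h1 h2) ⟨i, hi, g.ne hi le_rfl him, hil⟩
    ⟨j, hj, g.ne hj le_rfl hjm, hjr⟩
  refine ⟨P, hP, ?_⟩
  rw [hP.eq_iff]
  refine ⟨fun ⟨h1, h2⟩ => ?_, h.at_head⟩
  obtain ⟨i, hi, hi0, hil⟩ := h.left_node 0 (Or.inl rfl)
  obtain ⟨j, hj, hj0, hjr⟩ := h.right_node 0 (Or.inl rfl)
  obtain ⟨-, e1, e2, e3⟩ := first_edges (σ := 1) g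
  obtain ⟨-, f1, f2, f3⟩ := first_edges (σ := -1) g
  rw [← h.angle, opening, e3, f3]
  exact dirAngle_eq_of_apex g h.onLeft h.onRight hc h0 f2 e2 f1.ne' e1.ne'
    (fun z hz => by have := first_edge_side g (Or.inr rfl) hz; linarith)
    (fun z hz => by have := first_edge_side g (Or.inl rfl) hz; linarith)
    h1 h2 hi hi0 hil hj hj0 hjr

/-- Reversing both lines and exchanging them makes the signed area of the directions positive; the
argument for the head then applies with the tail as apex and the chains exchanged. -/
lemma IsTouchPair.meetsBeyond_tail (h : IsTouchPair m w s a d b e) (g : IsGuide m w)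
    (hs : s < 0) :
    ∃ P, MeetsBeyond (nodeHull m w) (lineThrough b e) (lineThrough a d) P (w m) ∧
      (P = w m ↔ s = opening m w (m - 1)) := by
  have hc : 0 < cross (-e) (-d) := by
    have := cross_neg_of_dirAngle (d := d) (e := e) (by rwa [h.angle])
    rw [cross_neg_left, cross_neg_right, neg_neg, cross_swap]; linarith
  have h0 : 0 ≤ m := Nat.zero_le m
  have o1 : (1 : ℝ) = 1 ∨ (1 : ℝ) = -1 := Or.inl rfl
  have hl := onRight_iff_onLeft_neg.1 h.onRight
  have hr : OnRight (nodeHull m w) a (-d) := onRight_iff_onLeft_neg.2 (by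
    rw [neg_neg]; exact h.onLeft)
  rw [← lineThrough_neg a, ← lineThrough_neg b]
  obtain ⟨i, hi, him, hil⟩ := h.left_node 0 (Or.inl rfl)
  obtain ⟨j, hj, hjm, hjr⟩ := h.right_node 0 (Or.inl rfl)
  obtain ⟨P, hP⟩ := exists_meetsBeyond_node (q := m) (q' := 0) hl hr hc le_rfl
    (by rw [lineThrough_neg]; exact h.chain_right) (by rw [lineThrough_neg]; exact h.chain_left)
    (fun k hk l hl h1 h2 => by simpa using g.orient_tail_nonneg o1 hl hk h2 h1)
    (fun k hk l hl h1 h2 => by simpa using g.orient_head_nonneg o1 hl hk h2 h1)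
    (fun k h1 h2 => (chain_inter h2 h1).symm)
    ⟨j, hj, g.ne hj h0 hjm, by rwa [lineThrough_neg]⟩
    ⟨i, hi, g.ne hi h0 him, by rwa [lineThrough_neg]⟩
  refine ⟨P, hP, ?_⟩
  rw [hP.eq_iff]
  refine ⟨fun ⟨h1, h2⟩ => ?_, fun hs => by
    rw [lineThrough_neg, lineThrough_neg]; exact (h.at_tail hs).symm⟩
  obtain ⟨i, hi, hi0, hil⟩ := h.left_node m (Or.inr rfl)
  obtain ⟨j, hj, hj0, hjr⟩ := h.right_node m (Or.inr rfl)
  obtain ⟨-, e1, e3⟩ := last_edges (σ := 1) g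
  obtain ⟨-, f1, f3⟩ := last_edges (σ := -1) g
  have key := dirAngle_eq_of_apex g hl hr hc le_rfl e1.le f1.le e1.ne f1.ne
    (fun z hz => by have := last_edge_side g (Or.inl rfl) hz; linarith)
    (fun z hz => by have := last_edge_side g (Or.inr rfl) hz; linarith)
    h1 h2 hj hj0 (by rwa [lineThrough_neg]) hi hi0 (by rwa [lineThrough_neg])
  rw [dirAngle_neg_neg, ← neg_sub (w m), ← neg_sub (w m), dirAngle_neg_neg, ← e3, ← f3] at key
  have hinv : ∀ x y : ℂ, dirAngle x y ≠ Real.pi → dirAngle y x = -dirAngle x y := by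
    intro x y hxy
    rw [dirAngle, ← inv_div y x, Complex.arg_inv]
    exact if_neg hxy
  have hlt := opening_last_neg g
  have hpi := Real.pi_pos
  rw [hinv d e (by rw [h.angle]; linarith), h.angle,
    hinv (edgeDir m w (-1) (m - 1)) _ (by rw [← opening]; linarith), ← opening] at key
  linarith

/-- The nodes are not collinear, so of two opposite directions of a line only one has the hull on
its left. -/
lemma direction_unique (g : IsGuide m w) {a' d' : ℂ} (hd : d ≠ 0) (hd' : d' ≠ 0)
    (h : OnLeft (nodeHull m w) a d) (h' : OnLeft (nodeHull m w) a' d')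
    (heq : lineThrough a d = lineThrough a' d') : ∃ r : ℝ, 0 < r ∧ d' = r * d := by
  have hm := g.two_le
  have ha' : a' ∈ lineThrough a d := heq ▸ self_mem_lineThrough a' d'
  have had : a' + d' ∈ lineThrough a d :=
    heq ▸ mem_lineThrough.2 ⟨1, by push_cast; ring⟩
  have hl := h.of_mem hd ha'
  rw [← lineThrough_eq_of_mem ha', mem_lineThrough_iff_cross hd, add_sub_cancel_left] at had
  obtain ⟨r, hr⟩ := exists_real_mul_of_cross_eq_zero hd had
  have hr0 : r ≠ 0 := by rintro rfl; apply hd'; rw [hr]; simp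
  refine ⟨r, lt_of_le_of_ne ?_ hr0.symm, hr⟩
  by_contra hneg
  push Not at hneg
  have hz : ∀ k ≤ m, cross d (w k - a') = 0 := by
    intro k hk
    have h1 := hl _ (node_mem hk)
    have h2 := h' _ (node_mem hk)
    rw [hr, cross_real_mul_left] at h2
    nlinarith
  have hz' : ∀ k ≤ m, ∃ t : ℝ, w k = a' + t * d := fun k hk => by
    obtain ⟨t, ht⟩ := exists_real_mul_of_cross_eq_zero hd (hz k hk)
    exact ⟨t, by linear_combination ht⟩
  obtain ⟨t0, e0⟩ := hz' 0 (by omega)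
  obtain ⟨t1, e1⟩ := hz' 1 (by omega)
  obtain ⟨t2, e2⟩ := hz' 2 (by omega)
  refine g.orient_ne (i := 0) (j := 1) (k := 2) (by omega) (by omega) (by omega) (by omega)
    (by omega) (by omega) ?_
  rw [e0, e1, e2]
  simp only [orient_eq, Complex.add_re, Complex.add_im, Complex.mul_re, Complex.mul_im,
    Complex.ofReal_re, Complex.ofReal_im]
  ring

/-- If the lines match in order, their directions agree up to positive factors, and so do the
angles. The crossed matching would put an inner node on both chains, which share only head and tail.
-/
lemma IsTouchPair.ne {s' : ℝ} {a' d' b' e' : ℂ} (g : IsGuide m w)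
    (h : IsTouchPair m w s a d b e) (h' : IsTouchPair m w s' a' d' b' e') (hs : s ≠ s') :
    s(lineThrough a d, lineThrough b e) ≠ s(lineThrough a' d', lineThrough b' e') := by
  intro heq
  rcases Sym2.eq_iff.1 heq with ⟨h1, h2⟩ | ⟨h1, h2⟩
  · obtain ⟨r, hr, hd⟩ := direction_unique g h.left_ne h'.left_ne h.onLeft h'.onLeft h1
    obtain ⟨t, ht, he⟩ := direction_unique g (neg_ne_zero.2 h.right_ne)
      (neg_ne_zero.2 h'.right_ne) (onRight_iff_onLeft_neg.1 h.onRight)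
      (onRight_iff_onLeft_neg.1 h'.onRight) (by rw [lineThrough_neg, lineThrough_neg, h2])
    apply hs
    have he' : e' = t * e := by linear_combination -he
    rw [← h.angle, ← h'.angle, hd, he', dirAngle_real_mul hr ht]
  · obtain ⟨k, hk0, hkm, hk⟩ := h.inner_node
    have hc : Chain m w (-1) k ∧ Chain m w 1 k := by
      rcases hk with hk | hk
      · exact ⟨h.chain_left k hkm.le hk, h'.chain_right k hkm.le (h1 ▸ hk)⟩
      · exact ⟨h'.chain_left k hkm.le (h2 ▸ hk), h.chain_right k hkm.le hk⟩
    rcases chain_inter hc.1 hc.2 with rfl | rfl <;> omega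

/-- The count of the pairs of support lines with angle `φ` and the Λ-property for nodes. -/
theorem nodePairs_count (g : IsGuide m w) {φ : ℝ} (hφ : 0 ≤ φ) :
    (φ = 0 → (nodePairs m w φ).encard = 1) ∧
    (0 < φ → φ ≤ min (opening m w 0) |opening m w (m - 1)| →
      ∃ (m₁ n₁ m₂ n₂ : AffineSubspace ℝ ℂ) (P₁ P₂ : ℂ),
        s(m₁, n₁) ≠ s(m₂, n₂) ∧
        nodePairs m w φ = {s(m₁, n₁), s(m₂, n₂)} ∧
        MeetsBeyond (nodeHull m w) m₁ n₁ P₁ (w 0) ∧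
        (P₁ = w 0 ↔ φ = opening m w 0) ∧
        MeetsBeyond (nodeHull m w) m₂ n₂ P₂ (w m) ∧
        (P₂ = w m ↔ φ = |opening m w (m - 1)|)) ∧
    (min (opening m w 0) |opening m w (m - 1)| < φ →
      φ ≤ max (opening m w 0) |opening m w (m - 1)| → (nodePairs m w φ).encard = 1) ∧
    (max (opening m w 0) |opening m w (m - 1)| < φ → nodePairs m w φ = ∅) := by
  obtain ⟨q, hq, hpairs⟩ := exists_nodePairs_param g
  have hhi := opening_first_pos g
  have hlo := opening_last_neg g
  have hpi := opening_zero_lt_pi g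
  rw [abs_of_neg hlo]
  have hset : ∀ t, opening m w (m - 1) ≤ t → t ≤ opening m w 0 →
      (∀ s, opening m w (m - 1) ≤ s → s ≤ opening m w 0 → (|s| = φ ↔ s = t)) →
      nodePairs m w φ = {q t} := by
    intro t h1 h2 h
    rw [hpairs]
    ext x
    simp only [Set.mem_ofPred_eq, Set.mem_singleton_iff]
    constructor
    · rintro ⟨s, s1, s2, s3, rfl⟩
      rw [(h s s1 s2).1 s3]
    · rintro rfl
      exact ⟨t, h1, h2, (h t h1 h2).2 rfl, rfl⟩
  refine ⟨?_, ?_, ?_, ?_⟩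
  · rintro rfl
    rw [hset 0 hlo.le hhi.le fun s _ _ => abs_eq_zero, Set.encard_singleton]
  · intro hpos hle
    obtain ⟨hle1, hle2⟩ := le_min_iff.1 hle
    obtain ⟨a, d, b, e, ht, e1⟩ := hq φ (by linarith) hle1
    obtain ⟨a', d', b', e', ht', e2⟩ := hq (-φ) (by linarith) (by linarith)
    obtain ⟨P, hP, hPe⟩ := ht.meetsBeyond_head g hpos (by linarith)
    obtain ⟨P', hP', hPe'⟩ := ht'.meetsBeyond_tail g (by linarith)
    refine ⟨_, _, _, _, P, P', ?_, ?_, hP, hPe, hP', hPe'.trans ?_⟩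
    · rw [Sym2.eq_swap (a := lineThrough b' e')]
      exact ht.ne g ht' (by linarith)
    · rw [Sym2.eq_swap (a := lineThrough b' e'), ← e1, ← e2, hpairs]
      ext x
      simp only [Set.mem_ofPred_eq, Set.mem_insert_iff, Set.mem_singleton_iff]
      constructor
      · rintro ⟨s, -, -, hs, rfl⟩
        rcases (abs_eq hφ).1 hs with rfl | rfl
        · exact Or.inl rfl
        · exact Or.inr rfl
      · rintro (rfl | rfl)
        · exact ⟨φ, by linarith, hle1, abs_of_nonneg hφ, rfl⟩
        · exact ⟨-φ, by linarith, by linarith, by rw [abs_neg, abs_of_nonneg hφ], rfl⟩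
    · constructor <;> intro h <;> linarith
  · intro h1 h2
    rcases le_max_iff.1 h2 with h | h
    · have h' : -opening m w (m - 1) < φ := by
        rcases min_lt_iff.1 h1 with h' | h'
        · linarith
        · exact h'
      rw [hset φ (by linarith) h fun s s1 s2 => ⟨fun hs => ?_, fun hs => by
        rw [hs, abs_of_nonneg hφ]⟩, Set.encard_singleton]
      rcases (abs_eq hφ).1 hs with rfl | rfl
      · rfl
      · linarith
    · have h' : opening m w 0 < φ := by
        rcases min_lt_iff.1 h1 with h' | h'
        · exact h'
        · linarith
      rw [hset (-φ) (by linarith) (by linarith) fun s s1 s2 => ⟨fun hs => ?_, fun hs => by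
        rw [hs, abs_neg, abs_of_nonneg hφ]⟩, Set.encard_singleton]
      rcases (abs_eq hφ).1 hs with rfl | rfl
      · linarith
      · rfl
  · intro h
    obtain ⟨h1, h2⟩ := max_lt_iff.1 h
    rw [hpairs]
    refine Set.eq_empty_iff_forall_notMem.2 ?_
    rintro x ⟨s, s1, s2, hs, -⟩
    rcases (abs_eq hφ).1 hs with rfl | rfl <;> linarith

end Guide

/-! ### Arcs through the nodes of the hull -/

lemma normalArg_of_pos {d : ℂ} (hd : d ≠ 0) {c : ℝ} (hc : 0 < c) :
    normalArg d (c * d) = -(Real.pi / 2) := by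
  have : -Complex.I * conj d * (c * d) = ((c * Complex.normSq d : ℝ) : ℂ) * -Complex.I := by
    rw [Complex.ofReal_mul, Complex.normSq_eq_conj_mul_self]; ring
  rw [normalArg, this, Complex.arg_real_mul _ (mul_pos hc (Complex.normSq_pos.2 hd)),
    Complex.arg_neg_I]

lemma normalArg_of_neg {d : ℂ} (hd : d ≠ 0) {c : ℝ} (hc : c < 0) :
    normalArg d (c * d) = Real.pi / 2 := by
  have : -Complex.I * conj d * (c * d) = ((-c * Complex.normSq d : ℝ) : ℂ) * Complex.I := by
    rw [Complex.ofReal_mul, Complex.normSq_eq_conj_mul_self]; push_cast; ring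
  rw [normalArg, this,
    Complex.arg_real_mul _ (mul_pos (neg_pos.2 hc) (Complex.normSq_pos.2 hd)), Complex.arg_I]

lemma abs_normalArg_lt {d z : ℂ} (h : 0 < cross d z) : |normalArg d z| < Real.pi / 2 := by
  rw [normalArg, Complex.abs_arg_lt_pi_div_two_iff, re_neg_I_mul_conj_mul]
  exact Or.inl h

/-- The arc `A` on the interval `[0, T]` is simple, it stays in the hull of the nodes, and it
visits the nodes in their order. -/
structure IsArcThrough (m : ℕ) (w : ℕ → ℂ) (A : ℝ → ℂ) (T : ℝ) (κ : ℕ → ℝ) : Prop where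
  two_le : 2 ≤ m
  notMem : ∀ i ≤ m, w i ∉ convexHull ℝ (w '' {j | j ≤ m ∧ j ≠ i})
  cont : ContinuousOn A (Set.Icc 0 T)
  inj : Set.InjOn A (Set.Icc 0 T)
  mem : ∀ t ∈ Set.Icc 0 T, A t ∈ nodeHull m w
  time_mem : ∀ i ≤ m, κ i ∈ Set.Icc 0 T
  time_lt : ∀ i j, i < j → j ≤ m → κ i < κ j
  node : ∀ i ≤ m, A (κ i) = w i

section Arc

variable {m : ℕ} {w : ℕ → ℂ} {A : ℝ → ℂ} {T : ℝ} {κ : ℕ → ℝ}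

/-- Two subarcs with disjoint time intervals satisfy the angle condition at their end points. -/
lemma IsArcThrough.sum_normalArg (h : IsArcThrough m w A T κ) {t₁ t₂ t₃ t₄ : ℝ}
    (h1 : t₁ ∈ Set.Icc 0 T) (h2 : t₂ ∈ Set.Icc 0 T) (h3 : t₃ ∈ Set.Icc 0 T)
    (h4 : t₄ ∈ Set.Icc 0 T) (hdis : Disjoint (Set.uIcc t₁ t₂) (Set.uIcc t₃ t₄))
    {d₁ d₂ d₃ d₄ : ℂ} (e1 : d₁ ≠ 0) (e2 : d₂ ≠ 0) (e3 : d₃ ≠ 0) (e4 : d₄ ≠ 0)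
    (l1 : OnLeft (nodeHull m w) (A t₁) d₁) (l2 : OnLeft (nodeHull m w) (A t₂) d₂)
    (l3 : OnLeft (nodeHull m w) (A t₃) d₃) (l4 : OnLeft (nodeHull m w) (A t₄) d₄) :
    (normalArg d₃ (A t₂ - A t₃) - normalArg d₃ (A t₁ - A t₃)) +
    (normalArg d₂ (A t₄ - A t₂) - normalArg d₂ (A t₃ - A t₂)) +
    (normalArg d₄ (A t₁ - A t₄) - normalArg d₄ (A t₂ - A t₄)) +
    (normalArg d₁ (A t₃ - A t₁) - normalArg d₁ (A t₄ - A t₁)) = 0 := by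
  -- The parameter is clamped to [0, 1], since `sum_normalArg_eq_zero` speaks of paths defined on
  -- the whole line.
  set π : ℝ → ℝ := fun x => Set.projIcc (0 : ℝ) 1 zero_le_one x with hπ
  have hπc : Continuous π := continuous_subtype_val.comp continuous_projIcc
  have hπm : ∀ x, π x ∈ Set.Icc (0 : ℝ) 1 := fun x => (Set.projIcc (0 : ℝ) 1 zero_le_one x).2
  have hπ0 : π 0 = 0 := by simp [hπ, Set.projIcc_left]
  have hπ1 : π 1 = 1 := by simp [hπ, Set.projIcc_right]
  have hseg : ∀ s t x : ℝ, AffineMap.lineMap (k := ℝ) s t (π x) ∈ Set.uIcc s t := by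
    intro s t x
    rw [← segment_eq_uIcc, segment_eq_image_lineMap]
    exact ⟨_, hπm x, rfl⟩
  have hsub : ∀ s t : ℝ, s ∈ Set.Icc 0 T → t ∈ Set.Icc 0 T → Set.uIcc s t ⊆ Set.Icc 0 T :=
    fun s t hs ht => Set.uIcc_subset_Icc hs ht
  have hcont : ∀ s t : ℝ, s ∈ Set.Icc 0 T → t ∈ Set.Icc 0 T →
      Continuous fun x => A (AffineMap.lineMap (k := ℝ) s t (π x)) := by
    intro s t hs ht
    refine h.cont.comp_continuous ?_ fun x => hsub s t hs ht (hseg s t x)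
    simp only [AffineMap.lineMap_apply]
    fun_prop
  have key := sum_normalArg_eq_zero (hcont t₁ t₂ h1 h2) (hcont t₃ t₄ h3 h4)
    (fun x y hxy => by
      have := h.inj (hsub _ _ h1 h2 (hseg t₁ t₂ x)) (hsub _ _ h3 h4 (hseg t₃ t₄ y)) hxy
      exact Set.disjoint_left.1 hdis (hseg t₁ t₂ x) (this ▸ hseg t₃ t₄ y))
    (dA := d₁) (dB := d₃) (dC := d₂) (dD := d₄) e1 e3 e2 e4
  simp only [hπ0, hπ1, AffineMap.lineMap_apply_zero, AffineMap.lineMap_apply_one] at key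
  exact key (fun x => l1 _ (h.mem _ (hsub _ _ h3 h4 (hseg t₃ t₄ x))))
    (fun x => l3 _ (h.mem _ (hsub _ _ h1 h2 (hseg t₁ t₂ x))))
    (fun x => l2 _ (h.mem _ (hsub _ _ h3 h4 (hseg t₃ t₄ x))))
    (fun x => l4 _ (h.mem _ (hsub _ _ h1 h2 (hseg t₁ t₂ x))))

/-- Every node has a support line. -/
lemma exists_support_at_node (hm : 2 ≤ m)
    (hw : ∀ i ≤ m, w i ∉ convexHull ℝ (w '' {j | j ≤ m ∧ j ≠ i})) {i : ℕ} (hi : i ≤ m) :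
    ∃ d : ℂ, d ≠ 0 ∧ OnLeft (nodeHull m w) (w i) d := by
  have hfin : (w '' {j | j ≤ m ∧ j ≠ i}).Finite :=
    ((Set.finite_Iic m).subset fun j hj => hj.1).image w
  obtain ⟨f, u, hf1, hf2⟩ := geometric_hahn_banach_point_closed (convex_convexHull ℝ _)
    (hfin.isClosed_convexHull ℝ) (hw i hi)
  -- A real linear functional on the plane is the signed area with a fixed vector; for the
  -- separating functional this vector is the direction of the support line.
  have hfz : ∀ z : ℂ, f z = cross (⟨f Complex.I, -f 1⟩ : ℂ) z := by
    intro z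
    have hz : z = z.re • (1 : ℂ) + z.im • Complex.I := by
      rw [Complex.real_smul, Complex.real_smul, mul_one, Complex.re_add_im]
    conv_lhs => rw [hz]
    rw [map_add, map_smul, map_smul, cross_eq, smul_eq_mul, smul_eq_mul]
    ring
  have hle : ∀ j ≤ m, j ≠ i → f (w i) < f (w j) := fun j hj hji =>
    hf1.trans (hf2 _ (subset_convexHull ℝ _ ⟨j, ⟨hj, hji⟩, rfl⟩))
  refine ⟨⟨f Complex.I, -f 1⟩, ?_, onLeft_nodeHull.2 fun j hj => ?_⟩
  · intro h0
    obtain ⟨j, hj, hji⟩ : ∃ j ≤ m, j ≠ i := by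
      rcases Nat.eq_zero_or_pos i with rfl | h
      · exact ⟨1, by omega, by omega⟩
      · exact ⟨0, by omega, by omega⟩
    have h1 := hfz (w i)
    have h2 := hfz (w j)
    rw [h0] at h1 h2
    have := hle j hj hji
    rw [h1, h2] at this
    simp [cross_eq] at this
  · rw [cross_sub_right, ← hfz, ← hfz]
    by_cases hji : j = i
    · rw [hji, sub_self]
    · linarith [hle j hj hji]

/-- On each side of the axis, a simple arc visits the nodes of the hull in the order from the head
to the tail. -/
theorem IsArcThrough.isGuide (h : IsArcThrough m w A T κ) : IsGuide m w := by
  refine ⟨h.two_le, h.notMem, fun σ hσ i j hij hj hi' hj' => ?_⟩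
  have hi : i ≤ m := hij.le.trans hj
  have h0 : 0 ≤ m := Nat.zero_le m
  have hjm := hj'.lt hj
  have hipos := hi'.pos
  have hne := orient_ne_zero h.notMem h0 hi hj (by omega) (by omega) hij.ne
  by_contra hcon
  have hbad : 0 < σ * orient (w 0) (w i) (w j) := by
    rw [orient_swap] at hcon
    rcases hσ with rfl | rfl <;> rcases lt_or_gt_of_ne hne with h | h <;> linarith
  have hmij := (orient_trans h.notMem hσ h0 le_rfl hi hj hi' hbad).2
  obtain ⟨d0, n0, s0⟩ := exists_support_at_node h.two_le h.notMem h0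
  obtain ⟨d1, n1, s1⟩ := exists_support_at_node h.two_le h.notMem hi
  obtain ⟨d2, n2, s2⟩ := exists_support_at_node h.two_le h.notMem hj
  obtain ⟨d3, n3, s3⟩ := exists_support_at_node h.two_le h.notMem (le_refl m)
  -- In the wrong order, the nodes 0, m, i, j form a convex quadrilateral in this cyclic order, so
  -- the subarcs from 0 to i and from j to m join opposite corners. They are disjoint, yet all four
  -- brackets of the angle sum have the same sign.
  have hdis : Disjoint (Set.uIcc (κ 0) (κ i)) (Set.uIcc (κ j) (κ m)) := by
    have t1 := h.time_lt 0 i hipos hi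
    have t2 := h.time_lt i j hij hj
    have t3 := h.time_lt j m hjm le_rfl
    rw [Set.uIcc_of_le t1.le, Set.uIcc_of_le t3.le, Set.disjoint_left]
    intro x hx hx'
    linarith [hx.2, hx'.1]
  have key := h.sum_normalArg (h.time_mem 0 h0) (h.time_mem i hi) (h.time_mem j hj)
    (h.time_mem m le_rfl) hdis n0 n1 n2 n3 (by rwa [h.node 0 h0]) (by rwa [h.node i hi])
    (by rwa [h.node j hj]) (by rwa [h.node m le_rfl])
  rw [h.node 0 h0, h.node i hi, h.node j hj, h.node m le_rfl] at key
  have c1 : cross (w 0 - w j) (w i - w j) = orient (w 0) (w i) (w j) := by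
    rw [← orient_rotate, ← orient_rotate, orient]
  have c2 : cross (w j - w i) (w m - w i) = orient (w m) (w i) (w j) := by
    rw [← orient_rotate, orient]
  have c3 : cross (w i - w m) (w 0 - w m) = orient (w 0) (w m) (w i) := by
    rw [← orient_rotate, orient]
  have c4 : cross (w m - w 0) (w j - w 0) = orient (w 0) (w m) (w j) := rfl
  unfold Side at hi' hj'
  have l : ∀ {a : ℕ} {d : ℂ}, OnLeft (nodeHull m w) (w a) d → ∀ k ≤ m, 0 ≤ cross d (w k - w a) :=
    fun hl k hk => hl _ (node_mem hk)
  rcases hσ with rfl | rfl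
  · rw [one_mul] at hi' hj' hbad hmij
    have a1 := normalArg_lt n2 (l s2 0 h0) (l s2 i hi) (by rwa [c1])
    have a2 := normalArg_lt n1 (l s1 j hj) (l s1 m le_rfl) (by rwa [c2])
    have a3 := normalArg_lt n3 (l s3 i hi) (l s3 0 h0) (by rwa [c3])
    have a4 := normalArg_lt n0 (l s0 m le_rfl) (l s0 j hj) (by rwa [c4])
    linarith
  · have a1 := normalArg_lt n2 (l s2 i hi) (l s2 0 h0) (by rw [cross_swap, c1]; linarith)
    have a2 := normalArg_lt n1 (l s1 m le_rfl) (l s1 j hj) (by rw [cross_swap, c2]; linarith)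
    have a3 := normalArg_lt n3 (l s3 0 h0) (l s3 i hi) (by rw [cross_swap, c3]; linarith)
    have a4 := normalArg_lt n0 (l s0 j hj) (l s0 m le_rfl) (by rw [cross_swap, c4]; linarith)
    linarith

/-- A subarc from an inner point of an edge of the hull to a point off this edge meets every
subarc that joins the end points of the edge. -/
lemma IsArcThrough.not_disjoint (h : IsArcThrough m w A T κ) {a d dv : ℂ} (hd : d ≠ 0)
    (hl : OnLeft (nodeHull m w) a d) {tu tv α β : ℝ} (hu : tu ∈ Set.Icc 0 T)
    (hv : tv ∈ Set.Icc 0 T) (hα : α ∈ Set.Icc 0 T) (hβ : β ∈ Set.Icc 0 T)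
    (hα' : A α ∈ lineThrough a d) (hβ' : A β ∈ lineThrough a d)
    (hu' : A tu ∈ openSegment ℝ (A α) (A β)) (hv' : A tv ∉ lineThrough a d) (hdv : dv ≠ 0)
    (hlv : OnLeft (nodeHull m w) (A tv) dv) :
    ¬ Disjoint (Set.uIcc tu tv) (Set.uIcc α β) := by
  have key : ∀ α β : ℝ, ∀ r : ℝ, 0 < r → A β - A α = r * d → α ∈ Set.Icc 0 T →
      β ∈ Set.Icc 0 T → A α ∈ lineThrough a d → A β ∈ lineThrough a d →
      A tu ∈ openSegment ℝ (A α) (A β) → ¬ Disjoint (Set.uIcc tu tv) (Set.uIcc α β) := by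
    intro α β r hr hrd hα hβ hα' hβ' hu' hdis
    obtain ⟨s, t, hs, ht, hst, hu''⟩ := hu'
    have hst' : (s : ℂ) + t = 1 := by exact_mod_cast hst
    simp only [Complex.real_smul] at hu''
    have hul : A tu ∈ lineThrough a d := by
      rw [← lineThrough_eq_of_mem hα']
      exact mem_lineThrough.2 ⟨t * r, by
        push_cast; linear_combination -hu'' + t * hrd + A α * hst'⟩
    have sum := h.sum_normalArg hu hv hα hβ hdis hd hdv hd hd (hl.of_mem hd hul) hlv
      (hl.of_mem hd hα') (hl.of_mem hd hβ')
    have u1 : A tu - A α = ((t * r : ℝ) : ℂ) * d := by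
      push_cast; linear_combination -hu'' + t * hrd + A α * hst'
    have u2 : A tu - A β = ((-(s * r) : ℝ) : ℂ) * d := by
      push_cast; linear_combination -hu'' - s * hrd + A β * hst'
    have u3 : A α - A tu = ((-(t * r) : ℝ) : ℂ) * d := by
      push_cast at u1 ⊢; linear_combination -u1
    have u4 : A β - A tu = ((s * r : ℝ) : ℂ) * d := by
      push_cast at u2 ⊢; linear_combination -u2
    have htr : 0 < t * r := mul_pos ht hr
    have hsr : 0 < s * r := mul_pos hs hr
    -- Seen from a point of the line, its other points are at ±π/2 and A tv is strictly in between.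
    -- So the bracket at A tu equals π and the other three are positive.
    rw [u1, u2, u3, u4, normalArg_of_pos hd htr, normalArg_of_pos hd hsr,
      normalArg_of_neg hd (neg_neg_of_pos htr), normalArg_of_neg hd (neg_neg_of_pos hsr)] at sum
    have hvp : ∀ z, z ∈ lineThrough a d → 0 < cross d (A tv - z) := by
      intro z hz
      refine lt_of_le_of_ne (hl.of_mem hd hz _ (h.mem _ hv)) fun h0 => hv' ?_
      rw [← lineThrough_eq_of_mem hz]
      exact (mem_lineThrough_iff_cross hd).2 h0.symm
    have b1 := abs_lt.1 (abs_normalArg_lt (hvp _ hα'))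
    have b2 := abs_lt.1 (abs_normalArg_lt (hvp _ hβ'))
    have b3 : normalArg dv (A α - A tv) < normalArg dv (A β - A tv) := by
      refine normalArg_lt hdv (hlv _ (h.mem _ hα)) (hlv _ (h.mem _ hβ)) ?_
      have e1 : A β - A tv = (A α - A tv) + r * d := by linear_combination hrd
      have e2 : A α - A tv = -(A tv - A α) := by ring
      rw [e1, cross_add_right, cross_self, zero_add, cross_real_mul_right, e2, cross_neg_left,
        ← cross_swap]
      exact mul_pos hr (hvp _ hα')
    linarith [Real.pi_pos]
  have hβ'' := hβ'
  rw [← lineThrough_eq_of_mem hα', mem_lineThrough_iff_cross hd] at hβ''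
  obtain ⟨r, hr⟩ := exists_real_mul_of_cross_eq_zero hd hβ''
  -- If d points from A β to A α, the two ends are exchanged; if they coincide, then tu = α.
  rcases lt_trichotomy r 0 with h0 | h0 | h0
  · rw [Set.uIcc_comm α β]
    exact key β α (-r) (neg_pos.2 h0) (by push_cast; linear_combination -hr) hβ hα hβ' hα'
      (by rwa [openSegment_symm])
  · subst h0
    have e : A α = A β := by
      rw [Complex.ofReal_zero, zero_mul] at hr; exact (sub_eq_zero.1 hr).symm
    rw [← e, openSegment_same] at hu'
    have := h.inj hu hα hu'
    subst this
    exact fun hdis => Set.disjoint_left.1 hdis Set.left_mem_uIcc Set.left_mem_uIcc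
  · exact key α β r h0 hr hα hβ hα' hβ' hu'

/-- A point of contact of a support line that contains two nodes lies between them. -/
lemma mem_segment_of_contact (g : IsGuide m w) {a d x : ℂ} (hd : d ≠ 0)
    (hl : OnLeft (nodeHull m w) a d) (hx : x ∈ nodeHull m w) (hxl : x ∈ lineThrough a d)
    {i j : ℕ} (hi : i ≤ m) (hj : j ≤ m) (hij : i ≠ j) (hil : w i ∈ lineThrough a d)
    (hjl : w j ∈ lineThrough a d) : x ∈ segment ℝ (w i) (w j) := by
  have hf := mem_face hl hx ((mem_lineThrough_iff_cross hd).1 hxl)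
  rw [← convexHull_pair]
  refine convexHull_mono ?_ hf
  rintro _ ⟨k, ⟨hk, hk0⟩, rfl⟩
  by_contra hc
  simp only [Set.mem_insert_iff, Set.mem_singleton_iff, not_or] at hc
  have hki : i ≠ k := by rintro rfl; exact hc.1 rfl
  have hkj : j ≠ k := by rintro rfl; exact hc.2 rfl
  apply g.orient_ne hi hj hk hij hki hkj
  have hk' : w k ∈ lineThrough a d := (mem_lineThrough_iff_cross hd).2 hk0
  rw [← lineThrough_eq_of_mem hil] at hjl hk'
  obtain ⟨r, hr⟩ := mem_lineThrough.1 hjl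
  obtain ⟨t, ht⟩ := mem_lineThrough.1 hk'
  rw [orient, hr, ht, add_sub_cancel_left, add_sub_cancel_left, cross_real_mul_left,
    cross_real_mul_right, cross_self, mul_zero, mul_zero]

lemma node_unique_of_contact (g : IsGuide m w) {a d : ℂ}
    {i j k : ℕ} (hi : i ≤ m) (hj : j ≤ m) (hk : k ≤ m) (hij : i ≠ j)
    (hil : w i ∈ lineThrough a d) (hjl : w j ∈ lineThrough a d) (hkl : w k ∈ lineThrough a d) :
    k = i ∨ k = j := by
  by_contra hc
  push Not at hc
  apply g.orient_ne hi hj hk hij hc.1.symm hc.2.symm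
  rw [← lineThrough_eq_of_mem hil] at hjl hkl
  obtain ⟨r, hr⟩ := mem_lineThrough.1 hjl
  obtain ⟨t, ht⟩ := mem_lineThrough.1 hkl
  rw [orient, hr, ht, add_sub_cancel_left, add_sub_cancel_left, cross_real_mul_left,
    cross_real_mul_right, cross_self, mul_zero, mul_zero]

/-- A point of contact of a support line is a node or an inner point of an edge. -/
lemma contact_cases (g : IsGuide m w) {a d x : ℂ} (hd : d ≠ 0)
    (hl : OnLeft (nodeHull m w) a d) (hx : x ∈ nodeHull m w) (hxl : x ∈ lineThrough a d) :
    (∃ k ≤ m, x = w k) ∨ ∃ i j, i < j ∧ j ≤ m ∧ w i ∈ lineThrough a d ∧ w j ∈ lineThrough a d ∧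
      x ∈ openSegment ℝ (w i) (w j) := by
  have hf := mem_face hl hx ((mem_lineThrough_iff_cross hd).1 hxl)
  obtain ⟨_, i, ⟨hi, hi0⟩, rfl⟩ := convexHull_nonempty_iff.1 ⟨x, hf⟩
  have hil : w i ∈ lineThrough a d := (mem_lineThrough_iff_cross hd).2 hi0
  by_cases hex : ∃ j ≤ m, j ≠ i ∧ w j ∈ lineThrough a d
  · obtain ⟨j, hj, hji, hjl⟩ := hex
    have hs := mem_segment_of_contact g hd hl hx hxl hi hj hji.symm hil hjl
    rw [← insert_endpoints_openSegment] at hs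
    rcases hs with rfl | rfl | hs
    · exact Or.inl ⟨i, hi, rfl⟩
    · exact Or.inl ⟨j, hj, rfl⟩
    · rcases lt_or_gt_of_ne hji with hlt | hlt
      · exact Or.inr ⟨j, i, hlt, hi, hjl, hil, by rwa [openSegment_symm]⟩
      · exact Or.inr ⟨i, j, hlt, hj, hil, hjl, hs⟩
  · push Not at hex
    refine Or.inl ⟨i, hi, ?_⟩
    have : w '' {k | k ≤ m ∧ cross d (w k - a) = 0} ⊆ {w i} := by
      rintro _ ⟨k, ⟨hk, hk0⟩, rfl⟩
      by_contra hne
      refine hex k hk ?_ ((mem_lineThrough_iff_cross hd).2 hk0)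
      rintro rfl; exact hne rfl
    have := convexHull_mono (𝕜 := ℝ) this hf
    rwa [convexHull_singleton] at this

lemma IsArcThrough.time_lt_iff (h : IsArcThrough m w A T κ) {i j : ℕ} (hi : i ≤ m) (hj : j ≤ m) :
    κ i < κ j ↔ i < j := by
  constructor
  · intro hlt
    by_contra hc
    rcases (not_lt.1 hc).eq_or_lt with rfl | h'
    · exact lt_irrefl _ hlt
    · exact lt_asymm hlt (h.time_lt j i h' hi)
  · exact fun hlt => h.time_lt i j hlt hj

lemma IsArcThrough.time_eq (h : IsArcThrough m w A T κ) {t : ℝ} (ht : t ∈ Set.Icc 0 T) {i : ℕ}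
    (hi : i ≤ m) (he : A t = w i) : t = κ i :=
  h.inj ht (h.time_mem i hi) (he.trans (h.node i hi).symm)

/-- If the arc meets `M` twice and in between meets `M'` off `M`, then the nodes do so, up to the
order of the two lines. -/
theorem IsArcThrough.nodeLambda (h : IsArcThrough m w A T κ) {a d b e : ℂ} (hd : d ≠ 0)
    (he : e ≠ 0) (hl : OnLeft (nodeHull m w) a d) (hl' : OnLeft (nodeHull m w) b e) {r s t : ℝ}
    (hr0 : 0 ≤ r) (hrs : r < s) (hst : s < t) (htT : t ≤ T) (hr : A r ∈ lineThrough a d)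
    (ht : A t ∈ lineThrough a d) (hs : A s ∈ lineThrough b e) (hs' : A s ∉ lineThrough a d) :
    NodeLambda m w (lineThrough a d) (lineThrough b e) ∨
      NodeLambda m w (lineThrough b e) (lineThrough a d) := by
  have g := h.isGuide
  have mr : r ∈ Set.Icc 0 T := ⟨hr0, by linarith⟩
  have ms : s ∈ Set.Icc 0 T := ⟨by linarith, by linarith⟩
  have mt : t ∈ Set.Icc 0 T := ⟨by linarith, htT⟩
  -- A contact that is not a node is an inner point of an edge, so two different contacts always
  -- provide two nodes on the line.
  obtain ⟨i, j, hij, hj, hil, hjl⟩ : ∃ i j, i < j ∧ j ≤ m ∧ w i ∈ lineThrough a d ∧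
      w j ∈ lineThrough a d := by
    rcases contact_cases g hd hl (h.mem r mr) hr with ⟨k, hk, ek⟩ | ⟨i, j, h1, h2, h3, h4, -⟩
    · rcases contact_cases g hd hl (h.mem t mt) ht with ⟨l, hl', el⟩ | ⟨i, j, h1, h2, h3, h4, -⟩
      · have e1 := h.time_eq mr hk ek
        have e2 := h.time_eq mt hl' el
        exact ⟨k, l, (h.time_lt_iff hk hl').1 (by rw [← e1, ← e2]; linarith), hl', ek ▸ hr,
          el ▸ ht⟩
      · exact ⟨i, j, h1, h2, h3, h4⟩
    · exact ⟨i, j, h1, h2, h3, h4⟩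
  have hi : i ≤ m := hij.le.trans hj
  have hκij := h.time_lt i j hij hj
  have nodei := h.node i hi
  have nodej := h.node j hj
  have hopen : ∀ x, x ∈ Set.Icc 0 T → A x ∈ lineThrough a d → x ≠ κ i → x ≠ κ j →
      A x ∈ openSegment ℝ (A (κ i)) (A (κ j)) := by
    intro x hx hxl hxi hxj
    have := mem_segment_of_contact g hd hl (h.mem x hx) hxl hi hj hij.ne hil hjl
    rw [← insert_endpoints_openSegment] at this
    rcases this with e' | e' | e'
    · exact absurd (h.time_eq hx hi e') hxi
    · exact absurd (h.time_eq hx hj e') hxj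
    · rwa [nodei, nodej]
  have hsup := hl'.of_mem he hs
  have hsi : s ≠ κ i := by rintro rfl; rw [nodei] at hs'; exact hs' hil
  have hsj : s ≠ κ j := by rintro rfl; rw [nodej] at hs'; exact hs' hjl
  -- If s came before the visit to w i, the subarc from r to s would lead from an inner point of the
  -- edge off its line before either end is visited, against `not_disjoint`. The subarc from t back
  -- to s serves for w j.
  have his : κ i < s := by
    by_contra hc
    have hlt : s < κ i := lt_of_le_of_ne (not_lt.1 hc) hsi
    refine h.not_disjoint hd hl mr ms (h.time_mem i hi) (h.time_mem j hj) (by rwa [nodei])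
      (by rwa [nodej]) (hopen r mr hr (by linarith) (by linarith)) hs' he hsup ?_
    rw [Set.uIcc_of_le hrs.le, Set.uIcc_of_le hκij.le, Set.disjoint_left]
    intro x hx hx'
    linarith [hx.2, hx'.1]
  have hsj' : s < κ j := by
    by_contra hc
    have hlt : κ j < s := lt_of_le_of_ne (not_lt.1 hc) hsj.symm
    refine h.not_disjoint hd hl mt ms (h.time_mem i hi) (h.time_mem j hj) (by rwa [nodei])
      (by rwa [nodej]) (hopen t mt ht (by linarith) (by linarith)) hs' he hsup ?_
    rw [Set.uIcc_of_ge hst.le, Set.uIcc_of_le hκij.le, Set.disjoint_left]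
    intro x hx hx'
    linarith [hx.1, hx'.2]
  rcases contact_cases g he hl' (h.mem s ms) hs with ⟨k, hk, ek⟩ | ⟨c, c', hcc, hc', hcl, hcl', hso⟩
  · have e1 := h.time_eq ms hk ek
    refine Or.inl ⟨i, k, j, (h.time_lt_iff hi hk).1 (e1 ▸ his), (h.time_lt_iff hk hj).1 (e1 ▸ hsj'),
      hj, hil, hjl, ek ▸ hs, ek ▸ hs'⟩
  have hc : c ≤ m := hcc.le.trans hc'
  have hκcc := h.time_lt c c' hcc hc'
  have nodec := h.node c hc
  have nodec' := h.node c' hc'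
  have hwne := g.ne hc hc' hcc.ne
  have hso' : A s ∈ openSegment ℝ (A (κ c)) (A (κ c')) := by rwa [nodec, nodec']
  have hsc : s ≠ κ c := by
    rintro rfl
    rw [nodec] at hso
    exact hwne (left_mem_openSegment_iff.1 hso)
  have hsc' : s ≠ κ c' := by
    rintro rfl
    rw [nodec'] at hso
    exact hwne (right_mem_openSegment_iff.1 hso)
  -- If both ends of the second edge were visited after s, the subarc from A s back to w i, a node
  -- visited before s and so off this line, would contradict `not_disjoint`. In the same way w j
  -- excludes that both ends come before s.
  have hcs : κ c < s := by
    by_contra hcon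
    have hlt : s < κ c := lt_of_le_of_ne (not_lt.1 hcon) hsc
    refine h.not_disjoint he hl' ms (h.time_mem i hi) (h.time_mem c hc) (h.time_mem c' hc')
      (by rwa [nodec]) (by rwa [nodec']) hso' ?_ hd (by rw [nodei]; exact hl.of_mem hd hil) ?_
    · rw [nodei]
      intro hie
      rcases node_unique_of_contact g hc hc' hi hcc.ne hcl hcl' hie with rfl | rfl <;> linarith
    · rw [Set.uIcc_of_ge his.le, Set.uIcc_of_le hκcc.le, Set.disjoint_left]
      intro x hx hx'
      linarith [hx.2, hx'.1]
  have hsc2 : s < κ c' := by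
    by_contra hcon
    have hlt : κ c' < s := lt_of_le_of_ne (not_lt.1 hcon) hsc'.symm
    refine h.not_disjoint he hl' ms (h.time_mem j hj) (h.time_mem c hc) (h.time_mem c' hc')
      (by rwa [nodec]) (by rwa [nodec']) hso' ?_ hd (by rw [nodej]; exact hl.of_mem hd hjl) ?_
    · rw [nodej]
      intro hje
      rcases node_unique_of_contact g hc hc' hj hcc.ne hcl hcl' hje with rfl | rfl <;> linarith
    · rw [Set.uIcc_of_le hsj'.le, Set.uIcc_of_le hκcc.le, Set.disjoint_left]
      intro x hx hx'
      linarith [hx.1, hx'.2]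
  have hcj : c < j := (h.time_lt_iff hc hj).1 (by linarith)
  have hic' : i < c' := (h.time_lt_iff hi hc').1 (by linarith)
  have offM : ∀ k ≤ m, k ≠ i → k ≠ j → w k ∉ lineThrough a d := fun k hk h1 h2 hkl =>
    (node_unique_of_contact g hi hj hk hij.ne hil hjl hkl).elim h1 h2
  have offM' : ∀ k ≤ m, k ≠ c → k ≠ c' → w k ∉ lineThrough b e := fun k hk h1 h2 hkl =>
    (node_unique_of_contact g hc hc' hk hcc.ne hcl hcl' hkl).elim h1 h2
  -- Both visiting intervals contain s, so the one that starts later has its first node inside the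
  -- other. For equal first nodes the last ones are compared; if these agree too, A s lies on the
  -- first line.
  rcases lt_trichotomy i c with h1 | rfl | h1
  · exact Or.inl ⟨i, c, j, h1, hcj, hj, hil, hjl, hcl, offM c hc h1.ne' hcj.ne⟩
  · rcases lt_trichotomy c' j with h2 | rfl | h2
    · exact Or.inl ⟨i, c', j, hic', h2, hj, hil, hjl, hcl', offM c' hc' hic'.ne' h2.ne⟩
    · exfalso
      apply hs'
      obtain ⟨x, y, -, -, hxy, hA⟩ := hso
      rw [← lineThrough_eq_of_mem hil] at hjl ⊢
      obtain ⟨z, hz⟩ := mem_lineThrough.1 hjl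
      refine mem_lineThrough.2 ⟨y * z, ?_⟩
      have hxy' : (x : ℂ) + y = 1 := by exact_mod_cast hxy
      simp only [Complex.real_smul] at hA
      push_cast
      linear_combination -hA + y * hz + w i * hxy'
    · exact Or.inr ⟨i, j, c', hij, h2, hc', hcl, hcl', hjl, offM' j hj hij.ne' h2.ne⟩
  · exact Or.inr ⟨c, i, c', h1, hic', hc', hcl, hcl', hil, offM' i hi h1.ne' hic'.ne⟩

end Arc

/-! ### Polygonal arcs and their guide paths -/

section Polyline

variable {N : ℕ} {p : ℕ → ℂ}

lemma polyline_natCast (p : ℕ → ℂ) (k : ℕ) : polyline p k = p k := by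
  simp [polyline]

lemma polyline_eq_lineMap {k : ℕ} {t : ℝ} (ht : t ∈ Set.Icc (k : ℝ) (k + 1)) :
    polyline p t = AffineMap.lineMap (p k) (p (k + 1)) (t - k) := by
  rcases ht.2.lt_or_eq with h | h
  · have : ⌊t⌋₊ = k := (Nat.floor_eq_iff ((Nat.cast_nonneg k).trans ht.1)).2 ⟨ht.1, h⟩
    rw [polyline, this]
  · rw [h, show ((k : ℝ) + 1) = ((k + 1 : ℕ) : ℝ) by push_cast; rfl, polyline_natCast]
    simp

lemma continuousOn_polyline (p : ℕ → ℂ) (N : ℕ) :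
    ContinuousOn (polyline p) (Set.Icc (0 : ℝ) N) := by
  induction N with
  | zero => simp
  | succ N ih =>
    have hu : Set.Icc (0 : ℝ) ((N + 1 : ℕ) : ℝ) = Set.Icc (0 : ℝ) N ∪ Set.Icc (N : ℝ) (N + 1) := by
      rw [Set.Icc_union_Icc_eq_Icc (Nat.cast_nonneg N) (by linarith)]; push_cast; rfl
    rw [hu]
    refine ih.union_of_isClosed ?_ isClosed_Icc isClosed_Icc
    refine ContinuousOn.congr (f := fun t : ℝ => AffineMap.lineMap (p N) (p (N + 1)) (t - N)) ?_
      fun t ht => polyline_eq_lineMap ht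
    simp only [AffineMap.lineMap_apply]
    fun_prop

lemma polyline_mem_convexHull {t : ℝ} (ht : t ∈ Set.Icc (0 : ℝ) N) :
    polyline p t ∈ convexHull ℝ (p '' Set.Iic N) := by
  have hv : ∀ k ≤ N, p k ∈ convexHull ℝ (p '' Set.Iic N) := fun k hk =>
    subset_convexHull ℝ _ ⟨k, hk, rfl⟩
  rcases ht.2.lt_or_eq with h | h
  · have h1 := Nat.floor_le ht.1
    have h2 := Nat.lt_floor_add_one t
    have hk : ⌊t⌋₊ < N := by
      have : (⌊t⌋₊ : ℝ) < N := by linarith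
      exact_mod_cast this
    have hs := (convex_convexHull ℝ (p '' Set.Iic N)).segment_subset (hv _ hk.le) (hv _ hk)
    apply hs
    rw [segment_eq_image_lineMap]
    exact ⟨_, ⟨by linarith, by linarith⟩, rfl⟩
  · rw [h, polyline_natCast]; exact hv N le_rfl

lemma vertex_mem_arcSet {k : ℕ} (hk : k ≤ N) : p k ∈ arcSet N p :=
  ⟨k, ⟨Nat.cast_nonneg k, by exact_mod_cast hk⟩, polyline_natCast p k⟩

lemma hull_eq_convexHull_vertices (N : ℕ) (p : ℕ → ℂ) :
    hull N p = convexHull ℝ (p '' Set.Iic N) := by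
  apply subset_antisymm
  · refine convexHull_min ?_ (convex_convexHull ℝ _)
    rintro _ ⟨t, ht, rfl⟩
    exact polyline_mem_convexHull ht
  · refine convexHull_mono ?_
    rintro _ ⟨k, hk, rfl⟩
    exact vertex_mem_arcSet hk

lemma extremePoints_hull_subset : (hull N p).extremePoints ℝ ⊆ p '' Set.Iic N := by
  rw [hull_eq_convexHull_vertices]
  exact extremePoints_convexHull_subset

lemma hull_eq_convexHull_extremePoints :
    hull N p = convexHull ℝ ((hull N p).extremePoints ℝ) := by
  have hfin : (p '' Set.Iic N).Finite := (Set.finite_Iic N).image p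
  have hc : IsCompact (hull N p) := by
    rw [hull_eq_convexHull_vertices]; exact hfin.isCompact_convexHull ℝ
  have := closure_convexHull_extremePoints hc (convex_convexHull ℝ _)
  rw [((hfin.subset extremePoints_hull_subset).isClosed_convexHull ℝ).closure_eq] at this
  exact this.symm

open Classical in
/-- The indices of the vertices of the arc that are vertices of the hull. -/
def visits (N : ℕ) (p : ℕ → ℂ) : List ℕ :=
  (List.range (N + 1)).filter fun k => decide (p k ∈ (hull N p).extremePoints ℝ)

lemma mem_visits {k : ℕ} :
    k ∈ visits N p ↔ k ≤ N ∧ p k ∈ (hull N p).extremePoints ℝ := by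
  classical
  rw [visits, List.mem_filter, List.mem_range, Nat.lt_succ_iff, decide_eq_true_iff]

lemma guide_eq_map_visits : guide N p = (visits N p).map p := by
  classical
  rw [guide, visits, List.filter_map]
  rfl

lemma guideLen_eq : guideLen N p = (visits N p).length := by
  rw [guideLen, guide_eq_map_visits, List.length_map]

lemma gnode_eq {i : ℕ} (hi : i < guideLen N p) : gnode N p i = p ((visits N p).getD i 0) := by
  have hi' : i < (visits N p).length := by rwa [← guideLen_eq]
  rw [gnode, guide_eq_map_visits, List.getD_eq_getElem _ _ (by simpa using hi'),
    List.getD_eq_getElem _ _ hi', List.getElem_map]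

lemma visits_spec {i : ℕ} (hi : i < guideLen N p) :
    (visits N p).getD i 0 ≤ N ∧ p ((visits N p).getD i 0) ∈ (hull N p).extremePoints ℝ := by
  have hi' : i < (visits N p).length := by rwa [← guideLen_eq]
  rw [List.getD_eq_getElem _ _ hi']
  exact mem_visits.1 (List.getElem_mem hi')

lemma visits_lt {i j : ℕ} (hij : i < j) (hj : j < guideLen N p) :
    (visits N p).getD i 0 < (visits N p).getD j 0 := by
  classical
  have hj' : j < (visits N p).length := by rwa [← guideLen_eq]
  rw [List.getD_eq_getElem _ _ hj', List.getD_eq_getElem _ _ (hij.trans hj')]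
  have hs : (visits N p).Pairwise (· < ·) := List.Pairwise.filter _ List.pairwise_lt_range
  exact List.pairwise_iff_getElem.1 hs i j _ _ hij

lemma exists_gnode_eq {z : ℂ} (hz : z ∈ (hull N p).extremePoints ℝ) :
    ∃ i < guideLen N p, gnode N p i = z := by
  obtain ⟨k, hk, rfl⟩ := extremePoints_hull_subset hz
  have hmem : k ∈ visits N p := mem_visits.2 ⟨hk, hz⟩
  obtain ⟨i, hi, he⟩ := List.getElem_of_mem hmem
  have hi' : i < guideLen N p := by rwa [guideLen_eq]
  refine ⟨i, hi', ?_⟩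
  rw [gnode_eq hi', List.getD_eq_getElem _ _ hi, he]

lemma gnode_mem_extremePoints {i : ℕ} (hi : i < guideLen N p) :
    gnode N p i ∈ (hull N p).extremePoints ℝ := by
  rw [gnode_eq hi]; exact (visits_spec hi).2

lemma gnode_image_Iio : gnode N p '' Set.Iio (guideLen N p) = (hull N p).extremePoints ℝ := by
  ext z
  constructor
  · rintro ⟨i, hi, rfl⟩; exact gnode_mem_extremePoints hi
  · intro hz
    obtain ⟨i, hi, h⟩ := exists_gnode_eq hz
    exact ⟨i, hi, h⟩

lemma polyline_visits {i : ℕ} (hi : i < guideLen N p) :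
    polyline p ((visits N p).getD i 0 : ℕ) = gnode N p i := by
  rw [polyline_natCast, gnode_eq hi]

lemma visits_mem_Icc {i : ℕ} (hi : i < guideLen N p) :
    (((visits N p).getD i 0 : ℕ) : ℝ) ∈ Set.Icc (0 : ℝ) N :=
  ⟨Nat.cast_nonneg _, by exact_mod_cast (visits_spec hi).1⟩

/-- An arc whose hull is a segment is a segment. -/
lemma arcSet_eq_segment {a b : ℂ} (ha : a ∈ arcSet N p) (hb : b ∈ arcSet N p)
    (h : hull N p = segment ℝ a b) : arcSet N p = segment ℝ a b := by
  apply subset_antisymm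
  · rw [← h]; exact subset_convexHull ℝ _
  · rcases eq_or_ne a b with rfl | hab
    · rw [segment_same]; simpa using ha
    intro z hz
    have hpre : IsPreconnected (arcSet N p) :=
      isPreconnected_Icc.image _ (continuousOn_polyline p N)
    -- The projection to the line of the segment, up to a factor. The connected arc attains every
    -- value between those at a and b, and on the segment the value determines the point.
    set f : ℂ → ℝ := fun z => ((z - a) * conj (b - a)).re with hf
    have hfc : ContinuousOn f (arcSet N p) := by
      have : Continuous f := Complex.continuous_re.comp (by fun_prop)
      exact this.continuousOn
    have hN : 0 < Complex.normSq (b - a) := Complex.normSq_pos.2 (sub_ne_zero.2 hab.symm)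
    have hfl : ∀ t : ℝ, f (a + t * (b - a)) = t * Complex.normSq (b - a) := by
      intro t
      rw [hf]
      simp only [add_sub_cancel_left]
      rw [mul_assoc, Complex.mul_conj, ← Complex.ofReal_mul, Complex.ofReal_re]
    have hseg : ∀ z ∈ segment ℝ a b, ∃ t : ℝ, 0 ≤ t ∧ t ≤ 1 ∧ z = a + t * (b - a) := by
      intro z hz
      rw [segment_eq_image'] at hz
      obtain ⟨t, ht, rfl⟩ := hz
      exact ⟨t, ht.1, ht.2, by simp⟩
    obtain ⟨t, ht0, ht1, rfl⟩ := hseg z hz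
    have hfa : f a = 0 := by simp [hf]
    have hfb : f b = Complex.normSq (b - a) := by
      have := hfl 1
      simpa using this
    have hmem : f (a + t * (b - a)) ∈ Set.Icc (f a) (f b) := by
      rw [hfa, hfb, hfl]
      exact ⟨by positivity, by nlinarith⟩
    obtain ⟨y, hy, hyf⟩ := hpre.intermediate_value ha hb hfc hmem
    obtain ⟨s, -, -, rfl⟩ := hseg y (h ▸ subset_convexHull ℝ _ hy)
    rw [hfl, hfl] at hyf
    rw [← mul_right_cancel₀ hN.ne' hyf]
    exact hy

/-- With at most two vertices the hull would be empty, a point, or a segment between two points of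
the arc; in the last two cases the arc itself would be a segment. -/
lemma IsOpenSimpleNonSegment.three_le (hp : IsOpenSimpleNonSegment N p) : 3 ≤ guideLen N p := by
  by_contra hlt
  apply hp.2
  have hne : (hull N p).Nonempty := ⟨p 0, subset_convexHull ℝ _ (vertex_mem_arcSet (Nat.zero_le N))⟩
  have hH := hull_eq_convexHull_extremePoints (N := N) (p := p)
  rw [← gnode_image_Iio] at hH
  have harc : ∀ i < guideLen N p, gnode N p i ∈ arcSet N p := fun i hi => by
    rw [gnode_eq hi]; exact vertex_mem_arcSet (visits_spec hi).1
  have hcases : guideLen N p = 0 ∨ guideLen N p = 1 ∨ guideLen N p = 2 := by omega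
  rcases hcases with h | h | h
  · rw [hH, h] at hne
    simp at hne
  · have : Set.Iio (1 : ℕ) = {0} := by ext; simp
    rw [h, this, Set.image_singleton, convexHull_singleton, ← segment_same ℝ] at hH
    exact ⟨_, _, arcSet_eq_segment (harc 0 (by omega)) (harc 0 (by omega)) hH⟩
  · have : Set.Iio (2 : ℕ) = {0, 1} := by ext; simp; omega
    rw [h, this, Set.image_pair, convexHull_pair] at hH
    exact ⟨_, _, arcSet_eq_segment (harc 0 (by omega)) (harc 1 (by omega)) hH⟩

lemma IsOpenSimpleNonSegment.hull_eq (hp : IsOpenSimpleNonSegment N p) :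
    hull N p = nodeHull (guideLen N p - 1) (gnode N p) := by
  have h3 := hp.three_le
  have : Set.Iic (guideLen N p - 1) = Set.Iio (guideLen N p) := by ext; simp; omega
  rw [nodeHull, this, gnode_image_Iio, ← hull_eq_convexHull_extremePoints]

/-- Simplicity makes the nodes distinct, so omitting an index omits a point, and an extreme point is
not in the convex hull of the remaining ones. -/
theorem IsOpenSimpleNonSegment.isArcThrough (hp : IsOpenSimpleNonSegment N p) :
    IsArcThrough (guideLen N p - 1) (gnode N p) (polyline p) N
      (fun i => ((visits N p).getD i 0 : ℕ)) := by
  have h3 := hp.three_le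
  have hinj : ∀ i < guideLen N p, ∀ j < guideLen N p, gnode N p i = gnode N p j → i = j := by
    intro i hi j hj he
    rw [← polyline_visits hi, ← polyline_visits hj] at he
    have := hp.1 (visits_mem_Icc hi) (visits_mem_Icc hj) he
    have this' : (visits N p).getD i 0 = (visits N p).getD j 0 := by exact_mod_cast this
    rcases lt_trichotomy i j with h | h | h
    · exact absurd this' (visits_lt h hj).ne
    · exact h
    · exact absurd this' (visits_lt h hi).ne'
  refine ⟨by omega, fun i hi => ?_, continuousOn_polyline p N, hp.1, fun t ht => ?_,
    fun i hi => visits_mem_Icc (by omega), fun i j hij hj => ?_,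
    fun i hi => polyline_visits (by omega)⟩
  · have hi' : i < guideLen N p := by omega
    have hext := gnode_mem_extremePoints hi'
    have hconv : Convex ℝ (hull N p) := convex_convexHull ℝ _
    rw [hconv.mem_extremePoints_iff_mem_sdiff_convexHull_sdiff] at hext
    intro hmem
    refine hext.2 (convexHull_mono ?_ hmem)
    rintro _ ⟨j, ⟨hj, hji⟩, rfl⟩
    have hj' : j < guideLen N p := by omega
    exact ⟨extremePoints_subset (gnode_mem_extremePoints hj'), fun he => hji (hinj j hj' i hi' he)⟩
  · rw [← hp.hull_eq]; exact subset_convexHull ℝ _ ⟨t, ht, rfl⟩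
  · exact_mod_cast visits_lt hij (by omega)

/-- The Λ-property of a pair of support lines only depends on the nodes of the guide path. -/
theorem IsOpenSimpleNonSegment.lambdaPairs_eq (hp : IsOpenSimpleNonSegment N p) (φ : ℝ) :
    lambdaPairs N p φ = nodePairs (guideLen N p - 1) (gnode N p) φ := by
  have h3 := hp.three_le
  have hA := hp.isArcThrough
  ext q
  constructor
  · rintro ⟨M, M', rfl, hM, hM', hang, r, s, t, hr, hrs, hst, ht, h1, h2, h3, h4⟩
    rw [hp.hull_eq] at hM hM' hang
    have hMM := hM
    have hMM' := hM'
    obtain ⟨a, d, -, hd, rfl, hl⟩ := hM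
    obtain ⟨b, e, -, he, rfl, hl'⟩ := hM'
    rcases hA.nodeLambda hd he hl hl' hr hrs hst ht h1 h2 h3 h4 with h | h
    · exact ⟨_, _, rfl, hMM, hMM', hang, h⟩
    · exact ⟨_, _, Sym2.eq_swap, hMM', hMM, hang.symm, h⟩
  · rintro ⟨M, M', rfl, hM, hM', hang, i, j, k, hij, hjk, hk, h1, h2, h3, h4⟩
    rw [← hp.hull_eq] at hM hM' hang
    rw [← hA.node i (by omega)] at h1
    rw [← hA.node k hk] at h2
    rw [← hA.node j (by omega)] at h3 h4
    exact ⟨M, M', rfl, hM, hM', hang, _, _, _, (hA.time_mem i (by omega)).1,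
      hA.time_lt i j hij (by omega), hA.time_lt j k hjk hk, (hA.time_mem k hk).2, h1, h2, h3, h4⟩

end Polyline

/-! ### Crossing links -/

lemma continuous_orient (a b : ℂ) : Continuous fun x => orient a b x := by
  simp only [orient_eq]
  fun_prop

/-- The midpoint of a diagonal is an inner point. -/
lemma midpoint_mem_interior {K : Set ℂ} (hK : Convex ℝ K) {P Q A B : ℂ} (hP : P ∈ K) (hQ : Q ∈ K)
    (hA : A ∈ K) (hB : B ∈ K) (h1 : 0 < orient P Q A) (h2 : orient P Q B < 0) :
    (1 / 2 : ℝ) • P + (1 / 2 : ℝ) • Q ∈ interior K := by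
  rw [mem_interior]
  -- The open quadrilateral P B Q A; its diagonal P Q splits it into two triangles with corners in
  -- K.
  refine ⟨{x | 0 < orient Q A x} ∩ {x | 0 < orient A P x} ∩
    ({x | 0 < orient P B x} ∩ {x | 0 < orient B Q x}), ?_, ?_, ?_⟩
  · rintro x ⟨⟨x1, x2⟩, x3, x4⟩
    rcases le_total 0 (orient P Q x) with h | h
    · refine convexHull_min ?_ hK (mem_convexHull_of_orient h1 h (le_of_lt x1) (le_of_lt x2))
      rintro z (rfl | rfl | rfl) <;> assumption
    · have e1 : 0 < orient Q P B := by
        have : orient Q P B = -orient P Q B := by simp only [orient_eq]; ring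
        linarith
      have e2 : 0 ≤ orient Q P x := by
        have : orient Q P x = -orient P Q x := by simp only [orient_eq]; ring
        linarith
      refine convexHull_min ?_ hK (mem_convexHull_of_orient e1 e2 (le_of_lt x3) (le_of_lt x4))
      rintro z (rfl | rfl | rfl) <;> assumption
  · exact ((isOpen_lt continuous_const (continuous_orient _ _)).inter
      (isOpen_lt continuous_const (continuous_orient _ _))).inter
      ((isOpen_lt continuous_const (continuous_orient _ _)).inter
      (isOpen_lt continuous_const (continuous_orient _ _)))
  · have key : orient Q A ((1 / 2 : ℝ) • P + (1 / 2 : ℝ) • Q) = orient P Q A / 2 ∧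
        orient A P ((1 / 2 : ℝ) • P + (1 / 2 : ℝ) • Q) = orient P Q A / 2 ∧
        orient P B ((1 / 2 : ℝ) • P + (1 / 2 : ℝ) • Q) = -orient P Q B / 2 ∧
        orient B Q ((1 / 2 : ℝ) • P + (1 / 2 : ℝ) • Q) = -orient P Q B / 2 := by
      simp only [orient_eq, Complex.add_re, Complex.add_im, Complex.real_smul, Complex.mul_re,
        Complex.mul_im, Complex.ofReal_re, Complex.ofReal_im]
      refine ⟨?_, ?_, ?_, ?_⟩ <;> ring
    simp only [Set.mem_inter_iff, Set.mem_ofPred_eq, key.1, key.2.1, key.2.2.1, key.2.2.2]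
    refine ⟨⟨?_, ?_⟩, ?_, ?_⟩ <;> linarith

lemma mem_frontier_of_onLeft {K : Set ℂ} {a d z : ℂ} (hd : d ≠ 0) (hl : OnLeft K a d) (hz : z ∈ K)
    (hza : cross d (z - a) = 0) : z ∈ frontier K := by
  refine ⟨subset_closure hz, fun hi => ?_⟩
  obtain ⟨ε, hε, hball⟩ := Metric.mem_nhds_iff.1 (mem_interior_iff_mem_nhds.1 hi)
  have hn : 0 < ‖d‖ := norm_pos_iff.2 hd
  -- A step of length ε / 2 along the right normal stays in the ball but leaves the half-plane.
  set c : ℝ := ε / (2 * ‖d‖) with hc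
  have hc0 : 0 < c := by positivity
  have hmem : z - c * (Complex.I * d) ∈ K := by
    apply hball
    rw [Metric.mem_ball, dist_eq_norm]
    have : z - c * (Complex.I * d) - z = -(c * (Complex.I * d)) := by ring
    rw [this, norm_neg, norm_mul, norm_mul, Complex.norm_I, one_mul, Complex.norm_real,
      Real.norm_of_nonneg hc0.le, hc]
    field_simp
    linarith
  have h1 := hl _ hmem
  have h2 : cross d (Complex.I * d) = Complex.normSq d := by
    simp only [cross_eq, Complex.mul_re, Complex.mul_im, Complex.I_re, Complex.I_im,
      Complex.normSq_apply]; ring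
  have h3 : z - c * (Complex.I * d) - a = (z - a) - c * (Complex.I * d) := by ring
  rw [h3, cross_sub_right, hza, cross_real_mul_right, h2] at h1
  have := mul_pos hc0 (Complex.normSq_pos.2 hd)
  linarith

section Guide

variable {m : ℕ} {w : ℕ → ℂ} {σ : ℝ}

lemma IsGuide.axis_ne_zero (g : IsGuide m w) {i : ℕ} (h0 : 0 < i) (hi : i < m) :
    orient (w 0) (w m) (w i) ≠ 0 :=
  g.orient_ne (Nat.zero_le _) le_rfl hi.le (by omega) (by omega) (by omega)

lemma IsEdge.segment_subset_frontier (g : IsGuide m w) (hσ : σ = 1 ∨ σ = -1) {a b : ℕ}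
    (h : IsEdge m w σ a b) : segment ℝ (w a) (w b) ⊆ frontier (nodeHull m w) := by
  have hne := h.ne_zero g
  have hab := h.lt
  have hb := h.le
  have hl : OnLeft (nodeHull m w) (w a) ((-σ : ℝ) * (w b - w a)) := onLeft_nodeHull.2 fun k hk => by
    rw [cross_real_mul_left]
    linarith [h.cross_nonpos g hσ hk]
  intro z hz
  refine mem_frontier_of_onLeft ?_ hl ?_ ?_
  · refine mul_ne_zero ?_ hne
    rcases hσ with rfl | rfl <;> norm_num
  · exact (convex_convexHull ℝ _).segment_subset (node_mem (by omega)) (node_mem hb) hz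
  · rw [segment_eq_image'] at hz
    obtain ⟨t, -, rfl⟩ := hz
    rw [add_sub_cancel_left, Complex.real_smul, cross_real_mul_left, cross_real_mul_right,
      cross_self, mul_zero, mul_zero]

/-- A link of the guide path does not lie on the boundary of the hull if and only if it joins
nodes on different sides of the axis. -/
lemma IsGuide.crossing_iff (g : IsGuide m w) {i : ℕ} (hi : i < m) :
    ¬ segment ℝ (w i) (w (i + 1)) ⊆ frontier (nodeHull m w) ↔
      orient (w 0) (w m) (w i) * orient (w 0) (w m) (w (i + 1)) < 0 := by
  have o1 : (1 : ℝ) = 1 ∨ (1 : ℝ) = -1 := Or.inl rfl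
  have o2 : (-1 : ℝ) = 1 ∨ (-1 : ℝ) = -1 := Or.inr rfl
  constructor
  · intro hns
    by_contra hc
    push Not at hc
    -- Head and tail belong to both chains, so two ends that are not strictly on opposite sides
    -- share a chain; being consecutive in time they then form an edge.
    obtain ⟨σ, hσ, h1, h2⟩ : ∃ σ : ℝ, (σ = 1 ∨ σ = -1) ∧ Chain m w σ i ∧ Chain m w σ (i + 1) := by
      rcases g.chain_or o1 hi.le with h1 | h1 <;>
      rcases g.chain_or o1 (by omega : i + 1 ≤ m) with h2 | h2
      · exact ⟨1, o1, h1, h2⟩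
      · rcases h1 with h1 | h1 | h1
        · exact ⟨-1, o2, Or.inl h1, h2⟩
        · omega
        · rcases h2 with h2 | h2 | h2
          · omega
          · exact ⟨1, o1, Or.inr (Or.inr h1), Or.inr (Or.inl h2)⟩
          · unfold Side at h1 h2; nlinarith
      · rcases h2 with h2 | h2 | h2
        · omega
        · exact ⟨-1, o2, h1, Or.inr (Or.inl h2)⟩
        · rcases h1 with h1 | h1 | h1
          · exact ⟨1, o1, Or.inl h1, Or.inr (Or.inr h2)⟩
          · omega
          · unfold Side at h1 h2; nlinarith
      · exact ⟨-1, o2, h1, h2⟩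
    have hE : IsEdge m w σ i (i + 1) := ⟨Nat.lt_succ_self i, hi, h1, h2, fun k h3 h4 => by omega⟩
    exact hns (hE.segment_subset_frontier g hσ)
  · intro hlt hsub
    have hnot : ¬ SameSide m w i (i + 1) := by
      intro hs
      rcases mul_neg_iff.1 hlt with ⟨h1, h2⟩ | ⟨h1, h2⟩
      · exact hs.not_side g o1 hi.le hi (by unfold Side; linarith) (by unfold Side; linarith)
      · exact hs.not_side g o2 hi.le hi (by unfold Side; linarith) (by unfold Side; linarith)
    unfold SameSide at hnot
    push Not at hnot
    obtain ⟨k, hk, l, hl, hkl⟩ := hnot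
    have hK : Convex ℝ (nodeHull m w) := convex_convexHull ℝ _
    have hmid : (1 / 2 : ℝ) • w i + (1 / 2 : ℝ) • w (i + 1) ∈ interior (nodeHull m w) := by
      rcases mul_neg_iff.1 hkl with ⟨h1, h2⟩ | ⟨h1, h2⟩
      · exact midpoint_mem_interior hK (node_mem hi.le) (node_mem hi) (node_mem hk) (node_mem hl)
          h1 h2
      · exact midpoint_mem_interior hK (node_mem hi.le) (node_mem hi) (node_mem hl) (node_mem hk)
          h2 h1
    exact (hsub ⟨1 / 2, 1 / 2, by norm_num, by norm_num, by norm_num, rfl⟩).2 hmid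

/-- The first link that changes the side of the axis ends in the last node of the first edge on
the other side. -/
lemma edgeEnd_zero (g : IsGuide m w) (hσ : σ = 1 ∨ σ = -1) (h1 : Side m w σ 1) {b : ℕ}
    (hb : b < m)
    (hcross : b = m - 1 ∨ orient (w 0) (w m) (w b) * orient (w 0) (w m) (w (b + 1)) < 0)
    (hmin : ∀ i < b, 0 ≤ orient (w 0) (w m) (w i) * orient (w 0) (w m) (w (i + 1))) :
    edgeEnd m w σ 0 = 1 ∧ edgeEnd m w (-σ) 0 = b + 1 := by
  have hm := g.two_le
  -- No link before b changes the side, so w 1, …, w b all stay on the side of w 1.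
  have hside : ∀ i, 1 ≤ i → i ≤ b → Side m w σ i := by
    intro i hi
    induction i, hi using Nat.le_induction with
    | base => exact fun _ => h1
    | succ k hk ih =>
      intro hkb
      have h2 := ih (by omega)
      have h3 := hmin k (by omega)
      refine (g.side_or hσ (Nat.succ_pos k) (by omega)).resolve_right fun h4 => ?_
      unfold Side at h2 h4
      rcases hσ with rfl | rfl <;> nlinarith
  have hb1 : 1 ≤ b := by
    rcases Nat.eq_zero_or_pos b with rfl | h
    · rcases hcross with h | h
      · omega
      · simp [orient_eq] at h
    · exact h
  constructor
  · have hE : IsEdge m w σ 0 1 := ⟨one_pos, by omega, Or.inl rfl, Or.inr (Or.inr h1),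
      fun k h2 h3 => by omega⟩
    exact (hE.eq_edge le_rfl one_pos).2
  · have hend : Chain m w (-σ) (b + 1) := by
      rcases hcross with h | h
      · exact Or.inr (Or.inl (by omega))
      · have h2 := hside b hb1 le_rfl
        refine Or.inr (Or.inr ?_)
        unfold Side at h2 ⊢
        rcases hσ with rfl | rfl <;> nlinarith
    have hE : IsEdge m w (-σ) 0 (b + 1) := ⟨Nat.succ_pos b, hb, Or.inl rfl, hend,
      fun k h2 h3 => (hside k h2 (by omega)).not_neg⟩
    exact (hE.eq_edge le_rfl (Nat.succ_pos b)).2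

/-- The counterpart of `edgeEnd_zero` in reversed time: after the last crossing link the nodes stay
on the side of w (m - 1), so the last edge on the other side starts where that link starts, or at
the head. -/
lemma edgeStart_last (g : IsGuide m w) (hσ : σ = 1 ∨ σ = -1) (h1 : Side m w σ (m - 1)) {a : ℕ}
    (ha : a < m) (hcross : a = 0 ∨ orient (w 0) (w m) (w a) * orient (w 0) (w m) (w (a + 1)) < 0)
    (hmax : ∀ i, a < i → i < m → 0 ≤ orient (w 0) (w m) (w i) * orient (w 0) (w m) (w (i + 1))) :
    edgeStart m w σ (m - 1) = m - 1 ∧ edgeStart m w (-σ) (m - 1) = a := by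
  have hm := g.two_le
  have hside : ∀ j, ∀ i, a < i → i < m → i + j = m - 1 → Side m w σ i := by
    intro j
    induction j with
    | zero => intro i _ _ h; rwa [show i = m - 1 by omega]
    | succ k ih =>
      intro i h2 h3 h4
      have h5 := ih (i + 1) (by omega) (by omega) (by omega)
      have h6 := hmax i h2 h3
      refine (g.side_or hσ (by omega) h3).resolve_right fun h7 => ?_
      unfold Side at h5 h7
      rcases hσ with rfl | rfl <;> nlinarith
  have ha1 : a < m - 1 := by
    rcases hcross with h | h
    · omega
    · by_contra hc
      have : a + 1 = m := by omega
      rw [this] at h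
      have e : orient (w 0) (w m) (w m) = 0 := by simp only [orient_eq]; ring
      rw [e, mul_zero] at h
      exact lt_irrefl _ h
  constructor
  · have hE : IsEdge m w σ (m - 1) m := ⟨by omega, le_rfl, Or.inr (Or.inr h1), Or.inr (Or.inl rfl),
      fun k h2 h3 => by omega⟩
    exact (hE.eq_edge le_rfl (by omega)).1
  · have hstart : Chain m w (-σ) a := by
      rcases hcross with h | h
      · exact Or.inl h
      · have h2 := hside (m - 1 - (a + 1)) (a + 1) (by omega) (by omega) (by omega)
        refine Or.inr (Or.inr ?_)
        unfold Side at h2 ⊢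
        rcases hσ with rfl | rfl <;> nlinarith
    have hE : IsEdge m w (-σ) a m := ⟨ha, le_rfl, hstart, Or.inr (Or.inl rfl),
      fun k h2 h3 => (hside (m - 1 - k) k h2 h3 (by omega)).not_neg⟩
    exact (hE.eq_edge (by omega) (by omega)).1

/-! ### Tilts of the first and the last edges -/

lemma arg_div_of_sin {z₁ z₂ : ℂ} (h1 : z₁ ≠ 0) (h2 : z₂ ≠ 0) (h3 : -Real.pi < z₁.arg - z₂.arg)
    (h4 : z₁.arg - z₂.arg ≤ Real.pi) : (z₁ / z₂).arg = z₁.arg - z₂.arg := by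
  have e1 := Complex.norm_mul_exp_arg_mul_I z₁
  have e2 := Complex.norm_mul_exp_arg_mul_I z₂
  have p1 : 0 < ‖z₁‖ := norm_pos_iff.2 h1
  have p2 : 0 < ‖z₂‖ := norm_pos_iff.2 h2
  have : z₁ / z₂ = ((‖z₁‖ / ‖z₂‖ : ℝ) : ℂ) *
      Complex.exp ((z₁.arg - z₂.arg : ℝ) * Complex.I) := by
    conv_lhs => rw [← e1, ← e2]
    push_cast
    rw [sub_mul, Complex.exp_sub, mul_div_mul_comm]
  rw [this, Complex.arg_real_mul _ (by positivity), Complex.arg_exp_mul_I, toIocMod_eq_self]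
  constructor <;> linarith

/-- The signs place the difference of the arguments in [0, 2π), and its positive sine bounds it by
π, so no full turn is lost. -/
lemma arg_div_of_cross_pos {z₁ z₂ : ℂ} (h1 : 0 ≤ z₁.arg) (h2 : z₂.arg ≤ 0)
    (h : 0 < cross z₂ z₁) : (z₁ / z₂).arg = z₁.arg - z₂.arg := by
  have hz1 : z₁ ≠ 0 := by rintro rfl; simp [cross_eq] at h
  have hz2 : z₂ ≠ 0 := by rintro rfl; simp [cross_eq] at h
  have hpi := Real.pi_pos
  refine arg_div_of_sin hz1 hz2 (by linarith) ?_
  rw [cross_eq_sin] at h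
  by_contra hc
  push Not at hc
  have b1 := Complex.arg_le_pi z₁
  have b2 := Complex.neg_pi_lt_arg z₂
  have := Real.sin_nonpos_of_nonpos_of_neg_pi_le (x := z₁.arg - z₂.arg - 2 * Real.pi)
    (by linarith) (by linarith)
  rw [Real.sin_sub_two_pi] at this
  exact absurd h (not_lt.2 (mul_nonpos_of_nonneg_of_nonpos (by positivity) this))

lemma arg_div_of_cross_neg {z₁ z₂ : ℂ} (h1 : z₁.arg ≤ 0) (h2 : 0 ≤ z₂.arg)
    (h : cross z₂ z₁ < 0) : (z₁ / z₂).arg = z₁.arg - z₂.arg := by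
  have hz1 : z₁ ≠ 0 := by rintro rfl; simp [cross_eq] at h
  have hz2 : z₂ ≠ 0 := by rintro rfl; simp [cross_eq] at h
  have hpi := Real.pi_pos
  refine arg_div_of_sin hz1 hz2 ?_ (by linarith)
  rw [cross_eq_sin] at h
  by_contra hc
  push Not at hc
  have b1 := Complex.neg_pi_lt_arg z₁
  have b2 := Complex.arg_le_pi z₂
  have := Real.sin_nonneg_of_nonneg_of_le_pi (x := z₁.arg - z₂.arg + 2 * Real.pi)
    (by linarith) (by linarith)
  rw [Real.sin_add_two_pi] at this
  exact absurd h (not_lt.2 (mul_nonneg (by positivity) this))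

lemma reflect_div {σ : ℝ} (hσ : σ = 1 ∨ σ = -1) (x y : ℂ) :
    reflect σ (x / y) = reflect σ x / reflect σ y := by
  have h1 : ∀ z, reflect 1 z = z := fun z => by simp [reflect]
  have h2 : ∀ z, reflect (-1) z = conj z := fun z => by
    apply Complex.ext <;> simp [reflect]
  rcases hσ with rfl | rfl
  · simp only [h1]
  · simp only [h2, map_div₀]

/-- The directed angle between two directions as a difference of tilts. -/
lemma angleOn_eq_sub {ξ x y : ℂ} (hσ : σ = 1 ∨ σ = -1) (hξ : ξ ≠ 0)
    (h : 0 ≤ angleOn σ ξ x ∧ angleOn σ ξ y ≤ 0 ∧ 0 < σ * cross y x ∨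
      angleOn σ ξ x ≤ 0 ∧ 0 ≤ angleOn σ ξ y ∧ σ * cross y x < 0) :
    angleOn σ y x = angleOn σ ξ x - angleOn σ ξ y := by
  have hN : 0 < Complex.normSq ξ := Complex.normSq_pos.2 hξ
  have e : reflect σ (x / y) = reflect σ (x / ξ) / reflect σ (y / ξ) := by
    rw [← reflect_div hσ, div_div_div_cancel_right₀ hξ]
  rw [angleOn, e]
  rcases h with ⟨h1, h2, h3⟩ | ⟨h1, h2, h3⟩
  · refine arg_div_of_cross_pos h1 h2 ?_
    rw [cross_reflect_div]; positivity
  · refine arg_div_of_cross_neg h1 h2 ?_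
    rw [cross_reflect_div]; exact div_neg_of_neg_of_pos h3 hN

lemma Chain.nonneg {k : ℕ} (h : Chain m w σ k) : 0 ≤ σ * orient (w 0) (w m) (w k) := by
  rcases h with rfl | rfl | h
  · simp [orient_eq]
  · simp [orient_eq, mul_comm]
  · exact le_of_lt h

lemma angleOn_nonneg {ξ x : ℂ} (hξ : ξ ≠ 0) (h : 0 ≤ σ * cross ξ x) : 0 ≤ angleOn σ ξ x := by
  have hN : 0 < Complex.normSq ξ := Complex.normSq_pos.2 hξ
  refine Complex.arg_nonneg_iff.2 ?_
  rw [im_reflect_div]; positivity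

lemma angleOn_neg {ξ x : ℂ} (hξ : ξ ≠ 0) (h : σ * cross ξ x < 0) : angleOn σ ξ x < 0 := by
  have hN : 0 < Complex.normSq ξ := Complex.normSq_pos.2 hξ
  refine Complex.arg_neg_iff.2 ?_
  rw [im_reflect_div]; exact div_neg_of_neg_of_pos h hN

lemma angleOn_self {ξ : ℂ} (hξ : ξ ≠ 0) : angleOn σ ξ ξ = 0 := by
  have : reflect σ (1 : ℂ) = 1 := by apply Complex.ext <;> simp [reflect]
  rw [angleOn, div_self hξ, this, Complex.arg_one]

lemma cross_edgeDir_first (g : IsGuide m w) (hσ : σ = 1 ∨ σ = -1) :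
    0 < σ * cross (edgeDir m w (-σ) 0) (edgeDir m w σ 0) := by
  have h := cross_pos_of_dirAngle (opening_first_pos g) (opening_zero_lt_pi g)
  rcases hσ with rfl | rfl
  · rwa [one_mul]
  · rw [neg_neg, cross_swap]; linarith

lemma cross_edgeDir_last (g : IsGuide m w) (hσ : σ = 1 ∨ σ = -1) :
    σ * cross (edgeDir m w (-σ) (m - 1)) (edgeDir m w σ (m - 1)) < 0 := by
  have h := cross_neg_of_dirAngle (opening_last_neg g)
  rcases hσ with rfl | rfl
  · rwa [one_mul]
  · rw [neg_neg, cross_swap]; linarith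

/-- At the head the two first edges point weakly to different sides of the axis, so their tilts
subtract without wrapping around. -/
lemma opening_first_eq_tilt (g : IsGuide m w) (hσ : σ = 1 ∨ σ = -1) :
    opening m w 0 = angleOn σ (w m - w 0) (edgeDir m w σ 0) -
      angleOn σ (w m - w 0) (edgeDir m w (-σ) 0) := by
  have hm := g.two_le
  have hξ : w m - w 0 ≠ 0 := sub_ne_zero.2 (g.ne le_rfl (Nat.zero_le _) (by omega))
  rw [opening_eq hσ]
  obtain ⟨-, f1, f2, f3⟩ := first_edges (σ := -σ) g
  have h2 := (edge_spec (w := w) (σ := -σ) (by omega : 0 < m)).1.right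
  refine angleOn_eq_sub hσ hξ (Or.inl ⟨?_, ?_, cross_edgeDir_first g hσ⟩)
  · rw [(first_edges (σ := σ) g).2.2.2]
    exact angleOn_nonneg hξ (edge_spec (w := w) (σ := σ) (by omega : 0 < m)).1.right.nonneg
  · rw [f3]
    rcases h2 with h2 | h2 | h2
    · omega
    · rw [h2, angleOn_self hξ]
    · refine (angleOn_neg hξ ?_).le
      have : 0 < -σ * cross (w m - w 0) (w (edgeEnd m w (-σ) 0) - w 0) := h2
      linarith

lemma opening_last_eq_tilt (g : IsGuide m w) (hσ : σ = 1 ∨ σ = -1) :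
    opening m w (m - 1) = angleOn σ (w m - w 0) (edgeDir m w σ (m - 1)) -
      angleOn σ (w m - w 0) (edgeDir m w (-σ) (m - 1)) := by
  have hm := g.two_le
  have hξ : w m - w 0 ≠ 0 := sub_ne_zero.2 (g.ne le_rfl (Nat.zero_le _) (by omega))
  rw [opening_eq hσ]
  obtain ⟨-, f1, f3⟩ := last_edges (σ := σ) g
  have h2 := (edge_spec (w := w) (σ := σ) (by omega : m - 1 < m)).1.left
  have hcr : ∀ k, cross (w m - w 0) (w m - w k) = -orient (w 0) (w m) (w k) := by
    intro k
    have : w m - w k = (w m - w 0) - (w k - w 0) := by ring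
    rw [this, cross_sub_right, cross_self, zero_sub, orient]
  refine angleOn_eq_sub hσ hξ (Or.inr ⟨?_, ?_, cross_edgeDir_last g hσ⟩)
  · rw [f3]
    rcases h2 with h2 | h2 | h2
    · rw [h2, angleOn_self hξ]
    · omega
    · refine (angleOn_neg hξ ?_).le
      rw [hcr]; unfold Side at h2; linarith
  · rw [(last_edges (σ := -σ) g).2.2]
    refine angleOn_nonneg hξ ?_
    have := (edge_spec (w := w) (σ := -σ) (by omega : m - 1 < m)).1.left.nonneg
    rw [hcr]; linarith

end Guide

/-! ### The aspect angles -/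

section Aspect

variable {N : ℕ} {p : ℕ → ℂ}

open Classical in
/-- The indices of the crossing links. -/
def crossings (N : ℕ) (p : ℕ → ℂ) (k : ℕ) : List ℕ :=
  (List.range k).filter fun i => decide (IsCrossing N p i)

lemma mem_crossings {k i : ℕ} : i ∈ crossings N p k ↔ i < k ∧ IsCrossing N p i := by
  classical
  rw [crossings, List.mem_filter, List.mem_range, decide_eq_true_iff]

lemma crossings_pairwise (k : ℕ) : (crossings N p k).Pairwise (· < ·) := by
  classical
  exact List.Pairwise.filter _ List.pairwise_lt_range

lemma breaks_eq : breaks N p =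
    0 :: (crossings N p (guideLen N p - 1) ++ [guideLen N p - 2]) := rfl

lemma numLocales_eq : numLocales N p = (crossings N p (guideLen N p - 1)).length + 1 := by
  simp [numLocales, breaks_eq]

/-- The crossing links are listed in increasing order, so the entry after the initial 0 is the first
of them, or the last link of the guide path if there is none. -/
lemma breaks_one : ((breaks N p).getD 1 0 = guideLen N p - 2 ∨
      (breaks N p).getD 1 0 ∈ crossings N p (guideLen N p - 1)) ∧
    ∀ i ∈ crossings N p (guideLen N p - 1), (breaks N p).getD 1 0 ≤ i := by
  have hs := crossings_pairwise (N := N) (p := p) (guideLen N p - 1)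
  rw [breaks_eq]
  cases hL : crossings N p (guideLen N p - 1) with
  | nil => simp
  | cons l L =>
    rw [hL] at hs
    have := (List.pairwise_cons.1 hs).1
    constructor
    · simp
    · intro i hi
      rcases List.mem_cons.1 hi with rfl | h
      · simp
      · simpa using (this i h).le

lemma breaks_last : (breaks N p).getD (numLocales N p) 0 = guideLen N p - 2 := by
  rw [numLocales_eq, breaks_eq]; simp

lemma breaks_pred_last : ((breaks N p).getD (numLocales N p - 1) 0 = 0 ∨
      (breaks N p).getD (numLocales N p - 1) 0 ∈ crossings N p (guideLen N p - 1)) ∧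
    ∀ i ∈ crossings N p (guideLen N p - 1), i ≤ (breaks N p).getD (numLocales N p - 1) 0 := by
  have hs := crossings_pairwise (N := N) (p := p) (guideLen N p - 1)
  rw [numLocales_eq, breaks_eq, Nat.add_sub_cancel]
  rcases List.eq_nil_or_concat (crossings N p (guideLen N p - 1)) with hL | ⟨L, l, hL⟩
  · rw [hL]; simp
  · rw [List.concat_eq_append] at hL
    rw [hL] at hs ⊢
    have := (List.pairwise_append.1 hs).2.2
    have e : (0 :: (L ++ [l] ++ [guideLen N p - 2])).getD (L ++ [l]).length 0 = l := by simp
    rw [e]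
    refine ⟨Or.inr (by simp), fun i hi => ?_⟩
    rcases List.mem_append.1 hi with h | h
    · exact (this i h l (by simp)).le
    · simp at h; omega

variable (hp : IsOpenSimpleNonSegment N p)
include hp

lemma IsOpenSimpleNonSegment.isCrossing_iff {i : ℕ} (hi : i < guideLen N p - 1) :
    IsCrossing N p i ↔ orient (gnode N p 0) (gnode N p (guideLen N p - 1)) (gnode N p i) *
      orient (gnode N p 0) (gnode N p (guideLen N p - 1)) (gnode N p (i + 1)) < 0 := by
  rw [IsCrossing, hp.hull_eq]
  exact hp.isArcThrough.isGuide.crossing_iff hi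

/-- The side of a node is determined by the parity of the number of preceding crossing links. -/
lemma IsOpenSimpleNonSegment.parity_crossings {k : ℕ} (h1 : 1 ≤ k) (hk : k < guideLen N p - 1) :
    0 < (-1 : ℝ) ^ (crossings N p k).length *
      (orient (gnode N p 0) (gnode N p (guideLen N p - 1)) (gnode N p 1) *
        orient (gnode N p 0) (gnode N p (guideLen N p - 1)) (gnode N p k)) := by
  classical
  have g := hp.isArcThrough.isGuide
  induction k, h1 using Nat.le_induction with
  | base =>
    have h0 : crossings N p 1 = [] := by
      rw [List.eq_nil_iff_forall_not_mem]
      intro i hi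
      obtain ⟨hi1, hi2⟩ := mem_crossings.1 hi
      obtain rfl : i = 0 := by omega
      rw [hp.isCrossing_iff (by omega)] at hi2
      simp [orient_eq] at hi2
    rw [h0, List.length_nil, pow_zero, one_mul]
    exact mul_self_pos.2 (g.axis_ne_zero one_pos hk)
  | succ k hk1 ih =>
    have ih := ih (by omega)
    have hc := hp.isCrossing_iff (i := k) (by omega)
    have n1 := g.axis_ne_zero (i := k) (by omega) (by omega)
    have n2 := g.axis_ne_zero (i := k + 1) (by omega) hk
    have hsucc : crossings N p (k + 1) = crossings N p k ++
        (if IsCrossing N p k then [k] else []) := by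
      rw [crossings, List.range_succ, List.filter_append, crossings]
      congr 1
      by_cases h : IsCrossing N p k <;> simp [h]
    set c1 := orient (gnode N p 0) (gnode N p (guideLen N p - 1)) (gnode N p 1)
    set ck := orient (gnode N p 0) (gnode N p (guideLen N p - 1)) (gnode N p k)
    set cs := orient (gnode N p 0) (gnode N p (guideLen N p - 1)) (gnode N p (k + 1))
    set e := (-1 : ℝ) ^ (crossings N p k).length
    have hk2 : 0 < ck ^ 2 := by positivity
    by_cases h : IsCrossing N p k
    · rw [hsucc, if_pos h, List.length_append, List.length_singleton, pow_succ]
      have h2 := hc.1 h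
      -- Multiplication by the square lets the sign of c1 * cs be read off from those of c1 * ck and
      -- ck * cs.
      have h3 : 0 < (e * -1 * (c1 * cs)) * ck ^ 2 := by
        have : (e * -1 * (c1 * cs)) * ck ^ 2 = (e * (c1 * ck)) * -(ck * cs) := by ring
        rw [this]; exact mul_pos ih (neg_pos.2 h2)
      exact pos_of_mul_pos_left h3 hk2.le
    · rw [hsucc, if_neg h, List.append_nil]
      have h2 : 0 < ck * cs := lt_of_le_of_ne (not_lt.1 fun h' => h (hc.2 h'))
        (mul_ne_zero n1 n2).symm
      have h3 : 0 < (e * (c1 * cs)) * ck ^ 2 := by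
        have : (e * (c1 * cs)) * ck ^ 2 = (e * (c1 * ck)) * (ck * cs) := by ring
        rw [this]; exact mul_pos ih h2
      exact pos_of_mul_pos_left h3 hk2.le

/-- The tilts as directed angles from the axis. -/
lemma IsOpenSimpleNonSegment.exists_tilt_eq : ∃ σ : ℝ, (σ = 1 ∨ σ = -1) ∧
    Side (guideLen N p - 1) (gnode N p) σ 1 ∧
    ∀ j, tilt N p j = angleOn σ (gnode N p (guideLen N p - 1) - gnode N p 0)
      ((base N p j).2 - (base N p j).1) := by
  have g := hp.isArcThrough.isGuide
  have h3 := hp.three_le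
  have hc : cross (axis N p) (gnode N p 1 - head N p) =
    orient (gnode N p 0) (gnode N p (guideLen N p - 1)) (gnode N p 1) := rfl
  by_cases h : 0 < cross (axis N p) (gnode N p 1 - head N p)
  · refine ⟨1, Or.inl rfl, ?_, fun j => ?_⟩
    · rw [Side, one_mul, ← hc]; exact h
    · rw [tilt, if_pos h, angleOn_one]; rfl
  · refine ⟨-1, Or.inr rfl, ?_, fun j => ?_⟩
    · have hne := g.axis_ne_zero (i := 1) one_pos (by omega)
      rw [hc] at h
      have := lt_of_le_of_ne (not_lt.1 h) hne
      unfold Side; linarith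
    · rw [tilt, if_neg h, angleOn, dirAngle, ← map_div₀]
      congr 1
      apply Complex.ext
      · rw [Complex.conj_re]; rfl
      · rw [Complex.conj_im, reflect, neg_one_mul]; rfl

/-- On the side σ of X the first edge is HX; on the other side it is the base of the first locale.
The opening at 0 is the difference of their tilts. -/
lemma IsOpenSimpleNonSegment.aspectL_eq :
    aspectL N p = opening (guideLen N p - 1) (gnode N p) 0 := by
  have g := hp.isArcThrough.isGuide
  have h3 := hp.three_le
  obtain ⟨σ, hσ, hs, ht⟩ := hp.exists_tilt_eq
  obtain ⟨hb1, hb2⟩ := breaks_one (N := N) (p := p)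
  set b := (breaks N p).getD 1 0 with hb
  have hbm : b < guideLen N p - 1 := by
    rcases hb1 with h | h
    · omega
    · exact (mem_crossings.1 h).1
  obtain ⟨e1, e2⟩ := edgeEnd_zero g hσ hs hbm
    (hb1.imp (fun h => by omega) fun h => (hp.isCrossing_iff hbm).1 (mem_crossings.1 h).2)
    (fun i hi => by
      by_contra hc
      have := hb2 i (mem_crossings.2 ⟨by omega, (hp.isCrossing_iff (by omega)).2 (not_le.1 hc)⟩)
      omega)
  have base0 : base N p 0 = (gnode N p 0, gnode N p 1) := by simp [base]
  have base1 : base N p 1 = (gnode N p 0, gnode N p (b + 1)) := by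
    have : 1 ≤ numLocales N p := by rw [numLocales_eq]; omega
    rw [base, if_neg one_ne_zero, if_pos this, hb]
    simp [breaks_eq]
  rw [aspectL, ht, ht, base0, base1, opening_first_eq_tilt g hσ, (first_edges g).2.2.2,
    (first_edges g).2.2.2, e1, e2]

/-- Each crossing link changes the side, so Y lies on the side of X exactly when J is odd. This
decides which of YT and the last base is the last edge on the side of X, and it accounts for the two
cases in the definition of φ_R. -/
lemma IsOpenSimpleNonSegment.aspectR_eq :
    aspectR N p = opening (guideLen N p - 1) (gnode N p) (guideLen N p - 1 - 1) := by
  have g := hp.isArcThrough.isGuide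
  have h3 := hp.three_le
  obtain ⟨σ, hσ, hs, ht⟩ := hp.exists_tilt_eq
  obtain ⟨hb1, hb2⟩ := breaks_pred_last (N := N) (p := p)
  set a := (breaks N p).getD (numLocales N p - 1) 0 with ha
  have ham : a < guideLen N p - 1 := by
    rcases hb1 with h | h
    · omega
    · exact (mem_crossings.1 h).1
  have hcr := hb1.imp_right fun h => (hp.isCrossing_iff ham).1 (mem_crossings.1 h).2
  have hmax : ∀ i, a < i → i < guideLen N p - 1 →
      0 ≤ orient (gnode N p 0) (gnode N p (guideLen N p - 1)) (gnode N p i) *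
        orient (gnode N p 0) (gnode N p (guideLen N p - 1)) (gnode N p (i + 1)) := by
    intro i hi him
    by_contra hc
    have := hb2 i (mem_crossings.2 ⟨him, (hp.isCrossing_iff him).2 (not_le.1 hc)⟩)
    omega
  have hJ : 1 ≤ numLocales N p := by rw [numLocales_eq]; omega
  have baseJ : base N p (numLocales N p) = (gnode N p a, gnode N p (guideLen N p - 1)) := by
    rw [base, if_neg (by omega), if_pos le_rfl, breaks_last,
      show guideLen N p - 2 + 1 = guideLen N p - 1 by omega]
  have baseJ' : base N p (numLocales N p + 1) =
      (gnode N p (guideLen N p - 1 - 1), gnode N p (guideLen N p - 1)) := by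
    rw [base, if_neg (by omega), if_neg (by omega)]; rfl
  have hpar := hp.parity_crossings (k := guideLen N p - 1 - 1) (by omega) (by omega)
  -- The last link ends in the tail, where the signed area vanishes, so it is not a crossing link
  -- and can be dropped from the count.
  have hlast : ¬ IsCrossing N p (guideLen N p - 1 - 1) := by
    rw [hp.isCrossing_iff (by omega), show guideLen N p - 1 - 1 + 1 = guideLen N p - 1 by omega]
    have : orient (gnode N p 0) (gnode N p (guideLen N p - 1))
      (gnode N p (guideLen N p - 1)) = 0 := by simp only [orient_eq]; ring
    rw [this, mul_zero]; exact lt_irrefl 0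
  have hlen : crossings N p (guideLen N p - 1) = crossings N p (guideLen N p - 1 - 1) := by
    classical
    conv_lhs => rw [crossings, show guideLen N p - 1 = guideLen N p - 1 - 1 + 1 by omega]
    rw [List.range_succ, List.filter_append, crossings]
    simp [hlast]
  have hside : Side (guideLen N p - 1) (gnode N p)
      ((-1) ^ (crossings N p (guideLen N p - 1)).length * σ) (guideLen N p - 1 - 1) := by
    rw [← hlen] at hpar
    unfold Side at hs ⊢
    set c1 := orient (gnode N p 0) (gnode N p (guideLen N p - 1)) (gnode N p 1)
    set e := (-1 : ℝ) ^ (crossings N p (guideLen N p - 1)).length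
    set cl := orient (gnode N p 0) (gnode N p (guideLen N p - 1))
      (gnode N p (guideLen N p - 1 - 1))
    have hc1 : c1 ≠ 0 := by
      intro h0; rw [h0, mul_zero] at hs; exact lt_irrefl 0 hs
    have hp2 : 0 < c1 ^ 2 := by positivity
    have h4 : 0 < (e * σ * cl) * c1 ^ 2 := by
      have : (e * σ * cl) * c1 ^ 2 = (e * (c1 * cl)) * (σ * c1) := by ring
      rw [this]; exact mul_pos hpar hs
    exact pos_of_mul_pos_left h4 hp2.le
  rw [aspectR, ht, ht, baseJ, baseJ', opening_last_eq_tilt g hσ, (last_edges g).2.2,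
    (last_edges g).2.2]
  by_cases hev : Even (crossings N p (guideLen N p - 1)).length
  · have hodd : ¬ Even (numLocales N p) := by
      rw [numLocales_eq, Nat.even_add_one]; simpa using hev
    rw [hev.neg_one_pow, one_mul] at hside
    obtain ⟨e1, e2⟩ := edgeStart_last g hσ hside ham hcr hmax
    rw [if_neg hodd, e1, e2]
  · have heven : Even (numLocales N p) := by
      rw [numLocales_eq, Nat.even_add_one]; exact hev
    rw [(Nat.not_even_iff_odd.1 hev).neg_one_pow, neg_one_mul] at hside
    obtain ⟨e1, e2⟩ := edgeStart_last g (neg_sign hσ) hside ham hcr hmax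
    rw [neg_neg] at e2
    rw [if_pos heven, e1, e2]

end Aspect

end LambdaArc

end

theorem theorem3 (N : ℕ) (p : ℕ → ℂ) (hp : LambdaArc.IsOpenSimpleNonSegment N p)
    (φ : ℝ) (hφ : 0 ≤ φ) :
    0 < LambdaArc.aspectL N p ∧ LambdaArc.aspectR N p < 0 ∧
    -- A
    (φ = 0 → (LambdaArc.lambdaPairs N p φ).encard = 1) ∧
    -- B
    (0 < φ → φ ≤ min (LambdaArc.aspectL N p) |LambdaArc.aspectR N p| →
      ∃ (m₁ n₁ m₂ n₂ : AffineSubspace ℝ ℂ) (P₁ P₂ : ℂ),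
        s(m₁, n₁) ≠ s(m₂, n₂) ∧
        LambdaArc.lambdaPairs N p φ = {s(m₁, n₁), s(m₂, n₂)} ∧
        LambdaArc.MeetsBeyond (LambdaArc.hull N p) m₁ n₁ P₁ (LambdaArc.head N p) ∧
        (P₁ = LambdaArc.head N p ↔ φ = LambdaArc.aspectL N p) ∧
        LambdaArc.MeetsBeyond (LambdaArc.hull N p) m₂ n₂ P₂ (LambdaArc.tail N p) ∧
        (P₂ = LambdaArc.tail N p ↔ φ = |LambdaArc.aspectR N p|)) ∧
    -- C
    (min (LambdaArc.aspectL N p) |LambdaArc.aspectR N p| < φ →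
      φ ≤ max (LambdaArc.aspectL N p) |LambdaArc.aspectR N p| →
      (LambdaArc.lambdaPairs N p φ).encard = 1) ∧
    -- D
    (max (LambdaArc.aspectL N p) |LambdaArc.aspectR N p| < φ →
      LambdaArc.lambdaPairs N p φ = ∅) := by
  have g := hp.isArcThrough.isGuide
  rw [hp.aspectL_eq, hp.aspectR_eq, hp.lambdaPairs_eq, hp.hull_eq]
  exact ⟨LambdaArc.opening_first_pos g, LambdaArc.opening_last_neg g,
    LambdaArc.nodePairs_count g hφ⟩
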